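/- Let $n\ge 1$ and let $M$ be a closed (compact, Hausdorff, without boundary) orientable smooth $n$-manifold, not necessarily connected, with $H_{n-1}(M;\mathbb{Z})=0$ (singular homology). Let $\Sigma\subset M$ be a nonempty closed (that is, compact, without boundary) orientable smoothly embedded hypersurface of dimension $n-1$, possibly disconnected. For subsets $S,K_1,K_2\subset M$, say that $S$ separates $K_1$ and $K_2$ if there are two distinct connected components $A\neq B$ of $M\setminus S$ with $K_1\subset A$ and $K_2\subset B$. If $K_1$ and $K_2$ are closed subsets of $M$ such that $\Sigma$ separates $K_1$ and $K_2$, then there is a connected component $\Sigma_0$ of $\Sigma$ which separates $K_1$ and $K_2$. -/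

import Mathlib

open scoped Manifold ContDiff

universe u

/-- The singular homology group `H_k(X; ℤ)`. -/
noncomputable def integralHomology (k : ℕ) (X : Type u) [TopologicalSpace X] : ModuleCat.{u} ℤ :=
  ((AlgebraicTopology.singularHomologyFunctor (ModuleCat.{u} ℤ) k).obj
    (ModuleCat.of ℤ (ULift.{u} ℤ))).obj (TopCat.of X)

/-- A smooth `d`-manifold is orientable if it can be covered by charts of its smooth structure
all of whose transition maps have positive Jacobian determinant. -/
def IsOrientableManifold (d : ℕ) (X : Type u) [TopologicalSpace X]
    [ChartedSpace (EuclideanSpace ℝ (Fin d)) X] : Prop :=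
  ∃ A : Set (OpenPartialHomeomorph X (EuclideanSpace ℝ (Fin d))),
    A ⊆ IsManifold.maximalAtlas (𝓡 d) ∞ X ∧
    (∀ x : X, ∃ e ∈ A, x ∈ e.source) ∧
    ∀ e ∈ A, ∀ e' ∈ A, ∀ y ∈ (e.symm.trans e').source,
      0 < (fderiv ℝ (e.symm.trans e') y).det

/-- `S` separates `K₁` and `K₂` if `K₁` and `K₂` lie in different connected components of the
complement of `S`. -/
def Separates {X : Type u} [TopologicalSpace X] (S K₁ K₂ : Set X) : Prop :=
  ∃ x ∈ Sᶜ, ∃ y ∈ Sᶜ, K₁ ⊆ connectedComponentIn Sᶜ x ∧ K₂ ⊆ connectedComponentIn Sᶜ y ∧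
    connectedComponentIn Sᶜ x ≠ connectedComponentIn Sᶜ y

/-!
Each component of `S` is a closed oriented hypersurface, hence carries a fundamental cycle `c`. As the
homology of `M` vanishes in that degree, `c` bounds a chain `d` of `M`. Off the component, the
property "the class of `d` modulo two is zero in the local homology of `M` at `x`" is locally constant
in `x`, since the boundary of `d` stays away from `x`; across the component it changes, since `c` is
nonzero in the local homology of `S` at each of its points. So this property, a winding number modulo
two, tells the two local sides of the component apart (`Chain.twoSided_nullIn`), and it is constant
on the connected components of the complement of that component.

Now suppose that no component of `S` separates two points `x` and `y` of the complement of `S`. Then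
`x` and `y` have the same winding number with respect to each component. Cut `M` along the finitely
many components, one after the other. When an open connected piece that contains `x` and `y` is
cut along the next component `T`, both the part with `x` and the part with `y` accumulate at all of
`T`, because `T` is connected. Each of them contains one of the two sides of `T` at a given point, and
by the equality of winding numbers the same one, so that they coincide
(`TwoSided.connectedComponentIn_sdiff_eq`). In the end `x` and `y` lie in the same component of the
complement of `S`.

The homology used here is developed directly at the level of singular chains. Subdivision and the
prism operator give small chains (`Chain.exists_split`), from which homotopy invariance, excision and
both halves of the Mayer–Vietoris argument follow for the relation `Chain.NullIn`. The homology of a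
punctured vector space is computed by induction on suspensions. Fundamental cycles are glued from
local orientations in `Chain.exists_fundamental`, where `Chain.isBdry_push_octa` shows that charts with
positive transition determinant define the same orientation. The change of the winding number across
`S` is `Chain.nullIn_of_nullIn_iff` in the flat case, and the vanishing of Mathlib's singular homology
is translated into a statement on chains in `Chain.exists_bd_eq_of_isZero`.
-/

/-! ### Linear chains and barycentric subdivision -/

/-- The standard simplex with `n` vertices. Chains are indexed by the number of vertices, not by the
dimension, so that all complexes are augmented: the empty simplex spans degree `0`, points are in
degree `1`, and `n`-dimensional chains are in degree `n + 1`. -/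
abbrev Simp (n : ℕ) : Type := stdSimplex ℝ (Fin n)

/-- Formal combinations of `m`-tuples of points of `V`, thought of as the vertices of simplices. -/
abbrev LinChain (R : Type*) [CommRing R] (m : ℕ) (V : Type*) := (Fin m → V) →₀ R

/-- Formal combinations of all maps, continuous or not, from a simplex with `m` vertices to `X`;
the singular chains of a subset are singled out by `sing`. -/
abbrev Chain (R : Type*) [CommRing R] (m : ℕ) (X : Type*) := (Simp m → X) →₀ R

namespace LinChain

variable {R : Type*} [CommRing R] {m n : ℕ} {V W : Type*}

/-- The alternating sum of the faces of a tuple. -/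
noncomputable def bd : LinChain R (m + 1) V →ₗ[R] LinChain R m V :=
  ∑ i : Fin (m + 1), (-1 : R) ^ (i : ℕ) • Finsupp.lmapDomain R R (fun v => v ∘ i.succAbove)

/-- The map induced on linear chains by a map of points. -/
noncomputable def map (φ : V → W) : LinChain R m V →ₗ[R] LinChain R m W :=
  Finsupp.lmapDomain R R (fun v => φ ∘ v)

/-- The join of a linear chain with an apex `a`. -/
noncomputable def cone (a : V) : LinChain R m V →ₗ[R] LinChain R (m + 1) V :=
  Finsupp.lmapDomain R R (fun v => (Fin.cons a v : Fin (m + 1) → V))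

@[simp] lemma bd_single (v : Fin (m + 1) → V) (r : R) :
    bd (Finsupp.single v r) =
      ∑ i : Fin (m + 1), Finsupp.single (v ∘ i.succAbove) ((-1 : R) ^ (i : ℕ) * r) := by
  simp [bd, LinearMap.sum_apply, Finsupp.smul_single]

@[simp] lemma map_single (φ : V → W) (v : Fin m → V) (r : R) :
    map φ (Finsupp.single v r) = Finsupp.single (φ ∘ v) r := by
  simp [map]

@[simp] lemma cone_single (a : V) (v : Fin m → V) (r : R) :
    cone a (Finsupp.single v r) = Finsupp.single (Fin.cons a v) r := by
  simp [cone]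

lemma bd_map (φ : V → W) (x : LinChain R (m + 1) V) : bd (map φ x) = map φ (bd x) := by
  induction x using Finsupp.induction_linear with
  | zero => simp
  | add x y hx hy => simp [hx, hy]
  | single v r => simp [-Finsupp.single_mul, map_sum, Function.comp_assoc]

lemma map_cone (φ : V → W) (a : V) (x : LinChain R m V) :
    map φ (cone a x) = cone (φ a) (map φ x) := by
  induction x using Finsupp.induction_linear with
  | zero => simp
  | add x y hx hy => simp [hx, hy]
  | single v r => simp [Fin.comp_cons]

lemma map_map {U : Type*} (ψ : W → U) (φ : V → W) (x : LinChain R m V) :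
    map ψ (map φ x) = map (ψ ∘ φ) x := by
  induction x using Finsupp.induction_linear with
  | zero => simp
  | add x y hx hy => simp [hx, hy]
  | single v r => simp [Function.comp_assoc]

lemma bd_cone (a : V) (x : LinChain R (m + 1) V) : bd (cone a x) = x - cone a (bd x) := by
  induction x using Finsupp.induction_linear with
  | zero => simp
  | add x y hx hy => simp only [map_add, hx, hy]; abel
  | single v r =>
    have h : ∀ i : Fin (m + 1), (Fin.cons a v : Fin (m + 2) → V) ∘ i.succ.succAbove =
        Fin.cons a (v ∘ i.succAbove) := by
      intro i
      ext j
      refine Fin.cases ?_ (fun j => ?_) j <;> simp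
    have h0 : (Fin.cons a v : Fin (m + 2) → V) ∘ Fin.succ = v := by ext j; simp
    rw [cone_single, bd_single, Fin.sum_univ_succ]
    simp [-Finsupp.single_mul, h, h0, pow_succ, map_sum, sub_eq_add_neg, Finsupp.single_neg]

lemma bd_cone_zero (a : V) (x : LinChain R 0 V) : bd (cone a x) = x := by
  induction x using Finsupp.induction_linear with
  | zero => simp
  | add x y hx hy => simp only [map_add, hx, hy]
  | single v r => simp

lemma bd_bd (x : LinChain R (m + 2) V) : bd (bd x) = 0 := by
  induction m with
  | zero =>
    induction x using Finsupp.induction_linear with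
    | zero => simp
    | add x y hx hy => simp only [map_add, hx, hy, add_zero]
    | single v r =>
      rw [show Finsupp.single v r = cone (v 0) (Finsupp.single (Fin.tail v) r) by simp, bd_cone,
        map_sub, bd_cone_zero, sub_self]
  | succ m ih =>
    induction x using Finsupp.induction_linear with
    | zero => simp
    | add x y hx hy => simp only [map_add, hx, hy, add_zero]
    | single v r =>
      rw [show Finsupp.single v r = cone (v 0) (Finsupp.single (Fin.tail v) r) by simp, bd_cone,
        map_sub, bd_cone, ih, map_zero, sub_zero, sub_self]

/-- The linear map sending a simplex `v` to the cone of `G v` with apex `β v`. -/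
noncomputable def coneExt (β : (Fin n → V) → W) (G : LinChain R n V →ₗ[R] LinChain R m W) :
    LinChain R n V →ₗ[R] LinChain R (m + 1) W :=
  Finsupp.linearCombination R (fun v => cone (β v) (G (Finsupp.single v 1)))

lemma coneExt_single (β : (Fin n → V) → W) (G : LinChain R n V →ₗ[R] LinChain R m W)
    (v : Fin n → V) : coneExt β G (Finsupp.single v 1) = cone (β v) (G (Finsupp.single v 1)) := by
  simp [coneExt]

/-- Two linear maps on linear chains agree if they do so on simplices. -/
lemma hom_ext {N : Type*} [AddCommGroup N] [Module R N] {f g : LinChain R m V →ₗ[R] N}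
    (h : ∀ v, f (Finsupp.single v 1) = g (Finsupp.single v 1)) : f = g :=
  Finsupp.lhom_ext' fun v => LinearMap.ext_ring (h v)

/-- A null-homotopy of the chain map `F`, which has to vanish in degree `0`: by recursion on the
degree, the simplex `v` is sent to the cone with apex `β v` of the cycle that has to be filled. -/
noncomputable def hty (β : ∀ m, (Fin (m + 1) → V) → W)
    (F : ∀ m, LinChain R m V →ₗ[R] LinChain R m W) :
    ∀ m, LinChain R m V →ₗ[R] LinChain R (m + 1) W
  | 0 => 0
  | m + 1 => coneExt (β m) (F (m + 1) - (hty β F m).comp bd)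

lemma bd_hty (β : ∀ m, (Fin (m + 1) → V) → W) (F : ∀ m, LinChain R m V →ₗ[R] LinChain R m W)
    (hF : ∀ m x, bd (F (m + 1) x) = F m (bd x)) (hF0 : F 0 = 0) :
    ∀ m x, bd (hty β F (m + 1) x) + hty β F m (bd x) = F (m + 1) x := by
  have key : ∀ m, (∀ x, bd (F (m + 1) x - hty β F m (bd x)) = 0) →
      ∀ x, bd (hty β F (m + 1) x) + hty β F m (bd x) = F (m + 1) x := by
    intro m hm
    suffices h : bd.comp (hty β F (m + 1)) + (hty β F m).comp bd = F (m + 1) from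
      fun x => LinearMap.congr_fun h x
    refine hom_ext fun v => ?_
    have := hm (Finsupp.single v 1)
    simp only [LinearMap.add_apply, LinearMap.comp_apply, hty, coneExt_single,
      LinearMap.sub_apply, bd_cone, this, map_zero, sub_zero, sub_add_cancel]
  intro m
  induction m with
  | zero => exact key 0 fun x => by simp [hty, hF, hF0]
  | succ m ih =>
    refine key (m + 1) fun x => ?_
    have := ih (bd x)
    rw [bd_bd, map_zero, add_zero] at this
    rw [map_sub, hF, this, sub_self]

lemma map_hty {V' W' : Type*} (φ : V → V') (ψ : W → W')
    (β : ∀ m, (Fin (m + 1) → V) → W) (β' : ∀ m, (Fin (m + 1) → V') → W')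
    (F : ∀ m, LinChain R m V →ₗ[R] LinChain R m W)
    (F' : ∀ m, LinChain R m V' →ₗ[R] LinChain R m W')
    (hβ : ∀ m v, ψ (β m v) = β' m (φ ∘ v)) (hF : ∀ m x, map ψ (F m x) = F' m (map φ x)) :
    ∀ m x, map ψ (hty β F m x) = hty β' F' m (map φ x)
  | 0, x => by simp [hty]
  | m + 1, x => by
    suffices h : (map ψ).comp (hty β F (m + 1)) = (hty β' F' (m + 1)).comp (map φ) from
      LinearMap.congr_fun h x
    refine hom_ext fun v => ?_
    simp only [LinearMap.comp_apply, map_single, hty, coneExt_single, map_cone, hβ,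
      LinearMap.sub_apply, map_sub, hF, map_hty φ ψ β β' F F' hβ hF m, ← bd_map]

end LinChain

/-- The convex combination of the points `v i` of a simplex with the weights `t i`. -/
noncomputable def mix {n m : ℕ} (v : Fin m → Simp n) (t : Simp m) : Simp n :=
  ⟨∑ i, t i • (v i : Fin n → ℝ),
    (convex_stdSimplex ℝ (Fin n)).sum_mem (fun i _ => t.2.1 i) t.2.2 (fun i _ => (v i).2)⟩

lemma coe_mix {n m : ℕ} (v : Fin m → Simp n) (t : Simp m) :
    ⇑(mix v t) = ∑ i, t i • ⇑(v i) := rfl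

lemma mix_map {n m k : ℕ} (v : Fin m → Simp n) (f : Fin k → Fin m) (t : Simp k) :
    mix v (stdSimplex.map f t) = mix (v ∘ f) t := by
  apply stdSimplex.ext
  simp only [coe_mix, stdSimplex.map_coe, FunOnFinite.linearMap_apply_apply, Finset.sum_smul,
    Function.comp_apply]
  rw [Finset.sum_congr rfl (fun i _ => Finset.sum_congr rfl
    (g := fun x => t x • ⇑(v (f x))) ?_)]
  · exact Finset.sum_fiberwise _ _ _
  · intro x hx
    simp at hx
    rw [hx]

lemma map_mix {n m k : ℕ} (v : Fin m → Simp n) (f : Fin n → Fin k) (t : Simp m) :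
    stdSimplex.map f (mix v t) = mix (stdSimplex.map f ∘ v) t := by
  apply stdSimplex.ext
  simp [coe_mix, stdSimplex.map_coe, map_sum]

lemma mix_vertex {n : ℕ} (t : Simp n) : mix stdSimplex.vertex t = t := by
  apply stdSimplex.ext
  ext j
  simp [coe_mix, Finset.sum_apply, Pi.single_apply]

lemma mix_const {n m : ℕ} (a : Simp n) (t : Simp m) : mix (fun _ => a) t = a := by
  apply stdSimplex.ext
  rw [coe_mix, ← Finset.sum_smul, stdSimplex.sum_eq_one, one_smul]

lemma continuous_mix {n m : ℕ} (v : Fin m → Simp n) : Continuous (mix v) := by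
  refine Continuous.subtype_mk (continuous_finsetSum _ fun i _ => ?_) _
  exact ((continuous_apply i).comp continuous_subtype_val).smul continuous_const

/-- A linear map sends `Finsupp.supported R R s` into a submodule if it does so for the basis
vectors indexed by `s`. -/
lemma Finsupp.map_mem_of_mem_supported {R A N : Type*} [CommRing R] [AddCommGroup N] [Module R N]
    {s : Set A} {P : Submodule R N} (G : (A →₀ R) →ₗ[R] N)
    (h : ∀ a ∈ s, G (Finsupp.single a 1) ∈ P) {x : A →₀ R} (hx : x ∈ Finsupp.supported R R s) :
    G x ∈ P := by
  rw [Finsupp.supported_eq_span_single] at hx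
  have : Submodule.span R ((fun i => Finsupp.single i (1 : R)) '' s) ≤ P.comap G := by
    rw [Submodule.span_le]
    rintro _ ⟨a, ha, rfl⟩
    exact h a ha
  exact this hx

namespace LinChain

variable {R : Type*} [CommRing R] {m n : ℕ}

/-- The barycentre of a nonempty tuple of points of a simplex. -/
noncomputable def bary (v : Fin (m + 1) → Simp n) : Simp n := mix v stdSimplex.barycenter

/-- Barycentric subdivision of linear chains in a simplex: the cone, with apex the barycentre, of the
subdivided boundary. -/
noncomputable def sd : ∀ m, LinChain R m (Simp n) →ₗ[R] LinChain R m (Simp n)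
  | 0 => LinearMap.id
  | m + 1 => coneExt bary ((sd m).comp bd)

lemma bd_sd : ∀ m (x : LinChain R (m + 1) (Simp n)), bd (sd (m + 1) x) = sd m (bd x)
  | 0, x => by
    suffices h : bd.comp (sd (R := R) (n := n) 1) = (sd 0).comp bd from LinearMap.congr_fun h x
    refine hom_ext fun v => ?_
    simp only [LinearMap.comp_apply, sd, coneExt_single, bd_cone_zero]
  | m + 1, x => by
    suffices h : bd.comp (sd (R := R) (n := n) (m + 2)) = (sd (m + 1)).comp bd from
      LinearMap.congr_fun h x
    refine hom_ext fun v => ?_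
    rw [LinearMap.comp_apply, sd, coneExt_single, bd_cone, LinearMap.comp_apply, bd_sd m, bd_bd,
      map_zero, map_zero, sub_zero]

lemma map_sd {k : ℕ} (f : Fin n → Fin k) :
    ∀ m (x : LinChain R m (Simp n)), map (stdSimplex.map f) (sd m x) = sd m (map (stdSimplex.map f) x)
  | 0, x => by simp [sd]
  | m + 1, x => by
    suffices h : (map (stdSimplex.map f)).comp (sd (R := R) (m + 1)) =
        (sd (m + 1)).comp (map (stdSimplex.map f)) from LinearMap.congr_fun h x
    refine hom_ext fun v => ?_
    simp only [LinearMap.comp_apply, map_single, sd, coneExt_single, map_cone, map_sd f m,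
      ← bd_map]
    rw [bary, map_mix, bary]

/-- The tuples with all points in `s` and all mutual distances at most `δ`. -/
def smallTuples (m : ℕ) (s : Set (Fin n → ℝ)) (δ : ℝ) : Set (Fin m → Simp n) :=
  {v | (∀ i, (v i : Fin n → ℝ) ∈ s) ∧ ∀ i j, dist (v i) (v j) ≤ δ}

/-- The vertices of an `m`-dimensional simplex of diameter `δ` are at distance at most
`m / (m + 1) * δ` from the barycentre. -/
lemma dist_bary_le (v : Fin (m + 1) → Simp n) {δ : ℝ} (hv : ∀ i j, dist (v i) (v j) ≤ δ)
    (j : Fin (m + 1)) : dist (v j) (bary v) ≤ m / (m + 1) * δ := by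
  have hb : ⇑(bary v) - ⇑(v j) = ((m : ℝ) + 1)⁻¹ • ∑ i, (⇑(v i) - ⇑(v j)) := by
    rw [bary, coe_mix]
    have hw : ∀ i, (stdSimplex.barycenter : Simp (m + 1)) i = ((m : ℝ) + 1)⁻¹ := fun i => by
      simp [DFunLike.coe, stdSimplex.barycenter]
    simp only [hw]
    rw [← Finset.smul_sum, Finset.sum_sub_distrib, Finset.sum_const, smul_sub]
    simp only [Finset.card_univ, Fintype.card_fin]
    congr 1
    rw [← Nat.cast_smul_eq_nsmul ℝ, smul_smul, Nat.cast_add, Nat.cast_one, inv_mul_cancel₀ (by positivity), one_smul]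
  have hd : ∀ i, ‖⇑(v i) - ⇑(v j)‖ = dist (v i) (v j) := fun i => by
    rw [Subtype.dist_eq, dist_eq_norm]; rfl
  rw [dist_comm, Subtype.dist_eq, dist_eq_norm]
  change ‖⇑(bary v) - ⇑(v j)‖ ≤ _
  rw [hb, norm_smul, Real.norm_of_nonneg (by positivity), div_eq_inv_mul, mul_assoc]
  refine mul_le_mul_of_nonneg_left ?_ (by positivity)
  refine (norm_sum_le _ _).trans ?_
  rw [← Finset.add_sum_erase _ _ (Finset.mem_univ j), sub_self, norm_zero, zero_add]
  refine (Finset.sum_le_card_nsmul _ _ δ fun i _ => (hd i).trans_le (hv i j)).trans ?_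
  simp

lemma bd_mem_smallTuples {s : Set (Fin n → ℝ)} {δ : ℝ} {v : Fin (m + 1) → Simp n}
    (hv : v ∈ smallTuples (m + 1) s δ) :
    bd (Finsupp.single v (1 : R)) ∈ Finsupp.supported R R (smallTuples m s δ) := by
  rw [bd_single]
  refine Submodule.sum_mem _ fun i _ => Finsupp.single_mem_supported _ _ ?_
  exact ⟨fun j => hv.1 _, fun j k => hv.2 _ _⟩

lemma sd_mem_smallTuples : ∀ (m : ℕ) {s : Set (Fin n → ℝ)} (_ : Convex ℝ s) {δ : ℝ} (_ : 0 ≤ δ)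
    {x : LinChain R m (Simp n)}, x ∈ Finsupp.supported R R (smallTuples m s δ) →
      sd m x ∈ Finsupp.supported R R (smallTuples m s (m / (m + 1) * δ))
  | 0, s, _, δ, _, x, _ => by
    have : smallTuples (n := n) 0 s ((0 : ℕ) / ((0 : ℕ) + 1) * δ) = Set.univ := by
      ext; simp [smallTuples]
    rw [this, Finsupp.supported_univ]
    trivial
  | m + 1, s, hs, δ, hδ, x, hx => by
    refine Finsupp.map_mem_of_mem_supported _ (fun v hv => ?_) hx
    have hle : (m : ℝ) / (m + 1) * δ ≤ ((m + 1 : ℕ) : ℝ) / ((m + 1 : ℕ) + 1) * δ := by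
      refine mul_le_mul_of_nonneg_right ?_ hδ
      push_cast
      rw [div_le_div_iff₀ (by positivity) (by positivity)]
      nlinarith
    -- the vertices of the faces stay in this ball, by convexity, so they are close to the apex
    set s' : Set (Fin n → ℝ) := s ∩ Metric.closedBall (bary v : Simp n) ((m : ℝ) / (m + 1) * δ)
    have hv' : v ∈ smallTuples (m + 1) s' δ :=
      ⟨fun i => ⟨hv.1 i, dist_bary_le v hv.2 i⟩, hv.2⟩
    have hs' : Convex ℝ s' := hs.inter (convex_closedBall _ _)
    have hsd := sd_mem_smallTuples m hs' hδ (bd_mem_smallTuples (R := R) hv')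
    rw [sd, coneExt_single, LinearMap.comp_apply]
    refine Finsupp.map_mem_of_mem_supported _ (fun w hw => ?_) hsd
    rw [cone_single]
    refine Finsupp.single_mem_supported _ _ ?_
    have hb : (bary v : Fin n → ℝ) ∈ s :=
      hs.sum_mem (fun i _ => stdSimplex.zero_le _ i) (stdSimplex.sum_eq_one _) (fun i _ => hv.1 i)
    have hwb : ∀ i, dist (w i) (bary v) ≤ ((m + 1 : ℕ) : ℝ) / ((m + 1 : ℕ) + 1) * δ :=
      fun i => (hw.1 i).2.trans hle
    refine ⟨fun i => ?_, fun i j => ?_⟩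
    · refine Fin.cases ?_ (fun i => ?_) i
      · exact hb
      · exact (hw.1 i).1
    · refine Fin.cases ?_ (fun i => ?_) i <;> refine Fin.cases ?_ (fun j => ?_) j
      · simp; positivity
      · simpa [dist_comm] using hwb j
      · simpa using hwb i
      · exact (hw.2 i j).trans hle

lemma iterate_sd_mem_smallTuples (m N : ℕ) :
    (sd m)^[N] (Finsupp.single stdSimplex.vertex (1 : R)) ∈ Finsupp.supported R R
      (smallTuples m Set.univ (((m : ℝ) / (m + 1)) ^ N * 2)) := by
  induction N with
  | zero =>
    refine Finsupp.single_mem_supported _ _ ⟨fun _ => trivial, fun i j => ?_⟩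
    rw [pow_zero, one_mul]
    have h : ∀ t : Simp m, dist (⇑t) 0 ≤ 1 := fun t => stdSimplex_subset_closedBall t.2
    refine (dist_triangle (⇑(stdSimplex.vertex i : Simp m)) 0 _).trans ?_
    rw [dist_comm 0]
    exact (add_le_add (h _) (h _)).trans (by norm_num)
  | succ N ih =>
    rw [Function.iterate_succ_apply', pow_succ', mul_assoc]
    exact sd_mem_smallTuples m convex_univ (by positivity) ih

lemma bd_iterate_sd (N m : ℕ) (x : LinChain R (m + 1) (Simp n)) :
    bd ((sd (m + 1))^[N] x) = (sd m)^[N] (bd x) := by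
  induction N generalizing x with
  | zero => rfl
  | succ N ih => rw [Function.iterate_succ_apply, ih, bd_sd, Function.iterate_succ_apply]

lemma map_iterate_sd (N : ℕ) {k : ℕ} (f : Fin n → Fin k) (m : ℕ) (x : LinChain R m (Simp n)) :
    map (stdSimplex.map f) ((sd m)^[N] x) = (sd m)^[N] (map (stdSimplex.map f) x) := by
  induction N generalizing x with
  | zero => rfl
  | succ N ih => rw [Function.iterate_succ_apply, ih, map_sd, Function.iterate_succ_apply]

end LinChain

/-! ### Singular chains -/

namespace Chain

variable {R : Type*} [CommRing R] {m n k : ℕ} {X Y Z : Type*}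

/-- The alternating sum of the faces of a simplex. -/
noncomputable def bd : Chain R (m + 1) X →ₗ[R] Chain R m X :=
  ∑ i : Fin (m + 1), (-1 : R) ^ (i : ℕ) •
    Finsupp.lmapDomain R R (fun σ => σ ∘ stdSimplex.map i.succAbove)

/-- The map induced on chains by a map of spaces. -/
noncomputable def push (f : X → Y) : Chain R m X →ₗ[R] Chain R m Y :=
  Finsupp.lmapDomain R R (fun σ => f ∘ σ)

lemma bd_single (σ : Simp (m + 1) → X) (r : R) :
    bd (Finsupp.single σ r) =
      ∑ i : Fin (m + 1),
        Finsupp.single (σ ∘ stdSimplex.map i.succAbove) ((-1 : R) ^ (i : ℕ) * r) := by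
  simp [bd, LinearMap.sum_apply, Finsupp.smul_single]

@[simp] lemma push_single (f : X → Y) (σ : Simp m → X) (r : R) :
    push f (Finsupp.single σ r) = Finsupp.single (f ∘ σ) r := by
  simp [push]

/-- Two linear maps on chains agree if they do so on simplices. -/
lemma hom_ext {N : Type*} [AddCommGroup N] [Module R N] {f g : Chain R m X →ₗ[R] N}
    (h : ∀ σ, f (Finsupp.single σ 1) = g (Finsupp.single σ 1)) : f = g :=
  Finsupp.lhom_ext' fun v => LinearMap.ext_ring (h v)

lemma bd_push (f : X → Y) (x : Chain R (m + 1) X) : bd (push f x) = push f (bd x) := by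
  induction x using Finsupp.induction_linear with
  | zero => simp
  | add x y hx hy => simp [hx, hy]
  | single v r => simp [-Finsupp.single_mul, bd_single, map_sum, Function.comp_assoc]

lemma push_push (g : Y → Z) (f : X → Y) (x : Chain R m X) : push g (push f x) = push (g ∘ f) x := by
  induction x using Finsupp.induction_linear with
  | zero => simp
  | add x y hx hy => simp [hx, hy]
  | single v r => simp [Function.comp_assoc]

@[simp] lemma push_id (x : Chain R m X) : push id x = x := by
  exact Finsupp.mapDomain_id

/-- The map on chains that replaces a simplex `σ` of `X` by the image of a fixed linear chain `a` of
`Δⁿ × Δ¹` under `(t, s) ↦ h s (σ t)`. Subdivision and prism operators have this form, which reduces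
their boundary formulas to those of the linear chain `a`. The points of `Δ¹` are read off by their
second barycentric coordinate. -/
noncomputable def op (h : ℝ → X → Y) (a : LinChain R m (Simp n × Simp 2)) :
    Chain R n X →ₗ[R] Chain R m Y :=
  Finsupp.linearCombination R fun σ =>
    Finsupp.lmapDomain R R
      (fun (w : Fin m → Simp n × Simp 2) t =>
        h (mix (Prod.snd ∘ w) t 1) (σ (mix (Prod.fst ∘ w) t))) a

lemma op_single_single (h : ℝ → X → Y) (w : Fin m → Simp n × Simp 2) (r s : R) (σ : Simp n → X) :
    op h (Finsupp.single w r) (Finsupp.single σ s) =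
      Finsupp.single (fun t => h (mix (Prod.snd ∘ w) t 1) (σ (mix (Prod.fst ∘ w) t))) (s * r) := by
  simp [op]

lemma op_add (h : ℝ → X → Y) (a b : LinChain R m (Simp n × Simp 2)) (c : Chain R n X) :
    op h (a + b) c = op h a c + op h b c := by
  induction c using Finsupp.induction_linear with
  | zero => simp
  | add x y hx hy => simp only [map_add, hx, hy]; abel
  | single v r => simp [op, Finsupp.mapDomain_add]

lemma op_smul (h : ℝ → X → Y) (r : R) (a : LinChain R m (Simp n × Simp 2)) (c : Chain R n X) :
    op h (r • a) c = r • op h a c := by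
  induction c using Finsupp.induction_linear with
  | zero => simp
  | add x y hx hy => simp only [map_add, hx, hy, smul_add]
  | single v s => simp [op, smul_comm r s]

/-- `op` as a linear map in the model chain. -/
noncomputable def opₗ (h : ℝ → X → Y) (c : Chain R n X) :
    LinChain R m (Simp n × Simp 2) →ₗ[R] Chain R m Y where
  toFun a := op h a c
  map_add' a b := op_add h a b c
  map_smul' r a := op_smul h r a c

lemma bd_op (h : ℝ → X → Y) (a : LinChain R (m + 1) (Simp n × Simp 2)) (c : Chain R n X) :
    bd (op h a c) = op h (LinChain.bd a) c := by
  suffices H : bd.comp (opₗ (m := m + 1) h c) = (opₗ h c).comp LinChain.bd from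
    LinearMap.congr_fun H a
  refine LinChain.hom_ext fun w => ?_
  simp only [LinearMap.comp_apply, opₗ, LinearMap.coe_mk, AddHom.coe_mk]
  suffices H : bd.comp (op h (Finsupp.single w 1)) =
      op (R := R) h (LinChain.bd (Finsupp.single w 1)) from LinearMap.congr_fun H c
  refine hom_ext fun σ => ?_
  change bd _ = opₗ h _ _
  rw [LinChain.bd_single, map_sum, op_single_single, bd_single]
  refine Finset.sum_congr rfl fun i _ => ?_
  change _ = op h _ _
  rw [op_single_single]
  congr 1
  · funext t
    simp [mix_map, Function.comp_assoc]
  · ring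

lemma op_comp_map (h : ℝ → X → Y) (a : LinChain R m (Simp n × Simp 2)) (f : Fin n → Fin k)
    (σ : Simp k → X) (s : R) :
    op h a (Finsupp.single (σ ∘ stdSimplex.map f) s) =
      op h (LinChain.map (Prod.map (stdSimplex.map f) id) a) (Finsupp.single σ s) := by
  induction a using Finsupp.induction_linear with
  | zero => simp [op]
  | add x y hx hy => simp only [map_add, op_add, hx, hy]
  | single w r =>
    rw [LinChain.map_single, op_single_single, op_single_single]
    congr 1
    funext t
    simp only [Function.comp_apply, map_mix]
    rfl

/-- A natural model for linear chains commutes with taking faces of singular simplices. -/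
lemma op_bd (h : ℝ → X → Y) (A : ∀ n, LinChain R k (Simp n) →ₗ[R] LinChain R m (Simp n × Simp 2))
    (hA : ∀ (n l : ℕ) (f : Fin n → Fin l) x,
      LinChain.map (Prod.map (stdSimplex.map f) id) (A n x) =
        A l (LinChain.map (stdSimplex.map f) x)) (c : Chain R (k + 1) X) :
    op h (A k (Finsupp.single stdSimplex.vertex 1)) (bd c) =
      op h (A (k + 1) (LinChain.bd (Finsupp.single stdSimplex.vertex 1))) c := by
  suffices H : (op h (A k (Finsupp.single stdSimplex.vertex 1))).comp bd =
      op h (A (k + 1) (LinChain.bd (Finsupp.single stdSimplex.vertex 1))) from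
    LinearMap.congr_fun H c
  refine hom_ext fun σ => ?_
  rw [LinearMap.comp_apply, bd_single, map_sum, LinChain.bd_single, map_sum]
  change _ = opₗ h _ _
  rw [map_sum]
  refine Finset.sum_congr rfl fun i _ => ?_
  change _ = op h _ _
  rw [op_comp_map, hA, LinChain.map_single]
  have hv : (stdSimplex.map i.succAbove : Simp k → Simp (k + 1)) ∘ stdSimplex.vertex =
      stdSimplex.vertex ∘ i.succAbove := by
    funext j
    simp
  rw [hv, mul_one]
  have e1 : (Finsupp.single σ ((-1 : R) ^ (i : ℕ))) = (-1 : R) ^ (i : ℕ) • Finsupp.single σ 1 := by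
    simp
  have e2 : (Finsupp.single ((stdSimplex.vertex : Fin (k + 1) → Simp (k + 1)) ∘ i.succAbove)
      ((-1 : R) ^ (i : ℕ))) = (-1 : R) ^ (i : ℕ) • Finsupp.single (stdSimplex.vertex ∘ i.succAbove) 1 := by
    simp
  rw [e1, e2, map_smul, map_smul, op_smul]

/-- On the face `Δⁿ × {s}` of the prism only the map `h s` matters. -/
lemma op_vertex (h : ℝ → X → Y) (s : Fin 2) (c : Chain R n X) (a : LinChain R m (Simp n)) :
    op h (LinChain.map (fun v => (v, stdSimplex.vertex s)) a) c =
      push (h (stdSimplex.vertex (S := ℝ) s 1))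
        (op (fun _ x => x) (LinChain.map (fun v => (v, stdSimplex.vertex 0)) a) c) := by
  induction c using Finsupp.induction_linear with
  | zero => simp
  | add x y hx hy => simp only [map_add, hx, hy]
  | single σ r =>
    induction a using Finsupp.induction_linear with
    | zero => simp [op]
    | add x y hx hy => simp only [map_add, op_add, hx, hy]
    | single w r' =>
      simp only [LinChain.map_single, op_single_single, push_single]
      congr 1
      funext t
      simp only [Function.comp_apply]
      congr 2
      exact (mix_const (stdSimplex.vertex s) t)

/-- The `N`-fold barycentric subdivision of singular chains. -/
noncomputable def subdiv (N : ℕ) : Chain R n X →ₗ[R] Chain R n X :=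
  op (fun _ x => x) (LinChain.map (fun v => (v, stdSimplex.vertex 0))
    ((LinChain.sd n)^[N] (Finsupp.single stdSimplex.vertex 1)))

lemma subdiv_zero (c : Chain R n X) : subdiv 0 c = c := by
  suffices H : subdiv (R := R) (X := X) (n := n) 0 = LinearMap.id from LinearMap.congr_fun H c
  refine hom_ext fun σ => ?_
  simp only [subdiv, Function.iterate_zero, id_eq, LinChain.map_single, op_single_single,
    LinearMap.id_apply, mul_one]
  congr 1
  funext t
  exact congrArg σ (mix_vertex t)

/-- The difference of the two chain maps related by `prismModel`: subdivision at the end `1` of the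
prism `Δⁿ × Δ¹` and the identity at the end `0`. -/
noncomputable def prismDiff (N n m : ℕ) : LinChain R m (Simp n) →ₗ[R] LinChain R m (Simp n × Simp 2) :=
  (LinChain.map (fun v => (v, stdSimplex.vertex 1))).comp ((LinChain.sd m) ^ N) -
    LinChain.map (fun v => (v, stdSimplex.vertex 0))

/-- The linear chain behind the prism operator: a null-homotopy of `prismDiff`, obtained by coning
from the first vertex of the bottom. -/
noncomputable def prismModel (N n m : ℕ) :
    LinChain R m (Simp n) →ₗ[R] LinChain R (m + 1) (Simp n × Simp 2) :=
  LinChain.hty (fun _ v => (v 0, stdSimplex.vertex 0)) (prismDiff N n) m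

lemma bd_prismModel (N n m : ℕ) (x : LinChain R (m + 1) (Simp n)) :
    LinChain.bd (prismModel N n (m + 1) x) + prismModel N n m (LinChain.bd x) =
      prismDiff N n (m + 1) x := by
  refine LinChain.bd_hty _ _ (fun m x => ?_) ?_ m x
  · simp only [prismDiff, LinearMap.sub_apply, LinearMap.comp_apply, map_sub, LinChain.bd_map,
      Module.End.pow_apply, LinChain.bd_iterate_sd]
  · refine LinChain.hom_ext fun v => ?_
    have h : ((LinChain.sd 0) ^ N) (Finsupp.single v (1 : R)) = Finsupp.single v 1 := by
      rw [show LinChain.sd (R := R) (n := n) 0 = 1 from rfl, one_pow]; rfl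
    simp only [prismDiff, LinearMap.sub_apply, LinearMap.comp_apply, h, LinChain.map_single]
    rw [Subsingleton.elim ((fun v => (v, stdSimplex.vertex 1)) ∘ v : Fin 0 → Simp n × Simp 2)
      ((fun v => (v, stdSimplex.vertex 0)) ∘ v), sub_self]
    rfl

lemma map_prismModel (N m n l : ℕ) (f : Fin n → Fin l) (x : LinChain R m (Simp n)) :
    LinChain.map (Prod.map (stdSimplex.map f) id) (prismModel N n m x) =
      prismModel N l m (LinChain.map (stdSimplex.map f) x) := by
  refine LinChain.map_hty _ _ _ _ _ _ (fun m v => rfl) (fun m x => ?_) m x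
  simp only [prismDiff, LinearMap.sub_apply, LinearMap.comp_apply, map_sub, Module.End.pow_apply,
    ← LinChain.map_iterate_sd, LinChain.map_map]
  rfl

/-- The prism operator of a homotopy `h`, including an `N`-fold subdivision at the end `1`. -/
noncomputable def prism (h : ℝ → X → Y) (N : ℕ) : Chain R n X →ₗ[R] Chain R (n + 1) Y :=
  op h (prismModel N n n (Finsupp.single stdSimplex.vertex 1))

lemma bd_prism (h : ℝ → X → Y) (N : ℕ) (c : Chain R (n + 1) X) :
    bd (prism h N c) + prism h N (bd c) = push (h 1) (subdiv N c) - push (h 0) c := by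
  have h1 : prism h N (bd c) = op h (prismModel N (n + 1) n
      (LinChain.bd (Finsupp.single stdSimplex.vertex 1))) c :=
    op_bd h (fun n' => prismModel N n' n) (fun n' l f x => map_prismModel N n n' l f x) c
  rw [h1, prism, bd_op, ← op_add, bd_prismModel]
  change opₗ h c _ = _
  rw [prismDiff, LinearMap.sub_apply, map_sub]
  change op h _ c - op h _ c = _
  rw [LinearMap.comp_apply, op_vertex, op_vertex h 0 c]
  congr 1
  · rw [Module.End.pow_apply]
    simp [subdiv]
  · have := subdiv_zero c
    rw [subdiv, Function.iterate_zero] at this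
    rw [id] at this
    rw [this]
    simp

/-- The identity is a `subdiv`, so the statement follows from that for linear chains. -/
lemma bd_bd (c : Chain R (n + 2) X) : bd (bd c) = 0 := by
  rw [← subdiv_zero c, subdiv, bd_op, bd_op, LinChain.bd_bd]
  exact map_zero (opₗ (fun _ x => x) c)

lemma push_congr {f g : X → Y} {U : Set X} (hfg : Set.EqOn f g U) {c : Chain R m X}
    (hc : c ∈ Finsupp.supported R R {σ | ∀ t, σ t ∈ U}) : push f c = push g c := by
  have : (push f - push g : Chain R m X →ₗ[R] Chain R m Y) c ∈ (⊥ : Submodule R _) := by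
    refine Finsupp.map_mem_of_mem_supported _ (fun σ hσ => ?_) hc
    rw [LinearMap.sub_apply, push_single, push_single,
      show f ∘ σ = g ∘ σ from funext fun t => hfg (hσ t), sub_self]
    exact zero_mem _
  exact sub_eq_zero.1 this

lemma subdiv_mem {N : ℕ} {c : Chain R n X} {P : Submodule R (Chain R n X)}
    {s : Set (Fin n → Simp n)}
    (hs : (LinChain.sd n)^[N] (Finsupp.single stdSimplex.vertex (1 : R)) ∈ Finsupp.supported R R s)
    (h : ∀ w ∈ s, op (fun _ x => x)
      (Finsupp.single (fun i => (w i, stdSimplex.vertex 0)) (1 : R)) c ∈ P) :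
    subdiv N c ∈ P := by
  refine Finsupp.map_mem_of_mem_supported
    ((opₗ (fun _ x => x) c).comp (LinChain.map fun v => (v, stdSimplex.vertex 0)))
    (fun w hw => ?_) hs
  rw [LinearMap.comp_apply, LinChain.map_single]
  exact h w hw

end Chain

/-! ### Singular chains of subsets and small chains -/

namespace Chain

variable {R : Type*} [CommRing R] {m n k : ℕ} {X Y Z : Type*}
  [TopologicalSpace X] [TopologicalSpace Y] [TopologicalSpace Z]

variable (R m) in
/-- The singular chains of a subset `U`: combinations of continuous simplices with image in `U`. -/
noncomputable def sing (U : Set X) : Submodule R (Chain R m X) :=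
  Finsupp.supported R R {σ | Continuous σ ∧ ∀ t, σ t ∈ U}

lemma sing_mono {U V : Set X} (h : U ⊆ V) : sing R m U ≤ sing R m V :=
  Finsupp.supported_mono fun _ hσ => ⟨hσ.1, fun t => h (hσ.2 t)⟩

lemma mem_sing_inter {U V : Set X} {c : Chain R m X} (hU : c ∈ sing R m U) (hV : c ∈ sing R m V) :
    c ∈ sing R m (U ∩ V) :=
  fun _ hσ => ⟨(hU hσ).1, fun t => ⟨(hU hσ).2 t, (hV hσ).2 t⟩⟩

lemma eq_zero_of_mem_sing_empty {c : Chain R (m + 1) X} (hc : c ∈ sing R (m + 1) (∅ : Set X)) :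
    c = 0 := by
  rw [← Finsupp.support_eq_empty, Finset.eq_empty_iff_forall_notMem]
  intro σ hσ
  exact (hc hσ).2 (stdSimplex.vertex 0)

lemma bd_mem {U : Set X} {c : Chain R (m + 1) X} (hc : c ∈ sing R (m + 1) U) :
    bd c ∈ sing R m U := by
  refine Finsupp.map_mem_of_mem_supported _ (fun σ hσ => ?_) hc
  rw [bd_single]
  refine Submodule.sum_mem _ fun i _ => Finsupp.single_mem_supported _ _ ?_
  exact ⟨hσ.1.comp (stdSimplex.continuous_map _), fun t => hσ.2 _⟩

lemma push_mem {f : X → Y} {U : Set X} {V : Set Y} (hf : ContinuousOn f U) (hUV : Set.MapsTo f U V)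
    {c : Chain R m X} (hc : c ∈ sing R m U) : push f c ∈ sing R m V := by
  refine Finsupp.map_mem_of_mem_supported _ (fun σ hσ => ?_) hc
  rw [push_single]
  exact Finsupp.single_mem_supported _ _ ⟨hf.comp_continuous hσ.1 hσ.2, fun t => hUV (hσ.2 t)⟩

lemma push_congr_of_mem {Y : Type*} {f g : X → Y} {U : Set X} (hfg : Set.EqOn f g U)
    {c : Chain R m X} (hc : c ∈ sing R m U) : push f c = push g c :=
  push_congr hfg fun _ hσ => (hc hσ).2

lemma op_mem {h : ℝ → X → Y} {U : Set X} {V : Set Y}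
    (hh : ContinuousOn (Function.uncurry h) (Set.Icc 0 1 ×ˢ U))
    (hUV : ∀ s ∈ Set.Icc (0 : ℝ) 1, ∀ x ∈ U, h s x ∈ V) (a : LinChain R m (Simp n × Simp 2))
    {c : Chain R n X} (hc : c ∈ sing R n U) : op h a c ∈ sing R m V := by
  refine Finsupp.map_mem_of_mem_supported _ (fun σ hσ => ?_) hc
  have ha : a ∈ Finsupp.supported R R Set.univ := by simp [Finsupp.supported_univ]
  change opₗ h _ a ∈ _
  refine Finsupp.map_mem_of_mem_supported _ (fun w _ => ?_) ha
  change op h _ _ ∈ _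
  rw [op_single_single]
  have h01 : ∀ t : Simp m, mix (Prod.snd ∘ w) t 1 ∈ Set.Icc (0 : ℝ) 1 :=
    fun t => ⟨stdSimplex.zero_le _ _, stdSimplex.le_one _ _⟩
  refine Finsupp.single_mem_supported _ _ ⟨?_, fun t => hUV _ (h01 t) _ (hσ.2 _)⟩
  refine hh.comp_continuous (f := fun t => (mix (Prod.snd ∘ w) t 1, σ (mix (Prod.fst ∘ w) t)))
    (Continuous.prodMk ?_ (hσ.1.comp (continuous_mix _))) fun t => ⟨h01 t, hσ.2 _⟩
  exact (continuous_apply (1 : Fin 2)).comp (continuous_subtype_val.comp (continuous_mix _))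

lemma prism_mem {h : ℝ → X → Y} {U : Set X} {V : Set Y}
    (hh : ContinuousOn (Function.uncurry h) (Set.Icc 0 1 ×ˢ U))
    (hUV : ∀ s ∈ Set.Icc (0 : ℝ) 1, ∀ x ∈ U, h s x ∈ V) (N : ℕ)
    {c : Chain R n X} (hc : c ∈ sing R n U) : prism h N c ∈ sing R (n + 1) V :=
  op_mem hh hUV _ hc

/-- By the Lebesgue number lemma, a sufficiently fine subdivision of a chain in `U ∪ V` is a sum of
chains in `U` and in `V`. -/
lemma exists_subdiv_mem_sup {U V : Set X} (hU : IsOpen U) (hV : IsOpen V) {c : Chain R m X}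
    (hc : c ∈ sing R m (U ∪ V)) : ∃ N, subdiv N c ∈ sing R m U ⊔ sing R m V := by
  have key : ∀ σ ∈ c.support, ∀ᶠ N : ℕ in Filter.atTop,
      subdiv N (Finsupp.single σ (c σ)) ∈ sing R m U ⊔ sing R m V := by
    intro σ hσ
    obtain ⟨hσc, hσU⟩ := hc hσ
    obtain ⟨δ, hδ, hL⟩ := lebesgue_number_lemma_of_metric (ι := Bool) (s := Set.univ)
      (c := fun b => σ ⁻¹' (cond b U V)) isCompact_univ
      (fun b => by cases b; exacts [hV.preimage hσc, hU.preimage hσc])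
      (fun t _ => by
        rcases hσU t with h | h
        · exact Set.mem_iUnion.2 ⟨true, h⟩
        · exact Set.mem_iUnion.2 ⟨false, h⟩)
    have hlim : Filter.Tendsto (fun N : ℕ => ((m : ℝ) / (m + 1)) ^ N * 2) Filter.atTop (nhds 0) := by
      have := (tendsto_pow_atTop_nhds_zero_of_lt_one (r := (m : ℝ) / (m + 1)) (by positivity)
        (by rw [div_lt_one (by positivity)]; linarith)).mul_const 2
      simpa using this
    filter_upwards [hlim.eventually (gt_mem_nhds hδ)] with N hN
    refine subdiv_mem (LinChain.iterate_sd_mem_smallTuples (R := R) m N) fun w hw => ?_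
    rw [op_single_single]
    have hcont : Continuous fun t => σ (mix w t) := hσc.comp (continuous_mix w)
    change Finsupp.single (fun t => σ (mix w t)) _ ∈ _
    rcases isEmpty_or_nonempty (Fin m) with he | ⟨⟨i⟩⟩
    · refine Submodule.mem_sup_left (Finsupp.single_mem_supported _ _ ⟨hcont, fun t => ?_⟩)
      have := stdSimplex.sum_eq_one t
      simp at this
    · obtain ⟨b, hb⟩ := hL (w i) trivial
      have hball : ∀ t, σ (mix w t) ∈ cond b U V := by
        intro t
        refine hb ?_
        have : (mix w t : Simp m).1 ∈ Metric.ball (w i).1 δ :=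
          (convex_ball _ _).sum_mem (fun j _ => stdSimplex.zero_le t j) (stdSimplex.sum_eq_one t)
            (fun j _ => (hw.2 j i).trans_lt hN)
        exact this
      cases b
      · exact Submodule.mem_sup_right (Finsupp.single_mem_supported _ _ ⟨hcont, hball⟩)
      · exact Submodule.mem_sup_left (Finsupp.single_mem_supported _ _ ⟨hcont, hball⟩)
  obtain ⟨N, hN⟩ := ((Filter.eventually_all_finset c.support).2 key).exists
  refine ⟨N, ?_⟩
  rw [← c.sum_single, Finsupp.sum, map_sum]
  exact Submodule.sum_mem _ hN

/-- **Small chains**: a chain of `U ∪ V` whose boundary already is a sum of chains of `U` and `V`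
is itself such a sum up to a boundary. -/
theorem exists_split {U V : Set X} (hU : IsOpen U) (hV : IsOpen V) {c : Chain R (m + 1) X}
    (hc : c ∈ sing R (m + 1) (U ∪ V)) (hbd : bd c ∈ sing R m U ⊔ sing R m V) :
    ∃ a ∈ sing R (m + 1) U, ∃ b ∈ sing R (m + 1) V, ∃ w ∈ sing R (m + 2) (U ∪ V),
      c = a + b + bd w := by
  obtain ⟨N, hN⟩ := exists_subdiv_mem_sup hU hV hc
  have hcont : ∀ W : Set X, ContinuousOn (Function.uncurry fun (_ : ℝ) (x : X) => x)
    (Set.Icc 0 1 ×ˢ W) := fun W => continuous_snd.continuousOn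
  have hp : prism (fun _ x => x) N (bd c) ∈ sing R (m + 1) U ⊔ sing R (m + 1) V := by
    obtain ⟨a, ha, b, hb, hab⟩ := Submodule.mem_sup.1 hbd
    rw [← hab, map_add]
    exact Submodule.add_mem_sup (prism_mem (hcont U) (fun _ _ _ h => h) N ha)
      (prism_mem (hcont V) (fun _ _ _ h => h) N hb)
  obtain ⟨a, ha, b, hb, hab⟩ := Submodule.mem_sup.1 (sub_mem hN hp)
  refine ⟨a, ha, b, hb, -prism (fun _ x => x) N c,
    neg_mem (prism_mem (hcont _) (fun _ _ _ h => h) N hc), ?_⟩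
  have := bd_prism (R := R) (fun (_ : ℝ) (x : X) => x) N c
  have e : ∀ x : Chain R (m + 1) X, push (fun x => x) x = x := push_id
  rw [e, e] at this
  rw [hab, map_neg, eq_sub_iff_add_eq.2 this]
  abel

end Chain

/-! ### Relative homology classes, excision and Mayer–Vietoris -/

namespace Chain

variable {R : Type*} [CommRing R] {m n k : ℕ} {X Y Z : Type*}
  [TopologicalSpace X] [TopologicalSpace Y] [TopologicalSpace Z]

/-- The chain `z` is, up to a boundary in `U`, a chain of `U \ K`. For a relative cycle `z` of the pair
`(U, U \ K)` this says that its class vanishes in the homology of `U` at `K`; the definition itself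
does not ask for `z` to be a relative cycle. -/
def NullIn (U K : Set X) (z : Chain R m X) : Prop :=
  ∃ w ∈ sing R (m + 1) U, z - bd w ∈ sing R m (U \ K)

lemma nullIn_of_mem {U K : Set X} {z : Chain R m X} (hz : z ∈ sing R m (U \ K)) : NullIn U K z :=
  ⟨0, zero_mem _, by simpa using hz⟩

lemma nullIn_bd {U K : Set X} {w : Chain R (m + 1) X} (hw : w ∈ sing R (m + 1) U) :
    NullIn U K (bd w) := ⟨w, hw, by simp⟩

lemma NullIn.add {U K : Set X} {z z' : Chain R m X} (h : NullIn U K z) (h' : NullIn U K z') :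
    NullIn U K (z + z') := by
  obtain ⟨w, hw, hz⟩ := h
  obtain ⟨w', hw', hz'⟩ := h'
  refine ⟨w + w', add_mem hw hw', ?_⟩
  rw [map_add, add_sub_add_comm]
  exact add_mem hz hz'

lemma NullIn.neg {U K : Set X} {z : Chain R m X} (h : NullIn U K z) : NullIn U K (-z) := by
  obtain ⟨w, hw, hz⟩ := h
  refine ⟨-w, neg_mem hw, ?_⟩
  rw [map_neg, ← neg_sub', neg_mem_iff]
  exact hz

lemma NullIn.sub {U K : Set X} {z z' : Chain R m X} (h : NullIn U K z) (h' : NullIn U K z') :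
    NullIn U K (z - z') := by
  rw [sub_eq_add_neg]
  exact h.add h'.neg

/-- Homologous chains vanish together. -/
lemma NullIn.congr {U K : Set X} {z z' : Chain R m X} (h : NullIn U K (z - z')) :
    NullIn U K z ↔ NullIn U K z' :=
  ⟨fun hz => by simpa using hz.sub h, fun hz => by simpa using h.add hz⟩

lemma NullIn.mono {U K K' : Set X} {z : Chain R m X} (h : NullIn U K z) (hK : K' ⊆ K) :
    NullIn U K' z := by
  obtain ⟨w, hw, hz⟩ := h
  exact ⟨w, hw, sing_mono (Set.sdiff_subset_sdiff_right hK) hz⟩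

lemma NullIn.mono_left {U U' K : Set X} {z : Chain R m X} (h : NullIn U K z) (hU : U ⊆ U') :
    NullIn U' K z := by
  obtain ⟨w, hw, hz⟩ := h
  exact ⟨w, sing_mono hU hw, sing_mono (Set.sdiff_subset_sdiff_left hU) hz⟩

lemma NullIn.push {U K : Set X} {V L : Set Y} {z : Chain R m X} (h : NullIn U K z) {f : X → Y}
    (hf : ContinuousOn f U) (hUV : Set.MapsTo f U V) (hKL : Set.MapsTo f (U \ K) (V \ L)) :
    NullIn V L (push f z) := by
  obtain ⟨w, hw, hz⟩ := h
  refine ⟨Chain.push f w, push_mem hf hUV hw, ?_⟩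
  rw [bd_push, ← map_sub]
  exact push_mem (hf.mono Set.sdiff_subset) hKL hz

/-- **Homotopy invariance** of relative classes. -/
lemma nullIn_homotopy {U K : Set X} {V L : Set Y} {z : Chain R (m + 1) X}
    (hz : z ∈ sing R (m + 1) U) (hbd : bd z ∈ sing R m (U \ K)) {h : ℝ → X → Y}
    (hh : ContinuousOn (Function.uncurry h) (Set.Icc 0 1 ×ˢ U))
    (hUV : ∀ s ∈ Set.Icc (0 : ℝ) 1, ∀ x ∈ U, h s x ∈ V)
    (hKL : ∀ s ∈ Set.Icc (0 : ℝ) 1, ∀ x ∈ U \ K, h s x ∈ V \ L) :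
    NullIn V L (push (h 1) z - push (h 0) z) := by
  have := bd_prism h 0 z
  rw [subdiv_zero] at this
  rw [← this]
  refine (nullIn_bd (prism_mem hh hUV 0 hz)).add (nullIn_of_mem (prism_mem (hh.mono ?_) hKL 0 hbd))
  exact Set.prod_mono_right Set.sdiff_subset

/-- The image of a cycle under a constant map is a boundary: the chain map factors through the linear
chains of a point, where one can take cones. -/
lemma exists_bd_eq_push_const {X : Type*} (a : Y) {z : Chain R (m + 1) X} (hz : bd z = 0) :
    ∃ w ∈ sing R (m + 2) ({a} : Set Y), bd w = push (fun _ => a) z := by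
  let κ : ∀ j, Chain R j X →ₗ[R] LinChain R j Unit := fun j => Finsupp.lmapDomain R R fun _ _ => ()
  let ι : ∀ j, LinChain R j Unit →ₗ[R] Chain R j Y := fun j => Finsupp.lmapDomain R R fun _ _ => a
  have hκ : LinChain.bd (κ (m + 1) z) = 0 := by
    rw [show (0 : LinChain R m Unit) = κ m (bd z) by rw [hz, map_zero]]
    suffices H : LinChain.bd.comp (κ (m + 1)) = (κ m).comp bd from LinearMap.congr_fun H z
    refine hom_ext fun σ => ?_
    simp [κ, bd_single, -Finsupp.single_mul, map_sum]
  have hι : ∀ j x, bd (ι (j + 1) x) = ι j (LinChain.bd x) := by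
    intro j x
    suffices H : bd.comp (ι (j + 1)) = (ι j).comp LinChain.bd from LinearMap.congr_fun H x
    refine LinChain.hom_ext fun v => ?_
    simp [ι, bd_single, -Finsupp.single_mul, map_sum]
    rfl
  refine ⟨ι (m + 2) (LinChain.cone () (κ (m + 1) z)), ?_, ?_⟩
  · have hu : ∀ x : LinChain R (m + 2) Unit, x ∈ Finsupp.supported R R Set.univ := fun x => by
      simp [Finsupp.supported_univ]
    refine Finsupp.map_mem_of_mem_supported (ι (m + 2)) (fun v _ => ?_) (hu _)
    simp only [ι, Finsupp.lmapDomain_apply, Finsupp.mapDomain_single]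
    exact Finsupp.single_mem_supported _ _ ⟨continuous_const, fun _ => rfl⟩
  · rw [hι, LinChain.bd_cone, hκ, map_zero, sub_zero]
    suffices H : (ι (m + 1)).comp (κ (m + 1)) = push (fun _ => a) from LinearMap.congr_fun H z
    refine hom_ext fun σ => ?_
    simp [ι, κ]
    rfl

/-- Cycles of positive degree in a contractible set are boundaries. -/
lemma exists_bd_eq_of_contraction {U : Set X} {z : Chain R (m + 1) X} (hz : z ∈ sing R (m + 1) U)
    (hbd : bd z = 0) {h : ℝ → X → X} {a : X} (ha : a ∈ U)
    (hh : ContinuousOn (Function.uncurry h) (Set.Icc 0 1 ×ˢ U))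
    (hU : ∀ s ∈ Set.Icc (0 : ℝ) 1, ∀ x ∈ U, h s x ∈ U) (h0 : ∀ x ∈ U, h 0 x = x)
    (h1 : ∀ x ∈ U, h 1 x = a) :
    ∃ w ∈ sing R (m + 2) U, bd w = z := by
  obtain ⟨w, hw, hwz⟩ := exists_bd_eq_push_const a hbd
  refine ⟨w - prism h 0 z, sub_mem (sing_mono (by simpa using ha) hw) (prism_mem hh hU 0 hz), ?_⟩
  have := bd_prism h 0 z
  rw [subdiv_zero, hbd, map_zero, add_zero] at this
  rw [map_sub, this, hwz, push_congr_of_mem (g := fun _ => a) h1 hz,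
    push_congr_of_mem (g := id) h0 hz, push_id]
  abel

/-- Cycles of positive degree in a star-shaped set are boundaries. -/
lemma exists_bd_eq_of_starConvex {E : Type*} [NormedAddCommGroup E] [NormedSpace ℝ E] {U : Set E}
    {a : E} (hU : StarConvex ℝ a U) (ha : a ∈ U) {z : Chain R (m + 1) E}
    (hz : z ∈ sing R (m + 1) U) (hbd : bd z = 0) : ∃ w ∈ sing R (m + 2) U, bd w = z := by
  refine exists_bd_eq_of_contraction hz hbd (h := fun s x => s • a + (1 - s) • x) ha ?_ ?_ ?_ ?_
  · refine Continuous.continuousOn ?_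
    unfold Function.uncurry
    fun_prop
  · exact fun s hs x hx => hU hx hs.1 (sub_nonneg.2 hs.2) (by ring)
  · simp
  · simp

/-- **Mayer–Vietoris**, uniqueness: a class that vanishes on `A` and on `B` vanishes on `A ∪ B` if
the next homology on `A ∩ B` is zero. -/
lemma NullIn.union {U A B : Set X} (hA : IsOpen (U \ A)) (hB : IsOpen (U \ B)) {z : Chain R (m + 1) X}
    (h : ∀ v : Chain R (m + 2) X, v ∈ sing R (m + 2) U → bd v ∈ sing R (m + 1) (U \ (A ∩ B)) →
      NullIn U (A ∩ B) v)
    (hzA : NullIn U A z) (hzB : NullIn U B z) : NullIn U (A ∪ B) z := by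
  obtain ⟨w₁, hw₁, hz₁⟩ := hzA
  obtain ⟨w₂, hw₂, hz₂⟩ := hzB
  have hbd : bd (w₁ - w₂) = (z - bd w₂) - (z - bd w₁) := by rw [map_sub]; abel
  obtain ⟨v, hv, ht⟩ := h (w₁ - w₂) (sub_mem hw₁ hw₂) (by
    rw [hbd]
    exact sub_mem (sing_mono (Set.sdiff_subset_sdiff_right Set.inter_subset_right) hz₂)
      (sing_mono (Set.sdiff_subset_sdiff_right Set.inter_subset_left) hz₁))
  rw [Set.sdiff_inter] at ht
  obtain ⟨a, ha, b, hb, v', hv', hab⟩ := exists_split hA hB ht (by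
    rw [map_sub, bd_bd, sub_zero, hbd, ← neg_sub_neg, sub_eq_add_neg, neg_neg, ]
    exact Submodule.add_mem_sup (neg_mem hz₁) hz₂)
  have hw : w₁ - a - (w₂ + b) = bd (v + v') := by
    rw [sub_eq_iff_eq_add, sub_eq_iff_eq_add] at hab
    rw [map_add, hab]
    abel
  refine ⟨w₁ - a, sub_mem hw₁ (sing_mono Set.sdiff_subset ha), ?_⟩
  rw [← Set.sdiff_inter_sdiff]
  refine mem_sing_inter ?_ ?_
  · rw [map_sub, ← sub_add]
    exact add_mem hz₁ (bd_mem ha)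
  · rw [eq_add_of_sub_eq hw, map_add, bd_bd, zero_add, map_add, ← sub_sub]
    exact sub_mem hz₂ (bd_mem hb)

/-- **Mayer–Vietoris**, existence: classes on `A` and `B` that agree on `A ∩ B` come from a class
on `A ∪ B`. -/
lemma exists_glue {U A B : Set X} (hA : IsOpen (U \ A)) (hB : IsOpen (U \ B))
    {zA zB : Chain R (m + 1) X} (hzA : zA ∈ sing R (m + 1) U)
    (hbA : bd zA ∈ sing R m (U \ A)) (hbB : bd zB ∈ sing R m (U \ B))
    (h : NullIn U (A ∩ B) (zA - zB)) :
    ∃ z ∈ sing R (m + 1) U, bd z ∈ sing R m (U \ (A ∪ B)) ∧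
      NullIn U A (z - zA) ∧ NullIn U B (z - zB) := by
  obtain ⟨v, hv, ht⟩ := h
  rw [Set.sdiff_inter] at ht
  obtain ⟨a, ha, b, hb, v', hv', hab⟩ := exists_split hA hB ht (by
    rw [map_sub, bd_bd, sub_zero, map_sub, sub_eq_add_neg]
    exact Submodule.add_mem_sup hbA (neg_mem hbB))
  have hz : zA - a = zB + b + bd (v + v') := by
    rw [map_add]
    rw [sub_eq_iff_eq_add, sub_eq_iff_eq_add] at hab
    rw [hab]
    abel
  have hvv : v + v' ∈ sing R (m + 2) U :=
    add_mem hv (sing_mono (Set.union_subset Set.sdiff_subset Set.sdiff_subset) hv')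
  refine ⟨zA - a, sub_mem hzA (sing_mono Set.sdiff_subset ha), ?_, ?_, ?_⟩
  · rw [← Set.sdiff_inter_sdiff]
    refine mem_sing_inter ?_ ?_
    · rw [map_sub]
      exact sub_mem hbA (bd_mem ha)
    · rw [hz, map_add, bd_bd, add_zero, map_add]
      exact add_mem hbB (bd_mem hb)
  · rw [sub_sub_cancel_left]
    exact (nullIn_of_mem ha).neg
  · rw [hz, add_assoc, add_sub_cancel_left]
    exact (nullIn_of_mem hb).add (nullIn_bd hvv)

/-- **Excision**, surjectivity: a class of `(V, V \ K)` is represented by a chain of any open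
neighbourhood `U` of `K`. -/
lemma exists_excision {U V K : Set X} (hU : IsOpen U) (hUV : U ⊆ V) (hVK : IsOpen (V \ K))
    (hKU : K ⊆ U) {z : Chain R (m + 1) X} (hz : z ∈ sing R (m + 1) V)
    (hbd : bd z ∈ sing R m U ⊔ sing R m (V \ K)) :
    ∃ z' ∈ sing R (m + 1) U, NullIn V K (z - z') ∧ ∃ y ∈ sing R (m + 1) (V \ K),
      bd z = bd z' + bd y := by
  have hcov : V ⊆ U ∪ (V \ K) := fun x hx => by
    by_cases hK : x ∈ K
    exacts [Or.inl (hKU hK), Or.inr ⟨hx, hK⟩]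
  obtain ⟨a, ha, b, hb, w, hw, hab⟩ := exists_split hU hVK (sing_mono hcov hz) hbd
  have hw' : w ∈ sing R (m + 2) V := sing_mono (Set.union_subset hUV Set.sdiff_subset) hw
  refine ⟨a, ha, ?_, b, hb, ?_⟩
  · rw [hab, add_assoc, add_sub_cancel_left]
    exact (nullIn_of_mem hb).add (nullIn_bd hw')
  · rw [hab, map_add, map_add, bd_bd, add_zero]

/-- **Excision**, injectivity. -/
lemma NullIn.excision {U V K : Set X} (hU : IsOpen U) (hVK : IsOpen (V \ K))
    (hKU : K ⊆ U) {z : Chain R m X} (hz : z ∈ sing R m U) (h : NullIn V K z) : NullIn U K z := by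
  obtain ⟨w, hw, hzw⟩ := h
  have hcov : V ⊆ U ∪ (V \ K) := fun x hx => by
    by_cases hK : x ∈ K
    exacts [Or.inl (hKU hK), Or.inr ⟨hx, hK⟩]
  obtain ⟨a, ha, b, hb, v, hv, hab⟩ := exists_split hU hVK (sing_mono hcov hw) (by
    rw [← sub_sub_cancel z (bd w), sub_eq_add_neg]
    exact Submodule.add_mem_sup hz (neg_mem hzw))
  refine ⟨a, ha, ?_⟩
  have hmem : z - bd a ∈ sing R m (V \ K) := by
    have : z - bd a = z - bd w + bd b := by
      rw [hab, map_add, map_add, bd_bd]; abel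
    rw [this]
    exact add_mem hzw (bd_mem hb)
  have hUK : U ∩ (V \ K) ⊆ U \ K := fun x hx => ⟨hx.1, hx.2.2⟩
  exact sing_mono hUK (mem_sing_inter (sub_mem hz (bd_mem ha)) hmem)

/-- The vanishing of a class can be tested in a chart. -/
lemma nullIn_push_iff (e : OpenPartialHomeomorph X Y) {K : Set X} (hKe : K ⊆ e.source)
    (hK : IsClosed K) (hK' : IsClosed (e '' K)) {z : Chain R m X} (hz : z ∈ sing R m e.source) :
    NullIn Set.univ (e '' K) (push e z) ↔ NullIn Set.univ K z := by
  have hKe' : e '' K ⊆ e.target := by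
    rintro _ ⟨x, hx, rfl⟩
    exact e.map_source (hKe hx)
  have hpz : Chain.push e z ∈ sing R m e.target := push_mem e.continuousOn e.mapsTo hz
  constructor
  · intro h
    have h1 : NullIn e.target (e '' K) (push e z) :=
      h.excision e.open_target (by simpa [← Set.compl_eq_univ_sdiff] using hK'.isOpen_compl) hKe' hpz
    have h2 : NullIn e.source K (Chain.push e.symm (Chain.push e z)) := by
      refine h1.push e.continuousOn_symm e.mapsTo_symm fun y hy => ⟨e.map_target hy.1, fun hyK => ?_⟩
      exact hy.2 ⟨_, hyK, e.right_inv hy.1⟩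
    rw [push_push, push_congr_of_mem (f := e.symm ∘ e) (g := id) (fun x hx => e.left_inv hx) hz, push_id] at h2
    exact h2.mono_left (Set.subset_univ _)
  · intro h
    have h1 : NullIn e.source K z :=
      h.excision e.open_source (by simpa [← Set.compl_eq_univ_sdiff] using hK.isOpen_compl) hKe hz
    refine (h1.push (V := e.target) (L := e '' K) e.continuousOn e.mapsTo
      fun x hx => ⟨e.map_source hx.1, ?_⟩).mono_left (Set.subset_univ _)
    rintro ⟨y, hy, hyx⟩
    exact hx.2 (e.injOn (hKe hy) hx.1 hyx ▸ hy)

end Chain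

/-! ### The homology of a punctured vector space -/

namespace Chain

variable {R : Type*} [CommRing R] {m n k : ℕ} {X Y Z : Type*}
  [TopologicalSpace X] [TopologicalSpace Y] [TopologicalSpace Z]

/-- Cycles of the augmented complex; every chain in degree zero is one. -/
def IsCycle {X : Type*} : ∀ {m : ℕ}, Chain R m X → Prop
  | 0, _ => True
  | _ + 1, z => bd z = 0

/-- The chain `z` is a boundary in `U`. -/
def IsBdry (U : Set X) (z : Chain R m X) : Prop := ∃ w ∈ sing R (m + 1) U, bd w = z

lemma isCycle_bd {X : Type*} : ∀ {m : ℕ} (z : Chain R (m + 1) X), IsCycle (bd z)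
  | 0, _ => trivial
  | _ + 1, z => bd_bd z

lemma IsCycle.push {X Y : Type*} (f : X → Y) :
    ∀ {m : ℕ} {z : Chain R m X}, IsCycle z → IsCycle (push f z)
  | 0, _, _ => trivial
  | m + 1, z, h => by
    change bd z = 0 at h
    change bd _ = 0
    rw [bd_push, h, map_zero]

lemma isBdry_zero (U : Set X) : IsBdry U (0 : Chain R m X) := ⟨0, zero_mem _, map_zero _⟩

lemma IsBdry.add {U : Set X} {z z' : Chain R m X} (h : IsBdry U z) (h' : IsBdry U z') :
    IsBdry U (z + z') := by
  obtain ⟨w, hw, rfl⟩ := h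
  obtain ⟨w', hw', rfl⟩ := h'
  exact ⟨w + w', add_mem hw hw', map_add _ _ _⟩

lemma IsBdry.smul {U : Set X} {z : Chain R m X} (h : IsBdry U z) (r : R) : IsBdry U (r • z) := by
  obtain ⟨w, hw, rfl⟩ := h
  exact ⟨r • w, Submodule.smul_mem _ r hw, map_smul _ _ _⟩

lemma IsBdry.neg {U : Set X} {z : Chain R m X} (h : IsBdry U z) : IsBdry U (-z) := by
  simpa using h.smul (-1)

lemma IsBdry.sub {U : Set X} {z z' : Chain R m X} (h : IsBdry U z) (h' : IsBdry U z') :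
    IsBdry U (z - z') := by
  simpa [sub_eq_add_neg] using h.add h'.neg

lemma IsBdry.push {U : Set X} {V : Set Y} {z : Chain R m X} (h : IsBdry U z) {f : X → Y}
    (hf : ContinuousOn f U) (hUV : Set.MapsTo f U V) : IsBdry V (push f z) := by
  obtain ⟨w, hw, rfl⟩ := h
  exact ⟨Chain.push f w, push_mem hf hUV hw, bd_push _ _⟩

lemma isBdry_homotopy {U : Set X} {V : Set Y} : ∀ {m : ℕ} {z : Chain R m X}, z ∈ sing R m U →
    IsCycle z → ∀ {h : ℝ → X → Y},
    ContinuousOn (Function.uncurry h) (Set.Icc 0 1 ×ˢ U) →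
    (∀ s ∈ Set.Icc (0 : ℝ) 1, ∀ x ∈ U, h s x ∈ V) →
    IsBdry V (push (h 1) z - push (h 0) z)
  | 0, z, hz, _, h, _, _ => by
    suffices H : Chain.push (R := R) (m := 0) (h 1) = Chain.push (h 0) by
      rw [H, sub_self]; exact isBdry_zero V
    refine hom_ext fun σ => ?_
    rw [push_single, push_single]
    congr 1
    funext t
    have := stdSimplex.sum_eq_one t
    simp at this
  | m + 1, z, hz, hc, h, hh, hUV => by
    refine ⟨prism h 0 z, prism_mem hh hUV 0 hz, ?_⟩
    change bd z = 0 at hc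
    have := bd_prism h 0 z
    rwa [subdiv_zero, hc, map_zero, add_zero] at this

section Suspension

variable {V : Type*} [NormedAddCommGroup V]

variable (V) in
/-- The complement of the lower closed half of the vertical axis. It is star-shaped, and together with
`lower` it covers the punctured space, with intersection homotopy equivalent to the punctured `V`. -/
def upper : Set (V × ℝ) := {p | p.1 ≠ 0 ∨ 0 < p.2}

variable (V) in
/-- The complement of the upper closed half of the vertical axis. -/
def lower : Set (V × ℝ) := {p | p.1 ≠ 0 ∨ p.2 < 0}

lemma isOpen_upper : IsOpen (upper V) :=
  (isOpen_ne.preimage continuous_fst).union (isOpen_lt continuous_const continuous_snd)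

lemma isOpen_lower : IsOpen (lower V) :=
  (isOpen_ne.preimage continuous_fst).union (isOpen_lt continuous_snd continuous_const)

lemma upper_union_lower : upper V ∪ lower V = {0}ᶜ := by
  ext ⟨v, t⟩
  simp only [upper, lower, Set.mem_union, Set.mem_ofPred_eq, Set.mem_compl_iff,
    Set.mem_singleton_iff, Prod.mk_eq_zero, not_and]
  constructor
  · rintro ((h | h) | (h | h)) h'
    exacts [absurd h' h, h.ne', absurd h' h, h.ne]
  · intro h
    by_cases hv : v = 0
    · rcases lt_or_gt_of_ne (h hv) with ht | ht
      exacts [Or.inr (Or.inr ht), Or.inl (Or.inr ht)]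
    · exact Or.inl (Or.inl hv)

lemma upper_inter_lower : upper V ∩ lower V = {p | p.1 ≠ 0} := by
  ext ⟨v, t⟩
  simp only [upper, lower, Set.mem_inter_iff, Set.mem_ofPred_eq]
  constructor
  · rintro ⟨h | h, h' | h'⟩
    exacts [h, h, h', absurd h' h.not_gt]
  · exact fun h => ⟨Or.inl h, Or.inl h⟩

variable {y₁ y₂ : Chain R (m + 1) (V × ℝ)}

lemma bd_mem_upper_inter_lower (h₁ : y₁ ∈ sing R (m + 1) (upper V))
    (h₂ : y₂ ∈ sing R (m + 1) (lower V)) (h : bd (y₁ + y₂) = 0) :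
    bd y₁ ∈ sing R m {p : V × ℝ | p.1 ≠ 0} := by
  rw [← upper_inter_lower]
  refine mem_sing_inter (bd_mem h₁) ?_
  rw [map_add] at h
  rw [eq_neg_of_add_eq_zero_left h]
  exact neg_mem (bd_mem h₂)

/-- If a cycle of the punctured space `V × ℝ` bounds, then so does its equator, the common boundary of
its upper and its lower part, projected to the punctured space `V`. -/
lemma isBdry_equator (h₁ : y₁ ∈ sing R (m + 1) (upper V)) (h₂ : y₂ ∈ sing R (m + 1) (lower V))
    (h : IsBdry {(0 : V × ℝ)}ᶜ (y₁ + y₂)) : IsBdry {(0 : V)}ᶜ (push Prod.fst (bd y₁)) := by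
  obtain ⟨w, hw, hwb⟩ := h
  rw [← upper_union_lower] at hw
  obtain ⟨w₁, hw₁, w₂, hw₂, v, hv, hab⟩ := exists_split isOpen_upper isOpen_lower hw
    (by rw [hwb]; exact Submodule.add_mem_sup h₁ h₂)
  have hsum : y₁ - bd w₁ = -(y₂ - bd w₂) := by
    rw [hab, map_add, map_add, bd_bd, add_zero] at hwb
    rw [neg_sub, sub_eq_sub_iff_add_eq_add, ← hwb]
    exact add_comm _ _
  have hW : y₁ - bd w₁ ∈ sing R (m + 1) {p : V × ℝ | p.1 ≠ 0} := by
    rw [← upper_inter_lower]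
    refine mem_sing_inter (sub_mem h₁ (bd_mem hw₁)) ?_
    rw [hsum]
    exact neg_mem (sub_mem h₂ (bd_mem hw₂))
  have : IsBdry {p : V × ℝ | p.1 ≠ 0} (bd y₁) := ⟨_, hW, by rw [map_sub, bd_bd, sub_zero]⟩
  exact this.push continuous_fst.continuousOn fun p hp => hp

/-- Every cycle of the punctured space `V × ℝ` is, up to boundaries, a sum of chains in the upper
and lower parts. -/
lemma exists_upper_lower {y : Chain R (m + 1) (V × ℝ)} (hy : y ∈ sing R (m + 1) {(0 : V × ℝ)}ᶜ)
    (h : bd y = 0) : ∃ y₁ ∈ sing R (m + 1) (upper V), ∃ y₂ ∈ sing R (m + 1) (lower V),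
      bd (y₁ + y₂) = 0 ∧ IsBdry {(0 : V × ℝ)}ᶜ (y - (y₁ + y₂)) := by
  rw [← upper_union_lower] at hy
  obtain ⟨y₁, h₁, y₂, h₂, v, hv, hab⟩ := exists_split isOpen_upper isOpen_lower hy
    (by rw [h]; exact zero_mem _)
  refine ⟨y₁, h₁, y₂, h₂, ?_, v, ?_, ?_⟩
  · rw [hab, map_add, bd_bd, add_zero] at h
    exact h
  · rwa [← upper_union_lower]
  · rw [hab]; abel

variable [NormedSpace ℝ V]

lemma starConvex_upper : StarConvex ℝ ((0, 1) : V × ℝ) (upper V) := by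
  rintro ⟨v, t⟩ h a b ha hb hab
  simp only [upper, Set.mem_ofPred_eq] at h ⊢
  rcases hb.eq_or_lt with rfl | hb
  · right; simp; linarith
  rcases h with h | h
  · left; simpa [hb.ne'] using h
  · right; simp; positivity

lemma starConvex_lower : StarConvex ℝ ((0, -1) : V × ℝ) (lower V) := by
  rintro ⟨v, t⟩ h a b ha hb hab
  simp only [lower, Set.mem_ofPred_eq] at h ⊢
  rcases hb.eq_or_lt with rfl | hb
  · right; simp; linarith
  rcases h with h | h
  · left; simpa [hb.ne'] using h
  · right; simp; nlinarith

/-- A cycle of the punctured space `V × ℝ` bounds if its equator bounds. -/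
lemma isBdry_of_equator (h₁ : y₁ ∈ sing R (m + 1) (upper V)) (h₂ : y₂ ∈ sing R (m + 1) (lower V))
    (h : bd (y₁ + y₂) = 0) (hb : IsBdry {(0 : V)}ᶜ (push Prod.fst (bd y₁))) :
    IsBdry {(0 : V × ℝ)}ᶜ (y₁ + y₂) := by
  have hW := bd_mem_upper_inter_lower h₁ h₂ h
  -- project the equator to the horizontal hyperplane
  have hhom : IsBdry {p : V × ℝ | p.1 ≠ 0} (push (fun p : V × ℝ => (p.1, (0 : ℝ))) (bd y₁) - bd y₁) := by
    have := isBdry_homotopy (V := {p : V × ℝ | p.1 ≠ 0}) hW (isCycle_bd y₁)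
      (h := fun s p => (p.1, (1 - s) * p.2)) (by
        refine Continuous.continuousOn ?_
        unfold Function.uncurry
        fun_prop) (fun s _ p hp => hp)
    have e : ∀ x : Chain R m (V × ℝ), push (fun p => p) x = x := push_id
    simpa [e] using this
  have hpush : IsBdry {p : V × ℝ | p.1 ≠ 0} (push (fun p : V × ℝ => (p.1, (0 : ℝ))) (bd y₁)) := by
    have := hb.push (f := fun v : V => (v, (0 : ℝ))) (V := {p : V × ℝ | p.1 ≠ 0})
      (by fun_prop) (fun v hv => hv)
    rwa [push_push] at this
  obtain ⟨t, ht, htb⟩ := hpush.sub hhom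
  rw [sub_sub_cancel] at htb
  rw [← upper_inter_lower] at ht
  obtain ⟨w₁, hw₁, hw₁b⟩ := exists_bd_eq_of_starConvex (starConvex_upper (V := V)) (Or.inr one_pos)
    (sub_mem h₁ (sing_mono Set.inter_subset_left ht)) (by rw [map_sub, htb, sub_self])
  obtain ⟨w₂, hw₂, hw₂b⟩ := exists_bd_eq_of_starConvex (starConvex_lower (V := V))
    (Or.inr (neg_lt_zero.2 one_pos))
    (add_mem h₂ (sing_mono Set.inter_subset_right ht)) (by rw [map_add, htb, add_comm (bd y₂), ← map_add, h])
  rw [← upper_union_lower]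
  refine ⟨w₁ + w₂, add_mem (sing_mono Set.subset_union_left hw₁)
    (sing_mono Set.subset_union_right hw₂), ?_⟩
  rw [map_add, hw₁b, hw₂b]
  abel

end Suspension

lemma isBdry_push_equiv {V W : Type*} [NormedAddCommGroup V] [NormedSpace ℝ V]
    [NormedAddCommGroup W] [NormedSpace ℝ W] (e : V ≃L[ℝ] W) {z : Chain R m V} :
    IsBdry {(0 : W)}ᶜ (push e z) ↔ IsBdry {(0 : V)}ᶜ z := by
  refine ⟨fun h => ?_, fun h => h.push e.continuous.continuousOn fun x hx => by simpa using hx⟩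
  have := h.push (f := e.symm) (V := {(0 : V)}ᶜ) e.symm.continuous.continuousOn
    fun x hx => by simpa using hx
  rw [push_push] at this
  have he : e.symm ∘ e = id := by ext; simp
  rwa [he, push_id] at this

lemma push_mem_compl_zero {V W : Type*} [NormedAddCommGroup V] [NormedSpace ℝ V]
    [NormedAddCommGroup W] [NormedSpace ℝ W] (e : V ≃L[ℝ] W) {z : Chain R m V}
    (hz : z ∈ sing R m {(0 : V)}ᶜ) : push e z ∈ sing R m {(0 : W)}ᶜ :=
  push_mem e.continuous.continuousOn (fun x hx => by simpa using hx) hz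

/-- The punctured space of dimension `d` has no homology in dimensions above `d - 1`. A chain in
`Chain R m V` has dimension `m - 1`. -/
theorem isBdry_of_finrank_lt (d : ℕ) : ∀ (V : Type) [NormedAddCommGroup V] [NormedSpace ℝ V]
    [FiniteDimensional ℝ V], Module.finrank ℝ V = d → ∀ {m : ℕ}, d < m → ∀ {z : Chain R m V},
    z ∈ sing R m {(0 : V)}ᶜ → IsCycle z → IsBdry {(0 : V)}ᶜ z := by
  induction d with
  | zero =>
    intro V _ _ _ hV m hm z hz _
    obtain ⟨m, rfl⟩ : ∃ k, m = k + 1 := ⟨m - 1, by omega⟩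
    have : Subsingleton V := Module.finrank_zero_iff.1 hV
    have h0 : ({0}ᶜ : Set V) = ∅ := by
      ext x; simp [Subsingleton.elim x 0]
    obtain rfl := eq_zero_of_mem_sing_empty (h0 ▸ hz)
    exact isBdry_zero _
  | succ d ih =>
    intro V _ _ _ hV m hm z hz hc
    obtain ⟨m, rfl⟩ : ∃ k, m = k + 1 := ⟨m - 1, by omega⟩
    let e : V ≃L[ℝ] EuclideanSpace ℝ (Fin d) × ℝ := ContinuousLinearEquiv.ofFinrankEq (by simp [hV])
    rw [← isBdry_push_equiv e]
    obtain ⟨y₁, h₁, y₂, h₂, h0, hy⟩ := exists_upper_lower (push_mem_compl_zero e hz) (hc.push e)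
    have := hy.add (isBdry_of_equator h₁ h₂ h0 (ih _ (by simp) (by omega)
      (push_mem continuous_fst.continuousOn (fun p hp => hp)
        (bd_mem_upper_inter_lower h₁ h₂ h0)) ((isCycle_bd y₁).push _)))
    simpa using this

/-- In dimension `d - 1` the reduced homology of the punctured space of dimension `d` with
coefficients in `ℤ/2` has at most two elements. -/
theorem isBdry_or_isBdry_or_isBdry_add (d : ℕ) : ∀ (V : Type) [NormedAddCommGroup V]
    [NormedSpace ℝ V] [FiniteDimensional ℝ V], Module.finrank ℝ V = d →
    ∀ {z z' : Chain (ZMod 2) d V}, z ∈ sing _ d {(0 : V)}ᶜ → IsCycle z →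
      z' ∈ sing _ d {(0 : V)}ᶜ → IsCycle z' →
      IsBdry {(0 : V)}ᶜ z ∨ IsBdry {(0 : V)}ᶜ z' ∨ IsBdry {(0 : V)}ᶜ (z + z') := by
  induction d with
  | zero =>
    intro V _ _ _ hV z z' _ _ _ _
    have key : ∀ x : Chain (ZMod 2) 0 V, x = 0 ∨ x = Finsupp.single (fun t => 0) 1 := by
      intro x
      have hx : x = Finsupp.single (fun t => 0) (x (fun t => 0)) := by
        ext σ
        have : IsEmpty (Simp 0) := ⟨fun t => by simpa using stdSimplex.sum_eq_one t⟩
        rw [Subsingleton.elim σ (fun t => 0)]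
        simp
      rw [hx]
      generalize x (fun t => 0) = r
      fin_cases r
      · left; exact Finsupp.single_zero _
      · right; rfl
    rcases key z with rfl | rfl
    · exact Or.inl (isBdry_zero _)
    rcases key z' with rfl | rfl
    · exact Or.inr (Or.inl (isBdry_zero _))
    · refine Or.inr (Or.inr ?_)
      rw [← Finsupp.single_add, show (1 + 1 : ZMod 2) = 0 from rfl, Finsupp.single_zero]
      exact isBdry_zero _
  | succ d ih =>
    intro V _ _ _ hV z z' hz hc hz' hc'
    let e : V ≃L[ℝ] EuclideanSpace ℝ (Fin d) × ℝ := ContinuousLinearEquiv.ofFinrankEq (by simp [hV])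
    rw [← isBdry_push_equiv e, ← isBdry_push_equiv e, ← isBdry_push_equiv e, map_add]
    obtain ⟨y₁, h₁, y₂, h₂, h0, hy⟩ := exists_upper_lower (push_mem_compl_zero e hz) (hc.push e)
    obtain ⟨y₁', h₁', y₂', h₂', h0', hy'⟩ :=
      exists_upper_lower (push_mem_compl_zero e hz') (hc'.push e)
    have hmem : ∀ {y : Chain (ZMod 2) d (EuclideanSpace ℝ (Fin d) × ℝ)},
        y ∈ sing _ d {p : EuclideanSpace ℝ (Fin d) × ℝ | p.1 ≠ 0} →
        push Prod.fst y ∈ sing _ d {(0 : EuclideanSpace ℝ (Fin d))}ᶜ :=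
      fun h => push_mem continuous_fst.continuousOn (fun p hp => hp) h
    rcases ih (EuclideanSpace ℝ (Fin d)) (by simp)
      (hmem (bd_mem_upper_inter_lower h₁ h₂ h0)) ((isCycle_bd y₁).push _)
      (hmem (bd_mem_upper_inter_lower h₁' h₂' h0')) ((isCycle_bd y₁').push _) with h | h | h
    · left
      simpa using hy.add (isBdry_of_equator h₁ h₂ h0 h)
    · right; left
      simpa using hy'.add (isBdry_of_equator h₁' h₂' h0' h)
    · right; right
      rw [← map_add, ← map_add] at h
      have h00 : bd (y₁ + y₁' + (y₂ + y₂')) = 0 := by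
        rw [add_add_add_comm, map_add, h0, h0', add_zero]
      have := (hy.add hy').add (isBdry_of_equator (add_mem h₁ h₁') (add_mem h₂ h₂') h00 h)
      rwa [show ∀ a b c a' b' c' : Chain (ZMod 2) (d + 1) (EuclideanSpace ℝ (Fin d) × ℝ),
        a - (b + c) + (a' - (b' + c')) + (b + b' + (c + c')) = a + a' from
          fun a b c a' b' c' => by abel]
        at this

end Chain

/-! ### The cross-polytope cycle and orientation-preserving linear maps -/

namespace Chain

variable {R : Type*} [CommRing R] {m n k : ℕ}

/-- The singular chain of a vector space given by the affine simplices of a linear chain. -/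
noncomputable def real {E : Type*} [AddCommGroup E] [Module ℝ E] :
    LinChain R m E →ₗ[R] Chain R m E :=
  Finsupp.lmapDomain R R fun w t => ∑ i, t i • w i

lemma real_single {E : Type*} [AddCommGroup E] [Module ℝ E] (w : Fin m → E) (r : R) :
    real (Finsupp.single w r) = Finsupp.single (fun t => ∑ i, t i • w i) r := by
  simp [real]

lemma bd_real {E : Type*} [AddCommGroup E] [Module ℝ E] (x : LinChain R (m + 1) E) :
    bd (real x) = real (LinChain.bd x) := by
  suffices H : bd.comp (real (m := m + 1) (E := E) (R := R)) = real.comp LinChain.bd from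
    LinearMap.congr_fun H x
  refine LinChain.hom_ext fun w => ?_
  simp only [LinearMap.comp_apply, LinChain.bd_single, real_single, bd_single, map_sum]
  refine Finset.sum_congr rfl fun i _ => ?_
  congr 1
  funext t
  simp only [Function.comp_apply, stdSimplex.map_coe, FunOnFinite.linearMap_apply_apply,
    Finset.sum_smul]
  rw [← Finset.sum_fiberwise Finset.univ i.succAbove (fun j => t j • w (i.succAbove j))]
  refine Finset.sum_congr rfl fun j _ => Finset.sum_congr (by ext; simp) fun k hk => ?_
  simp at hk
  rw [hk]

lemma push_real {E F : Type*} [AddCommGroup E] [Module ℝ E] [AddCommGroup F] [Module ℝ F]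
    (f : E →ₗ[ℝ] F) (x : LinChain R m E) : push f (real x) = real (LinChain.map f x) := by
  suffices H : (push f).comp (real (m := m) (E := E) (R := R)) = real.comp (LinChain.map f) from
    LinearMap.congr_fun H x
  refine LinChain.hom_ext fun w => ?_
  simp only [LinearMap.comp_apply, LinChain.map_single, real_single, push_single]
  congr 1
  funext t
  simp [map_sum]

lemma real_mem {E : Type*} [NormedAddCommGroup E] [NormedSpace ℝ E] {U : Set E}
    {s : Set (Fin m → E)} (h : ∀ w ∈ s, ∀ t : Simp m, ∑ i, t i • w i ∈ U) {x : LinChain R m E}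
    (hx : x ∈ Finsupp.supported R R s) : real x ∈ sing R m U := by
  refine Finsupp.map_mem_of_mem_supported _ (fun w hw => ?_) hx
  rw [real_single]
  refine Finsupp.single_mem_supported _ _ ⟨?_, h w hw⟩
  exact continuous_finsetSum _ fun i _ =>
    ((continuous_apply i).comp continuous_subtype_val).smul continuous_const

variable (R) in
/-- The boundary of the cross-polytope, built as iterated suspension. -/
noncomputable def crossPoly : ∀ n : ℕ, LinChain R n (Fin n → ℝ)
  | 0 => Finsupp.single Fin.elim0 1
  | n + 1 =>
    LinChain.cone (Pi.single 0 1) (LinChain.map (Fin.cons 0) (crossPoly n)) -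
      LinChain.cone (Pi.single 0 (-1)) (LinChain.map (Fin.cons 0) (crossPoly n))

/-- The vertex tuples of the facets of the cross-polytope. -/
def crossFacets (n : ℕ) : Set (Fin n → Fin n → ℝ) :=
  {w | ∃ ε : Fin n → ℝ, (∀ i, |ε i| = 1) ∧ ∀ i, w i = Pi.single i (ε i)}

lemma cons_zero_single {n : ℕ} (i : Fin n) (r : ℝ) :
    (Fin.cons 0 (Pi.single i r : Fin n → ℝ) : Fin (n + 1) → ℝ) = Pi.single i.succ r := by
  ext j
  refine Fin.cases ?_ (fun j => ?_) j
  · simp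
  · simp [Pi.single_apply]

lemma crossPoly_mem : ∀ n, crossPoly R n ∈ Finsupp.supported R R (crossFacets n)
  | 0 => Finsupp.single_mem_supported _ _ ⟨fun _ => 1, fun _ => abs_one, fun i => i.elim0⟩
  | n + 1 => by
    have key : ∀ r : ℝ, |r| = 1 → LinChain.cone (Pi.single 0 r)
        (LinChain.map (Fin.cons 0) (crossPoly R n)) ∈
          Finsupp.supported R R (crossFacets (n + 1)) := by
      intro r hr
      rw [← LinearMap.comp_apply]
      refine Finsupp.map_mem_of_mem_supported _ (fun w hw => ?_) (crossPoly_mem n)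
      obtain ⟨ε, hε, hw⟩ := hw
      rw [LinearMap.comp_apply, LinChain.map_single, LinChain.cone_single]
      refine Finsupp.single_mem_supported _ _ ⟨Fin.cons r ε, fun i => ?_, fun i => ?_⟩
      · refine Fin.cases ?_ (fun i => ?_) i
        · simpa using hr
        · simpa using hε i
      · refine Fin.cases ?_ (fun i => ?_) i
        · simp
        · simp [hw, cons_zero_single]
    exact sub_mem (key 1 abs_one) (key (-1) (by norm_num))

lemma bd_crossPoly : ∀ n, LinChain.bd (crossPoly R (n + 1)) = 0
  | 0 => by rw [crossPoly, map_sub, LinChain.bd_cone_zero, LinChain.bd_cone_zero, sub_self]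
  | n + 1 => by
    rw [crossPoly, map_sub, LinChain.bd_cone, LinChain.bd_cone, LinChain.bd_map, bd_crossPoly n,
      map_zero, map_zero, map_zero, sub_zero, sub_self]

/-- Reflecting the cross-polytope in coordinate hyperplanes changes its orientation accordingly. -/
lemma map_crossPoly : ∀ (n : ℕ) (ε : Fin n → ℤ), (∀ i, ε i = 1 ∨ ε i = -1) →
    LinChain.map (fun v i => (ε i : ℝ) * v i) (crossPoly ℤ n) = (∏ i, ε i) • crossPoly ℤ n
  | 0, ε, _ => by
    simp [crossPoly]
  | n + 1, ε, hε => by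
    have hcomp : (fun (v : Fin (n + 1) → ℝ) i => (ε i : ℝ) * v i) ∘ Fin.cons 0 =
        Fin.cons 0 ∘ fun (v : Fin n → ℝ) i => (ε i.succ : ℝ) * v i := by
      funext v i
      refine Fin.cases ?_ (fun i => ?_) i <;> simp
    have hs : ∀ r : ℝ, (fun i => (ε i : ℝ) * (Pi.single 0 r : Fin (n + 1) → ℝ) i) =
        Pi.single 0 ((ε 0 : ℝ) * r) := by
      intro r
      funext i
      refine Fin.cases ?_ (fun i => ?_) i <;> simp
    rw [crossPoly, map_sub, LinChain.map_cone, LinChain.map_cone, LinChain.map_map, hcomp,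
      ← LinChain.map_map, map_crossPoly n _ (fun i => hε i.succ), Fin.prod_univ_succ, hs, hs]
    simp only [map_smul]
    rcases hε 0 with h | h <;> rw [h]
    · simp [smul_sub]
    · simp [smul_sub, neg_add_eq_sub]

variable (R) in
/-- The cross-polytope as a singular cycle of the punctured space. -/
noncomputable def octa (n : ℕ) : Chain R n (Fin n → ℝ) := real (crossPoly R n)

lemma crossFacets_ne_zero {w : Fin n → Fin n → ℝ} (hw : w ∈ crossFacets n) (t : Simp n) :
    ∑ i, t i • w i ≠ 0 := by
  obtain ⟨ε, hε, hw⟩ := hw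
  intro h
  have hi : ∀ i, t i = 0 := by
    intro i
    have := congrFun h i
    simp only [Finset.sum_apply, Pi.smul_apply, hw, smul_eq_mul, Pi.zero_apply, Pi.single_apply,
      mul_ite, mul_zero, Finset.sum_ite_eq, Finset.mem_univ, if_true] at this
    exact (mul_eq_zero.1 this).resolve_right (abs_pos.1 (by rw [hε i]; exact one_pos))
  simpa [hi] using stdSimplex.sum_eq_one t

lemma octa_mem : octa R n ∈ sing R n {(0 : Fin n → ℝ)}ᶜ :=
  real_mem (fun _ hw t => crossFacets_ne_zero hw t) (crossPoly_mem n)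

lemma isCycle_octa : ∀ n, IsCycle (octa R n)
  | 0 => trivial
  | n + 1 => by
    change bd _ = 0
    rw [octa, bd_real, bd_crossPoly, map_zero]

/-- The cross-polytope is not a boundary in the punctured space: its equator is the cross-polytope of
one dimension less. -/
theorem not_isBdry_octa [Nontrivial R] : ∀ n, ¬ IsBdry {(0 : Fin n → ℝ)}ᶜ (octa R n)
  | 0, h => by
    obtain ⟨w, hw, hwb⟩ := h
    have h0 : ({0}ᶜ : Set (Fin 0 → ℝ)) = ∅ := by ext x; simp [Subsingleton.elim x 0]
    obtain rfl := eq_zero_of_mem_sing_empty (h0 ▸ hw)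
    rw [map_zero, octa, crossPoly, real_single, eq_comm, Finsupp.single_eq_zero] at hwb
    exact one_ne_zero hwb
  | n + 1, h => by
    let e : (Fin (n + 1) → ℝ) →ₗ[ℝ] (Fin n → ℝ) × ℝ :=
      { toFun := fun v => (Fin.tail v, v 0), map_add' := fun _ _ => rfl, map_smul' := fun _ _ => rfl }
    let i : (Fin n → ℝ) →ₗ[ℝ] (Fin n → ℝ) × ℝ := LinearMap.inl ℝ _ _
    let y : ℝ → Chain R (n + 1) ((Fin n → ℝ) × ℝ) := fun r =>
      real (LinChain.cone (0, r) (LinChain.map i (crossPoly R n)))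
    have he : push e (octa R (n + 1)) = y 1 + -y (-1) := by
      have h1 : ∀ r : ℝ, e (Pi.single 0 r) = (0, r) := by
        intro r
        refine Prod.ext ?_ ?_
        · funext j
          exact Pi.single_eq_of_ne (Fin.succ_ne_zero j) r
        · exact Pi.single_eq_same (M := fun _ : Fin (n + 1) => ℝ) 0 r
      have h2 : e ∘ Fin.cons 0 = i := by
        funext v
        exact Prod.ext (Fin.tail_cons (α := fun _ => ℝ) 0 v) (Fin.cons_zero (α := fun _ => ℝ) 0 v)
      rw [octa, push_real, crossPoly, map_sub, LinChain.map_cone, LinChain.map_cone,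
        LinChain.map_map, h1, h1, h2, map_sub, sub_eq_add_neg]
    have hmem : ∀ (r : ℝ) (U : Set ((Fin n → ℝ) × ℝ)), (∀ p : (Fin n → ℝ) × ℝ, p.1 ≠ 0 → p ∈ U) →
        (∀ a : ℝ, 0 < a → ∀ v, (v, a * r) ∈ U) → y r ∈ sing R (n + 1) U := by
      intro r U hU1 hU2
      have hs : LinChain.cone (0, r) (LinChain.map i (crossPoly R n)) ∈ Finsupp.supported R R
          {w | ∃ w' ∈ crossFacets n, w = Fin.cons (0, r) (i ∘ w')} := by
        rw [← LinearMap.comp_apply]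
        refine Finsupp.map_mem_of_mem_supported _ (fun w hw => ?_) (crossPoly_mem n)
        rw [LinearMap.comp_apply, LinChain.map_single, LinChain.cone_single]
        exact Finsupp.single_mem_supported _ _ ⟨w, hw, rfl⟩
      refine real_mem ?_ hs
      rintro _ ⟨w, ⟨ε, hε, hw⟩, rfl⟩ t
      rw [Fin.sum_univ_succ]
      simp only [Fin.cons_zero, Fin.cons_succ, Function.comp_apply]
      rcases (stdSimplex.zero_le t 0).eq_or_lt with h0 | h0
      · apply hU1
        intro hz
        have hi : ∀ j : Fin n, t j.succ = 0 := by
          intro j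
          have := congrFun hz j
          simp [i, hw, Prod.fst_sum, Finset.sum_apply, Pi.single_apply] at this
          exact this.resolve_right (abs_pos.1 (by rw [hε j]; exact one_pos))
        have := stdSimplex.sum_eq_one t
        rw [Fin.sum_univ_succ, ← h0] at this
        simp [hi] at this
      · convert hU2 _ h0 (∑ j, t (Fin.succ j) • w j) using 1
        refine Prod.ext ?_ ?_
        · simp [i, Prod.fst_sum]
        · simp [i, Prod.snd_sum]
    have hb := h.push (f := e) (V := {(0 : (Fin n → ℝ) × ℝ)}ᶜ)
      (LinearMap.continuous_of_finiteDimensional e).continuousOn (by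
        intro v hv hz
        refine hv ?_
        funext j
        refine Fin.cases ?_ (fun j => ?_) j
        · exact congrArg Prod.snd hz
        · exact congrFun (congrArg Prod.fst hz) j)
    rw [he] at hb
    have := isBdry_equator (hmem 1 (upper _) (fun p hp => Or.inl hp) fun a ha v => Or.inr (by simpa))
      (neg_mem (hmem (-1) (lower _) (fun p hp => Or.inl hp) fun a ha v => Or.inr (by simpa))) hb
    have hy1 : bd (y 1) = real (LinChain.map i (crossPoly R n)) := by
      rw [bd_real]
      congr 1
      cases n with
      | zero => rw [LinChain.bd_cone_zero]
      | succ n => rw [LinChain.bd_cone, LinChain.bd_map, bd_crossPoly, map_zero, map_zero, sub_zero]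
    rw [hy1, ← push_real, push_push] at this
    refine not_isBdry_octa n ?_
    have hi : Prod.fst ∘ i = id := by funext v; rfl
    rwa [hi, push_id] at this

/-- An invertible matrix acts on the class of the cross-polytope by the sign of its determinant: this
holds for transvections, which are homotopic to the identity, and for diagonal matrices, which are
homotopic to diagonal matrices with entries `± 1`. -/
theorem isBdry_push_octa (A : Matrix (Fin n) (Fin n) ℝ) (hA : A.det ≠ 0) :
    IsBdry {(0 : Fin n → ℝ)}ᶜ (push A.mulVec (octa ℤ n) - (SignType.sign A.det : ℤ) • octa ℤ n) := by
  have hmul0 : ∀ B : Matrix (Fin n) (Fin n) ℝ, B.det ≠ 0 →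
      Set.MapsTo B.mulVec {(0 : Fin n → ℝ)}ᶜ {0}ᶜ := by
    intro B hB v hv h0
    exact hv (Matrix.eq_zero_of_mulVec_eq_zero hB h0)
  have hcont : ∀ B : Matrix (Fin n) (Fin n) ℝ, Continuous B.mulVec := fun B => by fun_prop
  refine Matrix.diagonal_transvection_induction_of_det_ne_zero (fun A =>
    IsBdry {(0 : Fin n → ℝ)}ᶜ (push A.mulVec (octa ℤ n) - (SignType.sign A.det : ℤ) • octa ℤ n))
    A hA ?_ ?_ ?_
  · intro D hD
    rw [Matrix.det_diagonal] at hD ⊢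
    have hDi : ∀ i, D i ≠ 0 := fun i => Finset.prod_ne_zero_iff.1 hD i (Finset.mem_univ i)
    have h0 : push (fun (v : Fin n → ℝ) i => ((SignType.sign (D i) : ℤ) : ℝ) * v i) (octa ℤ n) =
        (SignType.sign (∏ i, D i) : ℤ) • octa ℤ n := by
      have hs : (SignType.sign (∏ i, D i) : ℤ) = ∏ i, (SignType.sign (D i) : ℤ) :=
        map_prod ((SignType.castHom (α := ℤ)).comp (signHom (α := ℝ))) D Finset.univ
      let f : (Fin n → ℝ) →ₗ[ℝ] (Fin n → ℝ) :=
        (Matrix.diagonal fun i => ((SignType.sign (D i) : ℤ) : ℝ)).mulVecLin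
      have hf : (f : (Fin n → ℝ) → (Fin n → ℝ)) =
          fun v i => ((SignType.sign (D i) : ℤ) : ℝ) * v i := by
        funext v i
        simp [f, Matrix.mulVec_diagonal]
      rw [← hf, octa, push_real, hf, map_crossPoly, hs, map_smul]
      intro i
      rcases lt_or_gt_of_ne (hDi i) with h | h
      · right; simp [sign_neg h]
      · left; simp [sign_pos h]
    rw [← h0]
    have := isBdry_homotopy (V := {(0 : Fin n → ℝ)}ᶜ) (octa_mem (R := ℤ) (n := n)) (isCycle_octa n)
      (h := fun s v i => ((1 - s) * ((SignType.sign (D i) : ℤ) : ℝ) + s * D i) * v i) (by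
        refine Continuous.continuousOn ?_
        unfold Function.uncurry
        fun_prop) (by
        intro s hs v hv h
        refine hv (funext fun i => ?_)
        refine (mul_eq_zero.1 (congrFun h i)).resolve_left ?_
        obtain ⟨hs0, hs1⟩ := hs
        rcases lt_or_gt_of_ne (hDi i) with h | h
        · rw [sign_neg h]
          simp only [SignType.coe_one, SignType.coe_neg, Int.cast_neg, Int.cast_one]
          rcases hs0.eq_or_lt with rfl | hs0
          · norm_num
          · nlinarith [mul_pos hs0 (neg_pos.2 h)]
        · rw [sign_pos h]
          simp only [SignType.coe_one, Int.cast_one]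
          rcases hs0.eq_or_lt with rfl | hs0
          · norm_num
          · nlinarith [mul_pos hs0 h])
    have hd : (Matrix.diagonal D).mulVec = fun v i => D i * v i := by
      funext v i; simp [Matrix.mulVec_diagonal]
    rw [hd]
    simpa using this
  · intro t
    have hdet : ∀ s : ℝ, (Matrix.transvection t.i t.j (s * t.c)).det = 1 := fun s =>
      Matrix.det_transvection_of_ne _ _ t.hij _
    have := isBdry_homotopy (V := {(0 : Fin n → ℝ)}ᶜ) (octa_mem (R := ℤ) (n := n)) (isCycle_octa n)
      (h := fun s => (Matrix.transvection t.i t.j (s * t.c)).mulVec) (by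
        refine Continuous.continuousOn ?_
        have ht : ∀ p : ℝ × (Fin n → ℝ), (Matrix.transvection t.i t.j (p.1 * t.c)).mulVec p.2 =
            p.2 + p.1 • (Matrix.single t.i t.j t.c).mulVec p.2 := fun p => by
          rw [Matrix.transvection, ← smul_eq_mul, ← Matrix.smul_single, Matrix.add_mulVec,
            Matrix.one_mulVec, Matrix.smul_mulVec]
        unfold Function.uncurry
        simp only [ht]
        fun_prop) (fun s _ => hmul0 _ (by rw [hdet]; exact one_ne_zero))
    simp only [one_mul, zero_mul, Matrix.transvection_zero] at this
    rw [Matrix.TransvectionStruct.det, sign_one, SignType.coe_one, one_smul]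
    have h1 : (1 : Matrix (Fin n) (Fin n) ℝ).mulVec = id := by funext v; simp
    rwa [h1, push_id] at this
  · intro A B hA hB h1 h2
    have h3 := (h2.push (hcont A).continuousOn (hmul0 A hA)).add
      (h1.smul (SignType.sign B.det : ℤ))
    rw [map_sub, push_push, map_smul, smul_sub, sub_add_sub_cancel, smul_smul] at h3
    rw [Matrix.det_mul, sign_mul, SignType.coe_mul, mul_comm (SignType.sign A.det : ℤ)]
    convert h3 using 4
    funext v
    simp [Matrix.mulVec_mulVec]

end Chain

/-! ### Relative classes of compact subsets of manifolds -/

namespace Chain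

variable {R : Type*} [CommRing R] {m n k : ℕ} {X Y : Type*}
  [TopologicalSpace X] [TopologicalSpace Y]

lemma exists_isCompact_mem_sing {U : Set X} {c : Chain R m X} (hc : c ∈ sing R m U) :
    ∃ C, IsCompact C ∧ C ⊆ U ∧ c ∈ sing R m C := by
  refine ⟨⋃ σ ∈ c.support, Set.range σ, ?_, ?_, ?_⟩
  · exact c.support.isCompact_biUnion fun σ hσ => isCompact_range (hc hσ).1
  · refine Set.iUnion₂_subset fun σ hσ => ?_
    rintro _ ⟨t, rfl⟩
    exact (hc hσ).2 t
  · intro σ hσ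
    exact ⟨(hc hσ).1, fun t => Set.mem_biUnion hσ ⟨t, rfl⟩⟩

lemma isBdry_push_homeomorph (e : X ≃ₜ Y) {U : Set X} {z : Chain R m X} :
    IsBdry (e '' U) (push e z) ↔ IsBdry U z := by
  refine ⟨fun h => ?_, fun h => h.push e.continuous.continuousOn (Set.mapsTo_image _ _)⟩
  have := h.push (f := e.symm) (V := U) e.symm.continuous.continuousOn (by
    rintro _ ⟨x, hx, rfl⟩; simpa using hx)
  rw [push_push] at this
  have he : e.symm ∘ e = id := by ext; simp
  rwa [he, push_id] at this

section NormedSpace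

variable {V : Type} [NormedAddCommGroup V] [NormedSpace ℝ V]

lemma nullIn_singleton_iff {x : V} {z : Chain R (m + 1) V}
    (hz : z ∈ sing R (m + 1) Set.univ) : NullIn Set.univ {x} z ↔ IsBdry {x}ᶜ (bd z) := by
  rw [Set.compl_eq_univ_sdiff]
  constructor
  · rintro ⟨w, hw, hwz⟩
    exact ⟨_, hwz, by rw [map_sub, bd_bd, sub_zero]⟩
  · rintro ⟨w, hw, hwz⟩
    obtain ⟨v, hv, hvz⟩ := exists_bd_eq_of_starConvex (starConvex_univ x) (Set.mem_univ x)
      (sub_mem hz (sing_mono (Set.subset_univ _) hw)) (by rw [map_sub, hwz, sub_self])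
    exact ⟨v, hv, by rwa [hvz, sub_sub_cancel]⟩

lemma isBdry_compl_singleton_iff {V : Type*} [NormedAddCommGroup V] (x : V) {z : Chain R m V} :
    IsBdry {x}ᶜ z ↔ IsBdry {0}ᶜ (push (fun v => v - x) z) := by
  have h := isBdry_push_homeomorph (R := R) (m := m) (Homeomorph.subRight x) (U := {x}ᶜ) (z := z)
  rw [Set.image_compl_eq (Homeomorph.bijective _), Set.image_singleton] at h
  simpa using h.symm

/-- Local homology vanishes above the dimension. -/
lemma nullIn_singleton_of_finrank_lt [FiniteDimensional ℝ V] {z : Chain R (m + 1) V} {x : V}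
    (hz : z ∈ sing R (m + 1) Set.univ) (hm : Module.finrank ℝ V < m)
    (hbd : bd z ∈ sing R m (Set.univ \ {x})) : NullIn Set.univ {x} z := by
  rw [nullIn_singleton_iff hz, isBdry_compl_singleton_iff]
  refine isBdry_of_finrank_lt _ V rfl hm ?_ ((isCycle_bd z).push _)
  exact push_mem (by fun_prop) (fun v hv => by simpa [sub_eq_zero] using hv) hbd

/-- A class that vanishes at one point of a bounded convex set vanishes on the whole set, as one
sees by dilating from the point. -/
lemma NullIn.of_convex {K : Set V} (hK : Convex ℝ K) (hKb : Bornology.IsBounded K) {x : V}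
    (hx : x ∈ K) {z : Chain R (m + 1) V} (hz : z ∈ sing R (m + 1) Set.univ)
    (hbd : bd z ∈ sing R m (Set.univ \ K)) (h : NullIn Set.univ {x} z) : NullIn Set.univ K z := by
  obtain ⟨w, hw, hu⟩ := h
  obtain ⟨C, hC, hCx, hu⟩ := exists_isCompact_mem_sing hu
  obtain ⟨ε, hε, hεC⟩ : ∃ ε > 0, Metric.ball x ε ⊆ Cᶜ :=
    Metric.isOpen_iff.1 hC.isClosed.isOpen_compl x fun hxC => (hCx hxC).2 rfl
  obtain ⟨r, hr⟩ := hKb.subset_closedBall x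
  have hr0 : 0 ≤ r := dist_nonneg.trans (hr hx)
  let h : ℝ → V → V := fun s v => x + (1 + s * (r / ε)) • (v - x)
  have hh : Continuous (Function.uncurry h) := by
    unfold Function.uncurry
    fun_prop
  have hpos : ∀ s ∈ Set.Icc (0 : ℝ) 1, 1 ≤ 1 + s * (r / ε) := fun s hs => by
    have := hs.1
    have : 0 ≤ s * (r / ε) := by positivity
    linarith
  have hout : ∀ s ∈ Set.Icc (0 : ℝ) 1, ∀ v ∈ Set.univ \ K, h s v ∈ Set.univ \ K := by
    rintro s hs v ⟨-, hv⟩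
    refine ⟨trivial, fun hsv => hv ?_⟩
    have h1 := hpos s hs
    have h0 : (1 + s * (r / ε)) ≠ 0 := by linarith
    have := hK.add_smul_sub_mem hx hsv
      (t := (1 + s * (r / ε))⁻¹) ⟨by positivity, inv_le_one_of_one_le₀ h1⟩
    simpa [h, smul_smul, inv_mul_cancel₀ h0] using this
  have h0 : h 0 = id := by
    funext v; simp [h]
  have hhom := nullIn_homotopy (V := Set.univ) (L := K) hz hbd hh.continuousOn
    (fun _ _ _ _ => trivial) hout
  rw [h0, push_id] at hhom
  refine hhom.congr.1 ⟨Chain.push (h 1) w, push_mem (Continuous.continuousOn ?_) (Set.mapsTo_univ _ _) hw, ?_⟩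
  · exact hh.comp (Continuous.prodMk_right 1)
  rw [bd_push, ← map_sub]
  refine push_mem (Continuous.continuousOn ?_) ?_ hu
  · exact hh.comp (Continuous.prodMk_right 1)
  · refine fun v hv => ⟨trivial, fun hvK => ?_⟩
    have h1 : ε ≤ dist v x := by
      by_contra! hlt
      exact hεC hlt hv
    have h2 := hr hvK
    rw [Metric.mem_closedBall, dist_eq_norm] at h2
    simp only [h, one_mul, add_sub_cancel_left, norm_smul, ← dist_eq_norm v x] at h2
    rw [Real.norm_of_nonneg (by positivity)] at h2
    have h3 : (1 + r / ε) * ε = ε + r := by field_simp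
    have h4 : (1 + r / ε) * ε ≤ (1 + r / ε) * dist v x := by gcongr
    linarith

/-- The Mayer–Vietoris induction over finite unions of compact convex sets; the intersections that
occur are again convex, and above the dimension all their classes vanish. -/
lemma nullIn_biUnion_convex [FiniteDimensional ℝ V] {ι : Type*} (s : Finset ι) :
    ∀ (K : ι → Set V), (∀ i, Convex ℝ (K i)) → (∀ i, IsCompact (K i)) → ∀ {m : ℕ},
      Module.finrank ℝ V ≤ m → ∀ {z : Chain R (m + 1) V}, z ∈ sing R (m + 1) Set.univ →
      bd z ∈ sing R m (Set.univ \ ⋃ i ∈ s, K i) → (∀ i ∈ s, NullIn Set.univ (K i) z) →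
      NullIn Set.univ (⋃ i ∈ s, K i) z := by
  classical
  induction s using Finset.induction_on with
  | empty =>
    intro K _ _ m _ z hz _ _
    exact nullIn_of_mem (by simpa using hz)
  | insert a s ha ih =>
    intro K hc hK m hm z hz hbd h
    rw [Finset.set_biUnion_insert, Set.union_comm] at hbd ⊢
    have hopen : ∀ C : Set V, IsCompact C → IsOpen (Set.univ \ C) := fun C hC => by
      rw [← Set.compl_eq_univ_sdiff]
      exact hC.isClosed.isOpen_compl
    refine NullIn.union (hopen _ (s.isCompact_biUnion fun i _ => hK i)) (hopen _ (hK a)) ?_ ?_ ?_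
    · intro v hv hbv
      rw [Set.iUnion₂_inter] at hbv ⊢
      refine ih (fun i => K i ∩ K a) (fun i => (hc i).inter (hc a))
        (fun i => (hK i).inter_right (hK a).isClosed) (by omega) hv hbv fun i hi => ?_
      have hbv' : bd v ∈ sing R (m + 1) (Set.univ \ (K i ∩ K a)) :=
        sing_mono (Set.sdiff_subset_sdiff_right (Set.subset_biUnion_of_mem
          (u := fun i => K i ∩ K a) hi)) hbv
      rcases (K i ∩ K a).eq_empty_or_nonempty with he | ⟨x, hx⟩
      · rw [he]
        exact nullIn_of_mem (by simpa using hv)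
      · exact NullIn.of_convex ((hc i).inter (hc a))
          ((hK i).inter_right (hK a).isClosed).isBounded hx hv hbv'
          (nullIn_singleton_of_finrank_lt hv (by omega)
            (sing_mono (Set.sdiff_subset_sdiff_right (Set.singleton_subset_iff.2 hx)) hbv'))
    · exact ih K hc hK hm hz
        (sing_mono (Set.sdiff_subset_sdiff_right Set.subset_union_left) hbd)
        fun i hi => h i (Finset.mem_insert_of_mem hi)
    · exact h a (Finset.mem_insert_self a s)

/-- In a vector space, classes of compact sets in degrees at least the dimension are detected at
points. -/
theorem nullIn_of_forall_singleton [FiniteDimensional ℝ V] {K : Set V} (hK : IsCompact K)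
    (hm : Module.finrank ℝ V ≤ m) {z : Chain R (m + 1) V} (hz : z ∈ sing R (m + 1) Set.univ)
    (hbd : bd z ∈ sing R m (Set.univ \ K)) (h : ∀ x ∈ K, NullIn Set.univ {x} z) :
    NullIn Set.univ K z := by
  obtain ⟨C, hC, hCK, hbC⟩ := exists_isCompact_mem_sing hbd
  have hball : ∀ x : V, ∃ r > 0, x ∈ K → Metric.closedBall x r ⊆ Cᶜ := by
    intro x
    by_cases hx : x ∈ K
    · obtain ⟨ε, hε, hεC⟩ : ∃ ε > 0, Metric.ball x ε ⊆ Cᶜ :=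
        Metric.isOpen_iff.1 hC.isClosed.isOpen_compl x fun hxC => (hCK hxC).2 hx
      exact ⟨ε / 2, half_pos hε, fun _ =>
        (Metric.closedBall_subset_ball (half_lt_self hε)).trans hεC⟩
    · exact ⟨1, one_pos, fun h => absurd h hx⟩
  choose r hr hrC using hball
  obtain ⟨t, htK, ht⟩ := hK.elim_nhds_subcover (fun x => Metric.closedBall x (r x))
    fun x _ => Metric.closedBall_mem_nhds x (hr x)
  have hsub : ∀ x ∈ t, bd z ∈ sing R m (Set.univ \ Metric.closedBall x (r x)) := fun x hx =>
    sing_mono (fun y hy => (⟨trivial,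
      fun hyx => hrC x (htK x hx) hyx hy⟩ : y ∈ Set.univ \ _)) hbC
  have hp : ProperSpace V := FiniteDimensional.proper ℝ V
  refine (nullIn_biUnion_convex t (fun x => Metric.closedBall x (r x))
    (fun x => convex_closedBall _ _) (fun x => isCompact_closedBall _ _) hm hz ?_ ?_).mono ht
  · refine sing_mono (V := Set.univ \ _) (fun y hy => ?_) hbC
    refine ⟨trivial, fun hyt => ?_⟩
    obtain ⟨x, hx, hyx⟩ := Set.mem_iUnion₂.1 hyt
    exact hrC x (htK x hx) hyx hy
  · exact fun x hx => NullIn.of_convex (convex_closedBall _ _) Metric.isBounded_closedBall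
      (Metric.mem_closedBall_self (hr x).le) hz (hsub x hx) (h x (htK x hx))

end NormedSpace

lemma isOpen_univ_sdiff {K : Set X} (hK : IsClosed K) : IsOpen (Set.univ \ K) := by
  rw [← Set.compl_eq_univ_sdiff]
  exact hK.isOpen_compl

/-- A relative class can be represented by a chain of an open neighbourhood. -/
lemma exists_mem_sing_nullIn_sub {U K : Set X} (hU : IsOpen U) (hK : IsClosed K) (hKU : K ⊆ U)
    {z : Chain R (m + 1) X} (hz : z ∈ sing R (m + 1) Set.univ)
    (hbd : bd z ∈ sing R m (Set.univ \ K)) :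
    ∃ z' ∈ sing R (m + 1) U, bd z' ∈ sing R m (U \ K) ∧ NullIn Set.univ K (z - z') := by
  obtain ⟨z', hz', hn, y, hy, hb⟩ := exists_excision hU (Set.subset_univ U)
    (isOpen_univ_sdiff hK) hKU hz (Submodule.mem_sup_right hbd)
  refine ⟨z', hz', ?_, hn⟩
  have h1 : bd z' ∈ sing R m (Set.univ \ K) := by
    rw [← sub_eq_of_eq_add hb]
    exact sub_mem hbd (bd_mem hy)
  have h2 : U ∩ (Set.univ \ K) ⊆ U \ K := fun x hx => ⟨hx.1, hx.2.2⟩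
  exact sing_mono h2 (mem_sing_inter (bd_mem hz') h1)

lemma bd_push_mem (e : OpenPartialHomeomorph X Y) {K : Set X} (hK : K ⊆ e.source)
    {z : Chain R (m + 1) X} (hbd : bd z ∈ sing R m (e.source \ K)) :
    bd (push e z) ∈ sing R m (Set.univ \ e '' K) := by
  rw [bd_push]
  refine push_mem (V := Set.univ \ _) (e.continuousOn.mono Set.sdiff_subset)
    (fun x hx => ⟨trivial, ?_⟩) hbd
  rintro ⟨y, hy, hyx⟩
  exact hx.2 (e.injOn (hK hy) hx.1 hyx ▸ hy)

/-- In a manifold, classes of compact subsets of a chart domain in degrees at least the dimension are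
detected at points. -/
theorem nullIn_of_forall_singleton_chart [T2Space X] {V : Type} [NormedAddCommGroup V]
    [NormedSpace ℝ V] [FiniteDimensional ℝ V] (e : OpenPartialHomeomorph X V) {K : Set X}
    (hK : IsCompact K) (hKe : K ⊆ e.source) (hm : Module.finrank ℝ V ≤ m)
    {z : Chain R (m + 1) X} (hz : z ∈ sing R (m + 1) Set.univ)
    (hbd : bd z ∈ sing R m (Set.univ \ K)) (h : ∀ x ∈ K, NullIn Set.univ {x} z) :
    NullIn Set.univ K z := by
  obtain ⟨z', hz', hbd', hn⟩ := exists_mem_sing_nullIn_sub e.open_source hK.isClosed hKe hz hbd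
  have hK' : IsCompact (e '' K) := hK.image_of_continuousOn (e.continuousOn.mono hKe)
  rw [hn.congr, ← nullIn_push_iff e hKe hK.isClosed hK'.isClosed hz']
  refine nullIn_of_forall_singleton hK' hm
    (push_mem e.continuousOn (Set.mapsTo_univ _ _) hz') (bd_push_mem e hKe hbd') ?_
  rintro _ ⟨x, hx, rfl⟩
  rw [← Set.image_singleton, nullIn_push_iff e (Set.singleton_subset_iff.2 (hKe hx))
    isClosed_singleton (by simp) hz', ← (hn.mono (Set.singleton_subset_iff.2 hx)).congr]
  exact h x hx

end Chain

/-! ### Local orientations -/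

namespace Chain

variable {R : Type*} [CommRing R] {m n k : ℕ} {X Y : Type*}
  [TopologicalSpace X] [TopologicalSpace Y]

/-- Coordinates on Euclidean space. -/
noncomputable def toE (n : ℕ) : (Fin n → ℝ) ≃L[ℝ] EuclideanSpace ℝ (Fin n) :=
  (EuclideanSpace.equiv (Fin n) ℝ).symm

variable (R) in
/-- The solid cross-polytope, a generator of the local homology of Euclidean space at the origin. -/
noncomputable def gen (n : ℕ) : Chain R (n + 1) (EuclideanSpace ℝ (Fin n)) :=
  real (LinChain.cone 0 (LinChain.map (toE n) (crossPoly R n)))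

lemma bd_gen : bd (gen R n) = push (toE n) (octa R n) := by
  have h : ∀ n, LinChain.bd (LinChain.cone (0 : EuclideanSpace ℝ (Fin n))
      (LinChain.map (toE n) (crossPoly R n))) = LinChain.map (toE n) (crossPoly R n)
    | 0 => LinChain.bd_cone_zero _ _
    | n + 1 => by rw [LinChain.bd_cone, LinChain.bd_map, bd_crossPoly, map_zero, map_zero, sub_zero]
  rw [gen, bd_real, h, octa]
  exact (push_real (toE n).toLinearMap _).symm

lemma gen_mem : gen R n ∈ sing R (n + 1) (Metric.closedBall (0 : EuclideanSpace ℝ (Fin n)) 1) := by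
  have hs : LinChain.cone (0 : EuclideanSpace ℝ (Fin n)) (LinChain.map (toE n) (crossPoly R n)) ∈
      Finsupp.supported R R {w | ∀ i, w i ∈ Metric.closedBall (0 : EuclideanSpace ℝ (Fin n)) 1} := by
    rw [← LinearMap.comp_apply]
    refine Finsupp.map_mem_of_mem_supported _ (fun w hw => ?_) (crossPoly_mem n)
    obtain ⟨ε, hε, hw⟩ := hw
    rw [LinearMap.comp_apply, LinChain.map_single, LinChain.cone_single]
    refine Finsupp.single_mem_supported _ _ (fun i => ?_ : ∀ i, _)
    refine Fin.cases ?_ (fun i => ?_) i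
    · simp
    · have : toE n (Pi.single i (ε i)) = EuclideanSpace.single i (ε i) := rfl
      simp [hw, this, hε]
  exact real_mem (fun w hw t => (convex_closedBall _ _).sum_mem
    (fun i _ => stdSimplex.zero_le t i) (stdSimplex.sum_eq_one t) (fun i _ => (hw : ∀ i, _) i)) hs

lemma bd_gen_mem : bd (gen R n) ∈ sing R n {(0 : EuclideanSpace ℝ (Fin n))}ᶜ := by
  rw [bd_gen]
  exact push_mem_compl_zero (toE n) octa_mem

/-- A linear map of positive determinant preserves the local generator. -/
lemma nullIn_push_gen (L : EuclideanSpace ℝ (Fin n) →L[ℝ] EuclideanSpace ℝ (Fin n))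
    (hL : 0 < L.det) : NullIn Set.univ {0} (push L (gen ℤ n) - gen ℤ n) := by
  have hu : ∀ z : EuclideanSpace ℝ (Fin n) → EuclideanSpace ℝ (Fin n), Continuous z →
      push z (gen ℤ n) ∈ sing ℤ (n + 1) Set.univ := fun z hz =>
    push_mem hz.continuousOn (Set.mapsTo_univ _ _) gen_mem
  rw [nullIn_singleton_iff (sub_mem (hu L L.continuous) (by simpa using hu id continuous_id)),
    map_sub, bd_push, bd_gen]
  let f : (Fin n → ℝ) →ₗ[ℝ] (Fin n → ℝ) :=
    (toE n).symm.toLinearMap ∘ₗ L.toLinearMap ∘ₗ (toE n).toLinearMap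
  have hdet : f.toMatrix'.det = L.det := by
    rw [LinearMap.det_toMatrix']
    exact LinearMap.det_conj L.toLinearMap (toE n).symm.toLinearEquiv
  have hf : f.toMatrix'.mulVec = f := by
    funext v
    rw [LinearMap.toMatrix'_mulVec]
  have h := isBdry_push_octa f.toMatrix' (by rw [hdet]; exact hL.ne')
  rw [hdet, sign_pos hL, SignType.coe_one, one_smul, hf, ← isBdry_push_equiv (toE n), map_sub,
    push_push] at h
  rw [push_push]
  convert h using 4
  funext v
  simp [f]

/-- The local generator at the point `x`, of size `r`, in the chart `e`. It is meaningful only if the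
closed ball of radius `r` around `e x` lies in the target of `e`. -/
noncomputable def locGen (e : OpenPartialHomeomorph X (EuclideanSpace ℝ (Fin n))) (x : X) (r : ℝ) :
    Chain R (n + 1) X := push (fun v => e.symm (e x + r • v)) (gen R n)

/-- Homotopic ways to place the generator in a chart give the same local class, as long as the set
`C`, which carries the boundary of the generator, stays away from the point. -/
lemma nullIn_push_gen_homotopy (e : OpenPartialHomeomorph X (EuclideanSpace ℝ (Fin n)))
    {x : X} {C : Set (EuclideanSpace ℝ (Fin n))} (hC : bd (gen R n) ∈ sing R n C)
    (φ : ℝ → EuclideanSpace ℝ (Fin n) → EuclideanSpace ℝ (Fin n))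
    (hφ : ContinuousOn (Function.uncurry φ) (Set.Icc 0 1 ×ˢ Metric.closedBall 0 1))
    (hφe : ∀ s ∈ Set.Icc (0 : ℝ) 1, ∀ v ∈ Metric.closedBall 0 1, φ s v ∈ e.target)
    (hφx : ∀ s ∈ Set.Icc (0 : ℝ) 1, ∀ v ∈ C, v ∈ Metric.closedBall 0 1 → φ s v ≠ e x) :
    NullIn Set.univ {x} (push (fun v => e.symm (φ 1 v)) (gen R n) -
      push (fun v => e.symm (φ 0 v)) (gen R n)) := by
  refine nullIn_homotopy (h := fun s v => e.symm (φ s v)) (U := Metric.closedBall 0 1) (K := Cᶜ)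
    gen_mem ?_ ?_ (fun _ _ _ _ => trivial) ?_
  · rw [Set.sdiff_compl]
    exact mem_sing_inter (bd_mem gen_mem) hC
  · exact e.continuousOn_symm.comp hφ fun p hp => hφe p.1 hp.1 p.2 hp.2
  · rintro s hs v ⟨hv, hvC⟩
    refine ⟨trivial, fun h => hφx s hs v (not_not.1 hvC) hv ?_⟩
    rw [← Set.mem_singleton_iff.1 h, e.right_inv (hφe s hs v hv)]

lemma smul_mem_closedBall {E : Type*} [NormedAddCommGroup E] [NormedSpace ℝ E] {a v : E} {r : ℝ}
    (hr : 0 ≤ r) (hv : v ∈ Metric.closedBall (0 : E) 1) : a + r • v ∈ Metric.closedBall a r := by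
  rw [mem_closedBall_zero_iff] at hv
  rw [Metric.mem_closedBall, dist_eq_norm, add_sub_cancel_left, norm_smul, Real.norm_of_nonneg hr]
  exact mul_le_of_le_one_right hr hv

lemma nullIn_locGen_sub (e : OpenPartialHomeomorph X (EuclideanSpace ℝ (Fin n))) {x : X}
    {r r' : ℝ} (hr : 0 < r) (hr' : 0 < r')
    (h : Metric.closedBall (e x) r ⊆ e.target) (h' : Metric.closedBall (e x) r' ⊆ e.target) :
    NullIn Set.univ {x} (locGen (R := R) e x r - locGen e x r') := by
  have hpos : ∀ s ∈ Set.Icc (0 : ℝ) 1, 0 < (1 - s) * r' + s * r := by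
    rintro s ⟨h0, h1⟩
    rcases h0.eq_or_lt with rfl | h0
    · simpa
    · have := mul_pos h0 hr
      have := mul_nonneg (sub_nonneg.2 h1) hr'.le
      linarith
  have := nullIn_push_gen_homotopy (R := R) e (x := x) bd_gen_mem
    (fun s v => e x + ((1 - s) * r' + s * r) • v) (by
      refine Continuous.continuousOn ?_
      unfold Function.uncurry
      fun_prop) (by
      intro s hs v hv
      have hmem := smul_mem_closedBall (a := e x) (hpos s hs).le hv
      rcases le_total r r' with hrr | hrr
      · refine h' (Metric.closedBall_subset_closedBall ?_ hmem)
        nlinarith [hs.1, hs.2]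
      · refine h (Metric.closedBall_subset_closedBall ?_ hmem)
        nlinarith [hs.1, hs.2]) (by
      intro s hs v hv _
      simpa [(hpos s hs).ne'] using hv)
  simpa [locGen] using this

/-- Charts whose transition map has positive Jacobian determinant give the same local generator: on a
small ball the transition map deforms linearly to its derivative, which preserves the generator. -/
lemma nullIn_locGen_sub_locGen (e e' : OpenPartialHomeomorph X (EuclideanSpace ℝ (Fin n))) {x : X}
    (hx : x ∈ e.source) (hx' : x ∈ e'.source)
    {L : EuclideanSpace ℝ (Fin n) →L[ℝ] EuclideanSpace ℝ (Fin n)}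
    (hL : HasFDerivAt (e.symm.trans e') L (e x)) (hdet : 0 < L.det) {r r' : ℝ}
    (hr : 0 < r) (hr' : 0 < r') (h : Metric.closedBall (e x) r ⊆ e.target)
    (h' : Metric.closedBall (e' x) r' ⊆ e'.target) :
    NullIn Set.univ {x} (locGen (R := ℤ) e x r - locGen e' x r') := by
  set f := e.symm.trans e' with hf
  set a := e x with ha
  set a' := e' x with ha'
  have hex : f a = a' := by simp [hf, ha, ha', hx]
  obtain ⟨c, hc, hcL⟩ : ∃ c > 0, ∀ v, c * ‖v‖ ≤ ‖L v‖ := by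
    let L' := L.toContinuousLinearEquivOfDetNeZero hdet.ne'
    refine ⟨(‖(L'.symm : EuclideanSpace ℝ (Fin n) →L[ℝ] EuclideanSpace ℝ (Fin n))‖ + 1)⁻¹,
      by positivity, fun v => ?_⟩
    rw [inv_mul_le_iff₀ (by positivity)]
    have h1 := (L'.symm : EuclideanSpace ℝ (Fin n) →L[ℝ] EuclideanSpace ℝ (Fin n)).le_opNorm (L v)
    have h2 : L'.symm (L v) = v := L'.symm_apply_apply v
    rw [ContinuousLinearEquiv.coe_coe, h2] at h1
    nlinarith [norm_nonneg (L v)]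
  have hfa : a ∈ f.source := by simp [hf, ha, hx, hx']
  obtain ⟨ρ, hρ, hρf⟩ := Metric.nhds_basis_closedBall.eventually_iff.1
    ((hL.isLittleO.def (half_pos hc)).and (f.open_source.mem_nhds hfa))
  -- a common small size
  set B := ‖L‖ + c + 2 with hB
  have hB0 : 0 < B := by positivity
  set r₀ := min ρ (r' / B) with hr₀
  have hr₀0 : 0 < r₀ := lt_min hρ (by positivity)
  have hr₀B : r₀ * B ≤ r' := by
    rw [← le_div_iff₀ hB0]
    exact min_le_right _ _
  have hball : ∀ v ∈ Metric.closedBall (0 : EuclideanSpace ℝ (Fin n)) 1,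
      ‖f (a + r₀ • v) - a' - r₀ • L v‖ ≤ c / 2 * (r₀ * ‖v‖) ∧ a + r₀ • v ∈ f.source := by
    intro v hv
    obtain ⟨h1, h2⟩ := hρf (Metric.closedBall_subset_closedBall (min_le_left _ _)
      (smul_mem_closedBall (a := a) hr₀0.le hv))
    rw [hex, add_sub_cancel_left, map_smul, norm_smul, Real.norm_of_nonneg hr₀0.le] at h1
    exact ⟨h1, h2⟩
  have hnorm : ∀ v ∈ Metric.closedBall (0 : EuclideanSpace ℝ (Fin n)) 1, ‖v‖ ≤ 1 :=
    fun v hv => by simpa using hv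
  have hr₀e : Metric.closedBall a r₀ ⊆ e.target := fun y hy =>
    (hρf (Metric.closedBall_subset_closedBall (min_le_left _ _) hy)).2.1
  have hr₀e' : Metric.closedBall a' r₀ ⊆ e'.target :=
    (Metric.closedBall_subset_closedBall (by nlinarith [norm_nonneg L])).trans h'
  -- deform the transition map to its derivative
  let φ : ℝ → EuclideanSpace ℝ (Fin n) → EuclideanSpace ℝ (Fin n) :=
    fun s v => (a' + r₀ • L v) + s • (f (a + r₀ • v) - a' - r₀ • L v)
  have hφ := nullIn_push_gen_homotopy (R := ℤ) e' (x := x) bd_gen_mem φ (by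
      have h1 : ContinuousOn (fun v => f (a + r₀ • v)) (Metric.closedBall 0 1) :=
        f.continuousOn.comp (by fun_prop) fun v hv => (hball v hv).2
      have h2 : ContinuousOn (fun p : ℝ × EuclideanSpace ℝ (Fin n) => f (a + r₀ • p.2))
          (Set.Icc 0 1 ×ˢ Metric.closedBall 0 1) := h1.comp continuousOn_snd fun p hp => hp.2
      exact ((continuous_const.add
        ((L.continuous.comp continuous_snd).const_smul r₀)).continuousOn).add
        (continuous_fst.continuousOn.smul ((h2.sub continuousOn_const).sub
          ((L.continuous.comp continuous_snd).const_smul r₀).continuousOn))) (by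
      intro s hs v hv
      refine h' ?_
      have h1 := (hball v hv).1
      have h2 := hnorm v hv
      have h3 : ‖L v‖ ≤ ‖L‖ := (L.le_opNorm v).trans (mul_le_of_le_one_right (norm_nonneg _) h2)
      have h4 : ‖s • (f (a + r₀ • v) - a' - r₀ • L v)‖ ≤ c / 2 * (r₀ * 1) := by
        rw [norm_smul, Real.norm_of_nonneg hs.1]
        refine (mul_le_of_le_one_left (norm_nonneg _) hs.2).trans (h1.trans ?_)
        gcongr
      rw [Metric.mem_closedBall, dist_eq_norm]
      simp only [φ]
      rw [add_assoc, add_sub_cancel_left]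
      refine (norm_add_le _ _).trans ?_
      rw [norm_smul, Real.norm_of_nonneg hr₀0.le]
      have h5 := mul_le_mul_of_nonneg_left h3 hr₀0.le
      have h6 : r₀ * B = r₀ * ‖L‖ + r₀ * c + r₀ * 2 := by rw [hB]; ring
      nlinarith [mul_pos hr₀0 hc]) (by
      intro s hs v hv hv1 heq
      have h1 := (hball v hv1).1
      simp only [φ, add_assoc] at heq
      have h2 := eq_neg_of_add_eq_zero_left (add_eq_left.1 heq)
      have h3 : ‖r₀ • L v‖ ≤ c / 2 * (r₀ * ‖v‖) := by
        rw [h2, norm_neg, norm_smul, Real.norm_of_nonneg hs.1]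
        exact (mul_le_of_le_one_left (norm_nonneg _) hs.2).trans h1
      rw [norm_smul, Real.norm_of_nonneg hr₀0.le] at h3
      have h4 := mul_le_mul_of_nonneg_left (hcL v) hr₀0.le
      have h5 : 0 < r₀ * (c * ‖v‖) := mul_pos hr₀0 (mul_pos hc (norm_pos_iff.2 hv))
      linarith)
  have hφ1 : push (fun v => e'.symm (φ 1 v)) (gen ℤ n) = locGen e x r₀ := by
    refine push_congr_of_mem (fun v hv => ?_) gen_mem
    have h1 := (hball v hv).2
    have h2 : φ 1 v = f (a + r₀ • v) := by simp only [φ, one_smul]; abel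
    rw [h2, hf, OpenPartialHomeomorph.coe_trans, Function.comp_apply]
    rw [hf, OpenPartialHomeomorph.trans_source] at h1
    exact e'.left_inv h1.2
  -- deform the derivative to the identity
  let ψ : EuclideanSpace ℝ (Fin n) → X := fun w => e'.symm (a' + r₀ • w)
  have hψB : ∀ w ∈ Metric.ball (0 : EuclideanSpace ℝ (Fin n)) B, a' + r₀ • w ∈ e'.target := by
    intro w hw
    refine h' ?_
    rw [mem_ball_zero_iff] at hw
    rw [Metric.mem_closedBall, dist_eq_norm, add_sub_cancel_left, norm_smul,
      Real.norm_of_nonneg hr₀0.le]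
    exact (mul_le_mul_of_nonneg_left hw.le hr₀0.le).trans hr₀B
  have hgen : gen ℤ n ∈ sing ℤ (n + 1) (Metric.ball (0 : EuclideanSpace ℝ (Fin n)) B) :=
    sing_mono (Metric.closedBall_subset_ball (by rw [hB]; linarith [norm_nonneg L])) gen_mem
  have hLgen : push L (gen ℤ n) ∈ sing ℤ (n + 1) (Metric.ball (0 : EuclideanSpace ℝ (Fin n)) B) :=
    push_mem L.continuous.continuousOn (fun v hv => by
      rw [mem_ball_zero_iff]
      have h3 : ‖L v‖ ≤ ‖L‖ :=
        (L.le_opNorm v).trans (mul_le_of_le_one_right (norm_nonneg _) (hnorm v hv))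
      linarith) gen_mem
  have hψ : NullIn Set.univ {x} (push ψ (push L (gen ℤ n) - gen ℤ n)) := by
    refine ((nullIn_push_gen L hdet).excision Metric.isOpen_ball
      (isOpen_univ_sdiff isClosed_singleton) (Set.singleton_subset_iff.2
        (Metric.mem_ball_self hB0)) (sub_mem hLgen hgen)).push
        (e'.continuousOn_symm.comp (by fun_prop) hψB) (Set.mapsTo_univ _ _) ?_
    rintro w ⟨hw, hw0⟩
    refine ⟨trivial, fun h => hw0 ?_⟩
    have h1 := e'.right_inv (hψB w hw)
    rw [Set.mem_singleton_iff] at h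
    simp only [ψ] at h
    rw [h, left_eq_add, smul_eq_zero] at h1
    exact h1.resolve_left hr₀0.ne'
  have hφ0 : push (fun v => e'.symm (φ 0 v)) (gen ℤ n) = push ψ (push L (gen ℤ n)) := by
    rw [push_push]
    have : (fun v => e'.symm (φ 0 v)) = ψ ∘ L := by
      funext v
      simp [φ, ψ]
    rw [this]
  rw [hφ1, hφ0] at hφ
  rw [map_sub] at hψ
  have h1 := nullIn_locGen_sub (R := ℤ) e hr hr₀0 h hr₀e
  have h2 := nullIn_locGen_sub (R := ℤ) e' hr₀0 hr' hr₀e' h'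
  have hψ' : push ψ (gen ℤ n) = locGen e' x r₀ := rfl
  rw [hψ'] at hψ
  simpa using ((h1.add hφ).add hψ).add h2

/-- The chain `z` represents the local orientation at `x` given by the chart `e`. -/
def OrientedAt (e : OpenPartialHomeomorph X (EuclideanSpace ℝ (Fin n))) (x : X)
    (z : Chain ℤ (n + 1) X) : Prop :=
  ∃ r > 0, Metric.closedBall (e x) r ⊆ e.target ∧ NullIn Set.univ {x} (z - locGen e x r)

lemma OrientedAt.congr {e : OpenPartialHomeomorph X (EuclideanSpace ℝ (Fin n))} {x : X}
    {z z' : Chain ℤ (n + 1) X} (h : OrientedAt e x z) (hz : NullIn Set.univ {x} (z' - z)) :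
    OrientedAt e x z' := by
  obtain ⟨r, hr, hre, hn⟩ := h
  exact ⟨r, hr, hre, by simpa using hz.add hn⟩

/-- A single chain represents the local orientations at all points near a given one: in a chart, the
generators at nearby points are translates of each other. -/
lemma exists_orientedAt_nhds [T2Space X]
    (e : OpenPartialHomeomorph X (EuclideanSpace ℝ (Fin n))) {x : X} (hx : x ∈ e.source) :
    ∃ N ∈ nhds x, IsCompact N ∧ N ⊆ e.source ∧ ∃ z ∈ sing ℤ (n + 1) Set.univ,
      bd z ∈ sing ℤ n (Set.univ \ N) ∧ ∀ y ∈ N, OrientedAt e y z := by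
  obtain ⟨R₀, hR₀, hRe⟩ := Metric.nhds_basis_closedBall.mem_iff.1
    (e.open_target.mem_nhds (e.map_source hx))
  obtain ⟨C, hCc, hC0, hC⟩ := exists_isCompact_mem_sing (bd_gen_mem (R := ℤ) (n := n))
  obtain ⟨c, hc, hcC⟩ : ∃ c > 0, Metric.ball (0 : EuclideanSpace ℝ (Fin n)) c ⊆ Cᶜ :=
    Metric.isOpen_iff.1 hCc.isClosed.isOpen_compl 0 fun h => hC0 h rfl
  have hcC' : ∀ v ∈ C, c ≤ ‖v‖ := fun v hv => by
    by_contra! hlt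
    exact hcC (by simpa using hlt) hv
  set r := R₀ / 2 with hr
  have hr0 : 0 < r := half_pos hR₀
  set δ := min r (r * c / 2) with hδ
  have hδ0 : 0 < δ := lt_min hr0 (by positivity)
  have hδr : δ ≤ r := min_le_left _ _
  have hδc : δ < r * c := (min_le_right _ _).trans_lt (half_lt_self (by positivity))
  have hBt : Metric.closedBall (e x) δ ⊆ e.target :=
    (Metric.closedBall_subset_closedBall (by linarith)).trans hRe
  have hrt : Metric.closedBall (e x) r ⊆ e.target :=
    (Metric.closedBall_subset_closedBall (by linarith)).trans hRe
  have hcomp : IsCompact (e.symm '' Metric.closedBall (e x) δ) :=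
    (isCompact_closedBall _ _).image_of_continuousOn (e.continuousOn_symm.mono hBt)
  have hcontl : ContinuousOn (fun v => e.symm (e x + r • v)) (Metric.closedBall 0 1) :=
    e.continuousOn_symm.comp (by fun_prop) fun v hv => hrt (smul_mem_closedBall hr0.le hv)
  refine ⟨e.symm '' Metric.closedBall (e x) δ, ?_, hcomp, ?_, locGen e x r, ?_, ?_, ?_⟩
  · rw [e.symm.image_eq_target_inter_inv_preimage hBt]
    exact Filter.inter_mem (e.open_source.mem_nhds hx)
      ((e.continuousAt hx).preimage_mem_nhds (Metric.closedBall_mem_nhds _ hδ0))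
  · rintro _ ⟨y, hy, rfl⟩
    exact e.map_target (hBt hy)
  · exact push_mem hcontl (Set.mapsTo_univ _ _) gen_mem
  · rw [locGen, bd_push]
    refine push_mem (V := Set.univ \ _) (U := Metric.closedBall 0 1 ∩ C)
      (hcontl.mono Set.inter_subset_left) ?_ (mem_sing_inter (bd_mem gen_mem) hC)
    rintro v ⟨hv, hvC⟩
    refine ⟨trivial, ?_⟩
    rintro ⟨y, hy, hyv⟩
    have := e.symm.injOn (hBt hy) (hrt (smul_mem_closedBall hr0.le hv)) hyv
    rw [this, Metric.mem_closedBall, dist_eq_norm, add_sub_cancel_left, norm_smul,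
      Real.norm_of_nonneg hr0.le] at hy
    have := mul_le_mul_of_nonneg_left (hcC' v hvC) hr0.le
    linarith
  · rintro _ ⟨y, hy, rfl⟩
    have hyt := hBt hy
    have hball : ∀ s ∈ Set.Icc (0 : ℝ) 1, ∀ v ∈ Metric.closedBall (0 : EuclideanSpace ℝ (Fin n)) 1,
        (y + s • (e x - y)) + r • v ∈ e.target := by
      intro s hs v hv
      refine hRe ?_
      have h1 := smul_mem_closedBall (a := y + s • (e x - y)) hr0.le hv
      have h2 : y + s • (e x - y) ∈ Metric.closedBall (e x) δ :=
        (convex_closedBall _ _).add_smul_sub_mem hy (Metric.mem_closedBall_self hδ0.le) hs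
      rw [Metric.mem_closedBall] at h1 h2 ⊢
      linarith [dist_triangle (y + s • (e x - y) + r • v) (y + s • (e x - y)) (e x)]
    refine ⟨r, hr0, ?_, ?_⟩
    · rw [e.right_inv hyt]
      refine (Metric.closedBall_subset_closedBall' ?_).trans hRe
      rw [Metric.mem_closedBall] at hy
      linarith
    · have := nullIn_push_gen_homotopy e (x := e.symm y) hC
        (fun s v => (y + s • (e x - y)) + r • v) (by
          refine Continuous.continuousOn ?_
          unfold Function.uncurry
          fun_prop) hball (by
          intro s hs v hv _ heq
          rw [e.right_inv hyt, add_assoc, add_eq_left] at heq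
          have h1 : ‖r • v‖ = ‖s • (e x - y)‖ := by
            rw [eq_neg_of_add_eq_zero_right heq, norm_neg]
          rw [norm_smul, norm_smul, Real.norm_of_nonneg hr0.le, Real.norm_of_nonneg hs.1] at h1
          have h2 := mul_le_mul_of_nonneg_left (hcC' v hv) hr0.le
          rw [Metric.mem_closedBall, dist_comm, dist_eq_norm] at hy
          have h3 := mul_le_mul hs.2 hy (norm_nonneg _) zero_le_one
          linarith)
      rw [locGen, locGen, e.right_inv hyt]
      simpa using this

end Chain

/-! ### Reduction modulo two -/

/-- Reduction of integral chains modulo two. -/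
noncomputable def red {A : Type*} : (A →₀ ℤ) →+ (A →₀ ZMod 2) :=
  Finsupp.mapRange.addMonoidHom (Int.castAddHom (ZMod 2))

lemma red_single {A : Type*} (a : A) (r : ℤ) : red (Finsupp.single a r) = Finsupp.single a (r : ZMod 2) := by
  simp [red]

lemma red_mapDomain {A B : Type*} (f : A → B) (x : A →₀ ℤ) :
    red (Finsupp.mapDomain f x) = Finsupp.mapDomain f (red x) := by
  induction x using Finsupp.induction_linear with
  | zero => simp
  | add x y hx hy => simp [Finsupp.mapDomain_add, hx, hy]
  | single a r => simp [red_single]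

namespace Chain

variable {R : Type*} [CommRing R] {m n k : ℕ} {X Y : Type*}
  [TopologicalSpace X] [TopologicalSpace Y]

lemma red_bd {X : Type*} (x : Chain ℤ (m + 1) X) : red (bd x) = bd (red x) := by
  induction x using Finsupp.induction_linear with
  | zero => simp
  | add x y hx hy => simp [hx, hy]
  | single a r => simp [red_single, bd_single, -Finsupp.single_mul, map_sum]

lemma red_push {X Y : Type*} (f : X → Y) (x : Chain ℤ m X) : red (push f x) = push f (red x) :=
  red_mapDomain _ _

lemma red_mem {U : Set X} {x : Chain ℤ m X} (hx : x ∈ sing ℤ m U) :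
    red x ∈ sing (ZMod 2) m U :=
  (Finset.coe_subset.2 (Finsupp.support_mapRange (hf := Int.cast_zero))).trans hx

lemma NullIn.red {U K : Set X} {z : Chain ℤ m X} (h : NullIn U K z) : NullIn U K (red z) := by
  obtain ⟨w, hw, hz⟩ := h
  refine ⟨_root_.red w, red_mem hw, ?_⟩
  rw [← red_bd, ← map_sub]
  exact red_mem hz

lemma red_crossPoly : ∀ n, red (crossPoly ℤ n) = crossPoly (ZMod 2) n
  | 0 => by simp [crossPoly, red_single]
  | n + 1 => by
    rw [crossPoly, crossPoly, map_sub, ← red_crossPoly n]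
    congr 1 <;>
    · simp only [LinChain.cone, LinChain.map, Finsupp.lmapDomain_apply, red_mapDomain]

lemma red_gen : red (gen ℤ n) = gen (ZMod 2) n := by
  rw [gen, gen, ← red_crossPoly]
  simp only [real, LinChain.cone, LinChain.map, Finsupp.lmapDomain_apply, red_mapDomain]

/-- The local orientations are nonzero modulo two. -/
lemma OrientedAt.not_nullIn_red [T1Space X]
    {e : OpenPartialHomeomorph X (EuclideanSpace ℝ (Fin n))} {x : X} (hx : x ∈ e.source)
    {z : Chain ℤ (n + 1) X} (h : OrientedAt e x z) : ¬ NullIn Set.univ {x} (red z) := by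
  obtain ⟨r, hr, hre, hn⟩ := h
  intro h0
  have h1 := hn.red
  rw [map_sub, locGen, red_push, red_gen] at h1
  replace h1 := h1.congr.1 h0
  have hcont : ContinuousOn (fun v => e.symm (e x + r • v)) (Metric.closedBall 0 1) :=
    e.continuousOn_symm.comp (by fun_prop) fun v hv => hre (smul_mem_closedBall hr.le hv)
  have hmem : push (fun v => e.symm (e x + r • v)) (gen (ZMod 2) n) ∈
      sing (ZMod 2) (n + 1) e.source :=
    push_mem hcont (fun v hv => e.map_target (hre (smul_mem_closedBall hr.le hv))) gen_mem
  rw [← nullIn_push_iff e (Set.singleton_subset_iff.2 hx) isClosed_singleton (by simp) hmem,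
    Set.image_singleton, nullIn_singleton_iff (push_mem e.continuousOn (Set.mapsTo_univ _ _) hmem),
    push_push, push_congr_of_mem (f := e ∘ fun v => e.symm (e x + r • v))
      (g := fun v => e x + r • v)
      (fun v hv => e.right_inv (hre (smul_mem_closedBall hr.le hv))) gen_mem,
    isBdry_compl_singleton_iff, bd_push, bd_gen, push_push, push_push] at h1
  let L : (Fin n → ℝ) ≃L[ℝ] EuclideanSpace ℝ (Fin n) :=
    (toE n).trans (ContinuousLinearEquiv.smulLeft (Units.mk0 r hr.ne'))
  refine not_isBdry_octa (R := ZMod 2) n ((isBdry_push_equiv L).1 ?_)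
  convert h1 using 3
  funext v
  simp [L, Units.smul_def]

/-! ### The fundamental class -/

variable {A : Set (OpenPartialHomeomorph X (EuclideanSpace ℝ (Fin n)))}

/-- The chain `z` represents the local orientation at `x` given by the atlas `A`. -/
def Oriented (A : Set (OpenPartialHomeomorph X (EuclideanSpace ℝ (Fin n)))) (x : X)
    (z : Chain ℤ (n + 1) X) : Prop :=
  ∃ e ∈ A, x ∈ e.source ∧ OrientedAt e x z

lemma Oriented.congr {x : X} {z z' : Chain ℤ (n + 1) X} (h : Oriented A x z)
    (hz : NullIn Set.univ {x} (z' - z)) : Oriented A x z' := by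
  obtain ⟨e, he, hx, h⟩ := h
  exact ⟨e, he, hx, h.congr hz⟩

lemma Oriented.nullIn_sub (hA : ∀ e ∈ A, ∀ e' ∈ A, ∀ y ∈ (e.symm.trans e').source,
    0 < (fderiv ℝ (e.symm.trans e') y).det) {x : X} {z z' : Chain ℤ (n + 1) X}
    (h : Oriented A x z) (h' : Oriented A x z') : NullIn Set.univ {x} (z - z') := by
  obtain ⟨e, he, hx, r, hr, hre, hz⟩ := h
  obtain ⟨e', he', hx', r', hr', hre', hz'⟩ := h'
  have hdet := hA e he e' he' (e x) (by simp [hx, hx'])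
  have hd : DifferentiableAt ℝ (e.symm.trans e') (e x) := by
    -- otherwise `fderiv` takes the junk value `0`, whose determinant is not positive
    by_contra hd
    rw [fderiv_zero_of_not_differentiableAt hd] at hdet
    rcases Nat.eq_zero_or_pos n with rfl | hn
    · exact hd (hasFDerivAt_of_subsingleton _ _).differentiableAt
    · have : Nonempty (Fin n) := ⟨⟨0, hn⟩⟩
      rw [ContinuousLinearMap.det, ContinuousLinearMap.toLinearMap_zero,
        LinearMap.det_zero''] at hdet
      exact lt_irrefl _ hdet
  have := nullIn_locGen_sub_locGen e e' hx hx' hd.hasFDerivAt hdet hr hr' hre hre'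
  simpa using (hz.add this).sub hz'

/-- A compact oriented manifold has a fundamental class: local orientations are glued by
Mayer–Vietoris over a finite cover by compact sets, on whose intersections they agree because they
agree at all points. -/
theorem exists_fundamental [T2Space X] [CompactSpace X] (hcov : ∀ x : X, ∃ e ∈ A, x ∈ e.source)
    (hA : ∀ e ∈ A, ∀ e' ∈ A, ∀ y ∈ (e.symm.trans e').source,
      0 < (fderiv ℝ (e.symm.trans e') y).det) :
    ∃ z ∈ sing ℤ (n + 1) (Set.univ : Set X), bd z ∈ sing ℤ n (∅ : Set X) ∧
      ∀ x, Oriented A x z := by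
  classical
  choose e heA hxe using hcov
  choose N hN hNc hNe z hz hbd hor using fun x => exists_orientedAt_nhds (e x) (hxe x)
  obtain ⟨t, -, ht⟩ := isCompact_univ.elim_nhds_subcover N fun x _ => hN x
  suffices H : ∃ z ∈ sing ℤ (n + 1) (Set.univ : Set X), bd z ∈ sing ℤ n (Set.univ \ ⋃ x ∈ t, N x) ∧
      ∀ y ∈ ⋃ x ∈ t, N x, Oriented A y z by
    obtain ⟨z, hz, hbd, h⟩ := H
    rw [Set.sdiff_eq_empty.2 ht] at hbd
    exact ⟨z, hz, hbd, fun x => h x (ht trivial)⟩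
  clear ht
  induction t using Finset.induction_on with
  | empty => exact ⟨0, zero_mem _, by simp, by simp⟩
  | insert a t ha ih =>
    obtain ⟨z', hz', hbd', hor'⟩ := ih
    have htc : IsCompact (⋃ x ∈ t, N x) := t.isCompact_biUnion fun x _ => hNc x
    obtain ⟨v, hv, hbv, h1, h2⟩ := exists_glue (isOpen_univ_sdiff (hNc a).isClosed)
      (isOpen_univ_sdiff htc.isClosed) (hz a) (hbd a) hbd'
      (nullIn_of_forall_singleton_chart (e a) ((hNc a).inter htc)
        (Set.inter_subset_left.trans (hNe a)) (by simp) (sub_mem (hz a) hz') (by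
          rw [map_sub]
          exact sub_mem (sing_mono (Set.sdiff_subset_sdiff_right Set.inter_subset_left) (hbd a))
            (sing_mono (Set.sdiff_subset_sdiff_right Set.inter_subset_right) hbd'))
        fun y hy => Oriented.nullIn_sub hA ⟨e a, heA a, hNe a hy.1, hor a y hy.1⟩ (hor' y hy.2))
    refine ⟨v, hv, by rwa [Finset.set_biUnion_insert], fun y hy => ?_⟩
    rw [Finset.set_biUnion_insert] at hy
    rcases hy with hy | hy
    · exact Oriented.congr ⟨e a, heA a, hNe a hy, hor a y hy⟩
        (h1.mono (Set.singleton_subset_iff.2 hy))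
    · exact (hor' y hy).congr (h2.mono (Set.singleton_subset_iff.2 hy))

end Chain

/-! ### The jump across a hyperplane -/

namespace Chain

variable {n : ℕ}

/-- Local homology in the top degree with coefficients in `ℤ/2` has at most two elements. -/
lemma nullIn_or_nullIn_or_nullIn_add {W : Type} [NormedAddCommGroup W] [NormedSpace ℝ W]
    [FiniteDimensional ℝ W] (hW : Module.finrank ℝ W = n) {x : W}
    {z z' : Chain (ZMod 2) (n + 1) W} (hz : z ∈ sing _ (n + 1) Set.univ)
    (hbd : bd z ∈ sing _ n (Set.univ \ {x})) (hz' : z' ∈ sing _ (n + 1) Set.univ)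
    (hbd' : bd z' ∈ sing _ n (Set.univ \ {x})) :
    NullIn Set.univ {x} z ∨ NullIn Set.univ {x} z' ∨ NullIn Set.univ {x} (z + z') := by
  have hmem : ∀ {y : Chain (ZMod 2) n W}, y ∈ sing _ n (Set.univ \ {x}) →
      push (fun v => v - x) y ∈ sing _ n {(0 : W)}ᶜ := fun h =>
    push_mem (by fun_prop) (fun v hv => by simpa [sub_eq_zero] using hv) h
  rw [nullIn_singleton_iff hz, nullIn_singleton_iff hz', nullIn_singleton_iff (add_mem hz hz'),
    isBdry_compl_singleton_iff x (z := bd z), isBdry_compl_singleton_iff x (z := bd z'),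
    isBdry_compl_singleton_iff x (z := bd (z + z')), map_add, map_add]
  exact isBdry_or_isBdry_or_isBdry_add n W hW (hmem hbd) ((isCycle_bd z).push _) (hmem hbd')
    ((isCycle_bd z').push _)

/-- Suppose that near a vertical segment the boundary of `D` is the chain `C` of the horizontal
hyperplane. If `D` is null at both ends of the segment or at none, then `C` is null at the point of
intersection. -/
theorem nullIn_of_nullIn_iff {V : Type} [NormedAddCommGroup V] [NormedSpace ℝ V]
    [FiniteDimensional ℝ V] (hV : Module.finrank ℝ V = n) {r : ℝ} (hr : 0 < r)
    {D : Chain (ZMod 2) (n + 2) (V × ℝ)} {C : Chain (ZMod 2) (n + 1) V}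
    (hD : D ∈ sing _ (n + 2) Set.univ) (hC : C ∈ sing _ (n + 1) Set.univ)
    (hbC : bd C ∈ sing _ n (Set.univ \ {0}))
    (hbD : bd D - push (fun v => (v, (0 : ℝ))) C ∈
      sing _ (n + 1) (Set.univ \ ({0} ×ˢ Set.Icc (-r) r)))
    (h : NullIn Set.univ {((0 : V), r)} D ↔ NullIn Set.univ {((0 : V), -r)} D) :
    NullIn Set.univ {0} C := by
  set L : Set (V × ℝ) := {0} ×ˢ Set.Icc (-r) r with hL
  have hLc : Convex ℝ L := (convex_singleton 0).prod (convex_Icc _ _)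
  have hLb : Bornology.IsBounded L := (isCompact_singleton.prod isCompact_Icc).isBounded
  have hqp : ((0 : V), r) ∈ L := ⟨rfl, by simp [hr.le]⟩
  have hqm : ((0 : V), -r) ∈ L := ⟨rfl, by simp [hr.le]⟩
  let f : ℝ → V → V × ℝ := fun s v => (v, 2 * r * s)
  have hf : ∀ U, ContinuousOn (Function.uncurry f) U := fun U => by
    refine Continuous.continuousOn ?_
    unfold Function.uncurry
    fun_prop
  -- The prism `P` over `C` moves the boundary of `D` to height `2 * r`, off the segment, so that
  -- `D + P` has the same class at both ends; `P` itself does not meet the lower end.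
  set P := prism f 0 C with hP
  have hP0 : P ∈ sing _ (n + 2) {p : V × ℝ | 0 ≤ p.2} :=
    prism_mem (hf _) (fun s hs v _ => by have := hs.1; simp only [f, Set.mem_ofPred_eq]; positivity)
      0 hC
  have hPu : P ∈ sing _ (n + 2) Set.univ := sing_mono (Set.subset_univ _) hP0
  have hside : prism f 0 (bd C) ∈ sing _ (n + 1) {p : V × ℝ | p.1 ≠ 0} :=
    prism_mem (hf _) (fun s _ v hv => hv.2) 0 hbC
  have hbP : bd P = push (fun v => (v, 2 * r)) C - push (fun v => (v, (0 : ℝ))) C -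
      prism f 0 (bd C) := by
    have := bd_prism f 0 C
    rw [subdiv_zero] at this
    rw [eq_sub_iff_add_eq, this]
    simp [f]
  have htop : ∀ t : ℝ, push (fun v : V => (v, t)) C ∈ sing _ (n + 1) {p : V × ℝ | p.2 = t} :=
    fun t => push_mem (f := fun v => (v, t)) (V := {p : V × ℝ | p.2 = t}) (by fun_prop)
      (fun v _ => rfl) hC
  have hbe : bd (D + P) ∈ sing _ (n + 1) (Set.univ \ L) := by
    have : bd (D + P) = (bd D - push (fun v => (v, (0 : ℝ))) C) + push (fun v => (v, 2 * r)) C -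
        prism f 0 (bd C) := by
      rw [map_add, hbP]; abel
    rw [this]
    have h1 : {p : V × ℝ | p.2 = 2 * r} ⊆ Set.univ \ L := by
      intro p hp
      refine ⟨trivial, fun h => ?_⟩
      have h1 := h.2.2
      rw [Set.mem_ofPred_eq] at hp
      linarith
    have h2 : {p : V × ℝ | p.1 ≠ 0} ⊆ Set.univ \ L := fun p hp => ⟨trivial, fun h => hp h.1⟩
    exact sub_mem (add_mem hbD (sing_mono h1 (htop _))) (sing_mono h2 hside)
  have hDP : D + P ∈ sing _ (n + 2) Set.univ := add_mem hD hPu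
  have hends : NullIn Set.univ {((0 : V), r)} (D + P) ↔ NullIn Set.univ {((0 : V), -r)} (D + P) :=
    ⟨fun h => (NullIn.of_convex hLc hLb hqp hDP hbe h).mono (Set.singleton_subset_iff.2 hqm),
      fun h => (NullIn.of_convex hLc hLb hqm hDP hbe h).mono (Set.singleton_subset_iff.2 hqp)⟩
  have hsm : {p : V × ℝ | 0 ≤ p.2} ⊆ Set.univ \ {((0 : V), -r)} := by
    intro p hp
    refine ⟨trivial, fun h => ?_⟩
    rw [Set.mem_singleton_iff] at h
    rw [h, Set.mem_ofPred_eq] at hp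
    linarith
  have hPm : NullIn Set.univ {((0 : V), -r)} P := nullIn_of_mem (sing_mono hsm hP0)
  -- modulo two, `P` is the difference of two classes that are both zero or both the nonzero one
  have hPp : NullIn Set.univ {((0 : V), r)} P := by
    have hiff : NullIn Set.univ {((0 : V), r)} (D + P) ↔ NullIn Set.univ {((0 : V), r)} D := by
      rw [hends, h]
      exact NullIn.congr (by simpa using hPm)
    have hne : ∀ p : V × ℝ, p ∈ L → p.2 ≠ 0 →
        bd D ∈ sing _ (n + 1) (Set.univ \ {p}) := by
      intro p hp hp0
      have h1 : {q : V × ℝ | q.2 = 0} ⊆ Set.univ \ {p} := by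
        intro q hq
        refine ⟨trivial, fun h => hp0 ?_⟩
        rw [Set.mem_singleton_iff] at h
        rwa [← h]
      rw [← sub_add_cancel (bd D) (push (fun v => (v, (0 : ℝ))) C)]
      exact add_mem (sing_mono (Set.sdiff_subset_sdiff_right (Set.singleton_subset_iff.2 hp)) hbD)
        (sing_mono h1 (htop 0))
    rcases nullIn_or_nullIn_or_nullIn_add (by simp [hV]) hD (hne _ hqp hr.ne') hDP
      (sing_mono (Set.sdiff_subset_sdiff_right (Set.singleton_subset_iff.2 hqp)) hbe)
      with h | h | h
    · simpa using (hiff.2 h).sub h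
    · simpa using h.sub (hiff.1 h)
    · have h2 : D + (D + P) = P := by
        rw [← add_assoc, ← two_smul (ZMod 2) D, show (2 : ZMod 2) = 0 from rfl, zero_smul, zero_add]
      rwa [h2] at h
  -- seen from the upper end, the boundary of the prism consists of its bottom and a part in `upper`,
  -- and the equator is the boundary of `C`
  rw [nullIn_singleton_iff hPu, isBdry_compl_singleton_iff] at hPp
  rw [nullIn_singleton_iff hC]
  let y₂ : Chain (ZMod 2) (n + 1) (V × ℝ) := -push (fun v => (v, -r)) C
  let y₁ : Chain (ZMod 2) (n + 1) (V × ℝ) :=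
    push (fun v => (v, r)) C - push (fun p => p - ((0 : V), r)) (prism f 0 (bd C))
  have hsum : push (fun p => p - ((0 : V), r)) (bd P) = y₁ + y₂ := by
    have h1 : ∀ t t' : ℝ, t - r = t' → push (fun p => p - ((0 : V), r)) (push (fun v => (v, t)) C) =
        push (fun v => (v, t')) C := by
      rintro t t' rfl
      rw [push_push]
      congr 2
      funext v
      simp
    rw [hbP, map_sub, map_sub, h1 (2 * r) r (by ring), h1 0 (-r) (by ring)]
    simp only [y₁, y₂]
    abel
  have hb : bd y₁ = push (fun v => (v, -r)) (bd C) := by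
    have h1 : bd (y₁ + y₂) = 0 := by rw [← hsum, bd_push, bd_bd, map_zero]
    rw [map_add] at h1
    rw [eq_neg_of_add_eq_zero_left h1]
    simp only [y₂]
    rw [map_neg, neg_neg, bd_push]
  rw [hsum] at hPp
  have hy₁ : y₁ ∈ sing _ (n + 1) (upper V) := by
    simp only [y₁]
    have h1 : {p : V × ℝ | p.2 = r} ⊆ upper V := by
      intro p hp
      rw [Set.mem_ofPred_eq] at hp
      exact Or.inr (by rwa [hp])
    have h2 : Set.MapsTo (fun p => p - ((0 : V), r)) {p : V × ℝ | p.1 ≠ 0} (upper V) :=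
      fun p hp => Or.inl (by simpa using hp)
    exact sub_mem (sing_mono h1 (htop r)) (push_mem (by fun_prop) h2 hside)
  have hy₂ : y₂ ∈ sing _ (n + 1) (lower V) := by
    simp only [y₂]
    have h1 : {p : V × ℝ | p.2 = -r} ⊆ lower V := by
      intro p hp
      rw [Set.mem_ofPred_eq] at hp
      exact Or.inr (by rw [hp]; linarith)
    exact neg_mem (sing_mono h1 (htop (-r)))
  have := isBdry_equator hy₁ hy₂ hPp
  rw [hb, push_push] at this
  exact (push_id (bd C)) ▸ this

end Chain

/-! ### Comparison with singular homology -/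

namespace Chain

open CategoryTheory Simplicial

variable (X : TopCat.{u})

/-- The coefficient module of integral homology. -/
noncomputable abbrev coeff : ModuleCat.{u} ℤ := ModuleCat.of ℤ (ULift.{u} ℤ)

/-- The complex by which Mathlib defines the integral homology of `X`. Its degree `k` corresponds to
`Chain ℤ (k + 1) X`. -/
noncomputable abbrev cplx : ChainComplex (ModuleCat.{u} ℤ) ℕ :=
  (TopCat.toSSet.obj X).chainComplex coeff

variable {X}

/-- The continuous map on the standard simplex underlying a singular simplex. -/
noncomputable def toMap {k : ℕ} (x : (TopCat.toSSet.obj X) _⦋k⦌) : C(Simp (k + 1), X) :=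
  X.toSSetObjEquiv (Opposite.op ⦋k⦌) x

/-- The singular simplex given by a continuous map on the standard simplex. -/
noncomputable def ofMap {k : ℕ} (f : C(Simp (k + 1), X)) : (TopCat.toSSet.obj X) _⦋k⦌ :=
  (X.toSSetObjEquiv (Opposite.op ⦋k⦌)).symm f

lemma toMap_ofMap {k : ℕ} (f : C(Simp (k + 1), X)) : toMap (ofMap f) = f :=
  (X.toSSetObjEquiv (Opposite.op ⦋k⦌)).apply_symm_apply f

lemma toMap_δ {k : ℕ} (x : (TopCat.toSSet.obj X) _⦋k + 1⦌) (i : Fin (k + 2)) :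
    ⇑(toMap ((TopCat.toSSet.obj X).δ i x)) = toMap x ∘ stdSimplex.map i.succAbove := by
  funext z
  exact TopCat.toSSetObjEquiv_δ_apply x i z


/-- The comparison map from `cplx X` to chains. -/
noncomputable def toChain (k : ℕ) :
    (cplx X).X k ⟶ ModuleCat.of ℤ (Chain ℤ (k + 1) X) :=
  Limits.Cofan.IsColimit.desc ((TopCat.toSSet.obj X).isColimitChainComplexXCofan coeff k) fun x =>
    ModuleCat.ofHom ((Finsupp.lsingle (⇑(toMap x))).comp (ULift.moduleEquiv (R := ℤ)).toLinearMap)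

lemma ι_toChain {k : ℕ} (x : (TopCat.toSSet.obj X) _⦋k⦌) :
    (TopCat.toSSet.obj X).ιChainComplex x ≫ toChain k =
      ModuleCat.ofHom ((Finsupp.lsingle (⇑(toMap x))).comp
        (ULift.moduleEquiv (R := ℤ)).toLinearMap) :=
  Limits.Cofan.IsColimit.fac ((TopCat.toSSet.obj X).isColimitChainComplexXCofan coeff k) _ x

lemma d_toChain (k : ℕ) :
    (cplx X).d (k + 1) k ≫ toChain k = toChain (k + 1) ≫ ModuleCat.ofHom bd := by
  refine SSet.chainComplex_hom_ext fun x => ?_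
  rw [SSet.ιChainComplex_d_assoc, ← Category.assoc, ι_toChain, Preadditive.sum_comp]
  ext
  simp [ι_toChain, bd_single, toMap_δ]

/-- The comparison map from chains to `cplx X`, meant for combinations of continuous simplices; all
other simplices are sent to zero. -/
noncomputable def ofChain (k : ℕ) : Chain ℤ (k + 1) X →ₗ[ℤ] (cplx X).X k :=
  open Classical in
  Finsupp.linearCombination ℤ fun σ => if h : Continuous σ then
    ((TopCat.toSSet.obj X).ιChainComplex (R := coeff) (ofMap ⟨σ, h⟩)).hom ⟨1⟩ else 0

lemma ofChain_single {k : ℕ} {σ : Simp (k + 1) → X} (h : Continuous σ) (r : ℤ) :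
    ofChain k (Finsupp.single σ r) =
      r • ((TopCat.toSSet.obj X).ιChainComplex (R := coeff) (ofMap ⟨σ, h⟩)).hom ⟨1⟩ := by
  rw [ofChain, Finsupp.linearCombination_single, dif_pos h]
  exact int_smul_eq_zsmul _ _ _


lemma toChain_mem {k : ℕ} (y : (cplx X).X k) :
    (toChain k).hom y ∈ sing ℤ (k + 1) (Set.univ : Set X) := by
  have h : toChain k ≫ ModuleCat.ofHom (sing ℤ (k + 1) (Set.univ : Set X)).mkQ = 0 := by
    refine SSet.chainComplex_hom_ext fun x => ?_
    rw [← Category.assoc, ι_toChain, Limits.comp_zero]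
    ext r
    refine (Submodule.Quotient.mk_eq_zero _).2 ?_
    exact Finsupp.single_mem_supported _ _ ⟨(toMap x).continuous, fun _ => trivial⟩
  rw [← Submodule.Quotient.mk_eq_zero]
  exact congrArg (fun f => f.hom y) h

lemma eq_of_eqOn_sing {N : Type*} [AddCommGroup N] [Module ℤ N] {k : ℕ} {f g : Chain ℤ k X →ₗ[ℤ] N}
    (h : ∀ σ : Simp k → X, Continuous σ → f (Finsupp.single σ 1) = g (Finsupp.single σ 1))
    {c : Chain ℤ k X} (hc : c ∈ sing ℤ k (Set.univ : Set X)) : f c = g c := by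
  rw [← sub_eq_zero]
  refine Finsupp.map_mem_of_mem_supported (P := (⊥ : Submodule ℤ N)) (f - g) (fun σ hσ => ?_) hc
  simp [h σ hσ.1]

lemma toChain_ofChain {k : ℕ} {c : Chain ℤ (k + 1) X} (hc : c ∈ sing ℤ (k + 1) (Set.univ : Set X)) :
    (toChain k).hom (ofChain k c) = c := by
  refine eq_of_eqOn_sing (f := (toChain k).hom.comp (ofChain k)) (g := LinearMap.id)
    (fun σ hσ => ?_) hc
  rw [LinearMap.comp_apply, ofChain_single hσ, one_smul]
  have := congrArg (fun f => f.hom ⟨1⟩) (ι_toChain (ofMap ⟨σ, hσ⟩))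
  refine this.trans ?_
  rw [toMap_ofMap]
  rfl

lemma d_ofChain {k : ℕ} {c : Chain ℤ (k + 2) X} (hc : c ∈ sing ℤ (k + 2) (Set.univ : Set X)) :
    ((cplx X).d (k + 1) k).hom (ofChain (k + 1) c) = ofChain k (bd c) := by
  refine eq_of_eqOn_sing (f := ((cplx X).d (k + 1) k).hom.comp (ofChain (k + 1)))
    (g := (ofChain k).comp bd) (fun σ hσ => ?_) hc
  rw [LinearMap.comp_apply, ofChain_single hσ, one_smul, LinearMap.comp_apply, bd_single, map_sum]
  have := congrArg (fun f => f.hom ⟨1⟩)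
    ((TopCat.toSSet.obj X).ιChainComplex_d (R := coeff) (ofMap ⟨σ, hσ⟩))
  refine this.trans ?_
  simp only [ModuleCat.hom_sum, LinearMap.sum_apply, mul_one]
  refine Finset.sum_congr rfl fun i _ => ?_
  rw [ofChain_single (hσ.comp (stdSimplex.continuous_map _))]
  rfl

/-- If the integral singular homology of a space vanishes in dimension `n`, then the `n`-dimensional
cycles are boundaries. In dimension zero every chain counts as a cycle; since boundaries are
cycles of the augmented complex, the space is then empty. -/
theorem exists_bd_eq_of_isZero {M : Type u} [TopologicalSpace M] {n : ℕ}
    (hH : Limits.IsZero (integralHomology n M)) {z : Chain ℤ (n + 1) M}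
    (hz : z ∈ sing ℤ (n + 1) Set.univ) (hbd : n ≠ 0 → bd z = 0) :
    ∃ w ∈ sing ℤ (n + 2) (Set.univ : Set M), bd w = z := by
  have hex : (cplx (TopCat.of M)).ExactAt n := (HomologicalComplex.exactAt_iff_isZero_homology _ _).2 hH
  have key : ∀ j, (ComplexShape.down ℕ).next n = j →
      ((cplx (TopCat.of M)).d n j).hom (ofChain (X := TopCat.of M) n z) = 0 := by
    rintro j hj
    obtain _ | n := n
    · rw [(cplx (TopCat.of M)).shape 0 j (by simp)]
      rfl
    · obtain rfl : n = j := by rw [← hj, ChainComplex.next_nat_succ]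
      rw [d_ofChain (X := TopCat.of M) hz, hbd (by simp), map_zero]
  rw [HomologicalComplex.exactAt_iff' _ (n + 1) n _ (ChainComplex.prev _ _) rfl,
    ShortComplex.moduleCat_exact_iff] at hex
  obtain ⟨y, hy⟩ := hex (ofChain (X := TopCat.of M) n z) (key _ rfl)
  refine ⟨(toChain (X := TopCat.of M) (n + 1)).hom y, toChain_mem y, ?_⟩
  have h1 := congrArg (fun f => f.hom y) (d_toChain (X := TopCat.of M) n)
  refine (Eq.symm h1).trans ?_
  refine Eq.trans ?_ (toChain_ofChain (X := TopCat.of M) hz)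
  exact congrArg (toChain (X := TopCat.of M) n).hom hy

end Chain

/-! ### The jump across a hypersurface -/

/-- The chart of `S` obtained from a chart of the ambient space that flattens `S`. The point `p` only
serves as a value of the inverse outside of its domain. -/
noncomputable def sliceChart {M V : Type*} [TopologicalSpace M] [TopologicalSpace V] {S : Set M}
    (Θ : OpenPartialHomeomorph M (V × ℝ)) (p : S)
    (hΘ : ∀ x ∈ Θ.source, x ∈ S ↔ (Θ x).2 = 0) : OpenPartialHomeomorph S V where
  toFun x := (Θ x).1
  invFun v := open Classical in
    if h : (v, 0) ∈ Θ.target then ⟨Θ.symm (v, 0), (hΘ _ (Θ.map_target h)).2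
      (by rw [Θ.right_inv h])⟩ else p
  source := Subtype.val ⁻¹' Θ.source
  target := {v | (v, 0) ∈ Θ.target}
  map_source' x hx := by
    have h0 := (hΘ x hx).1 x.2
    have h1 := Θ.map_source hx
    rwa [← Prod.mk.eta (p := Θ x), h0] at h1
  map_target' v hv := by
    have hv : (v, (0 : ℝ)) ∈ Θ.target := hv
    rw [dif_pos hv]
    exact Θ.map_target hv
  left_inv' x hx := by
    have h0 := (hΘ x hx).1 x.2
    have h1 := Θ.map_source hx
    have h2 : ((Θ x).1, (0 : ℝ)) = Θ x := by rw [← h0]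
    rw [dif_pos (by rwa [h2])]
    exact Subtype.ext ((congrArg Θ.symm h2).trans (Θ.left_inv hx))
  right_inv' v hv := by
    have hv : (v, (0 : ℝ)) ∈ Θ.target := hv
    rw [dif_pos hv, Θ.right_inv hv]
  open_source := Θ.open_source.preimage continuous_subtype_val
  open_target := Θ.open_target.preimage (by fun_prop)
  continuousOn_toFun := continuous_fst.comp_continuousOn
    (Θ.continuousOn.comp continuous_subtype_val.continuousOn fun _ h => h)
  continuousOn_invFun := by
    rw [Topology.IsInducing.subtypeVal.continuousOn_iff]
    refine (Θ.continuousOn_symm.comp (f := fun v : V => (v, (0 : ℝ))) (by fun_prop)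
      fun v hv => hv).congr fun v hv => ?_
    have hv : (v, (0 : ℝ)) ∈ Θ.target := hv
    simp [hv]

namespace Chain

variable {n : ℕ} {X : Type*} [TopologicalSpace X]

/-- A union of components of a compact oriented manifold carries a cycle that is not null modulo
two at any of its points. If `n = 0`, there is no simplex in degree `n` with image in `∅` to exclude,
and the condition on the boundary is void. -/
lemma exists_cycle_of_isClopen [T2Space X] [CompactSpace X]
    {A : Set (OpenPartialHomeomorph X (EuclideanSpace ℝ (Fin n)))}
    (hcov : ∀ x : X, ∃ e ∈ A, x ∈ e.source)
    (hA : ∀ e ∈ A, ∀ e' ∈ A, ∀ y ∈ (e.symm.trans e').source,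
      0 < (fderiv ℝ (e.symm.trans e') y).det) {U : Set X} (hU : IsClopen U) :
    ∃ a ∈ sing ℤ (n + 1) U, bd a ∈ sing ℤ n (∅ : Set X) ∧
      ∀ p ∈ U, ¬ NullIn Set.univ {p} (red a) := by
  obtain ⟨z, hz, hbd, hor⟩ := exists_fundamental hcov hA
  obtain ⟨a, ha, b, hb, w, hw, hab⟩ := exists_split hU.isOpen hU.compl.isOpen
    (by rwa [Set.union_compl_self]) (sing_mono (Set.empty_subset U) hbd |> Submodule.mem_sup_left)
  rw [Set.union_compl_self] at hw
  refine ⟨a, ha, ?_, fun p hp h => ?_⟩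
  · rw [← Set.inter_compl_self U]
    refine mem_sing_inter (bd_mem ha) ?_
    have : bd a = bd z - bd b := by
      rw [hab, map_add, map_add, bd_bd]; abel
    rw [this]
    exact sub_mem (sing_mono (Set.empty_subset _) hbd) (bd_mem hb)
  · obtain ⟨e, -, hpe, he⟩ := hor p
    refine he.not_nullIn_red hpe ?_
    rw [hab, map_add, map_add, red_bd]
    refine (h.add (nullIn_of_mem (sing_mono ?_ (red_mem hb)))).add (nullIn_bd (red_mem hw))
    exact fun x hx => ⟨trivial, fun h => hx (by rwa [Set.mem_singleton_iff.1 h])⟩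

/-- If `d` bounds a chain `c` of the hypersurface `S`, which near `p` is a cycle and not null, then `d`
is null on exactly one of the two sides of `S` at `p`. -/
theorem not_nullIn_iff_of_bd_eq_push {M : Type*} [TopologicalSpace M] [T2Space M] {S : Set M}
    {V : Type} [NormedAddCommGroup V] [NormedSpace ℝ V] [FiniteDimensional ℝ V]
    (hV : Module.finrank ℝ V = n) (Θ : OpenPartialHomeomorph M (V × ℝ)) {p : S}
    (hp : (p : M) ∈ Θ.source) (hp0 : Θ p = 0) (hΘ : ∀ x ∈ Θ.source, x ∈ S ↔ (Θ x).2 = 0)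
    {c : Chain (ZMod 2) (n + 1) S} (hc : c ∈ sing _ (n + 1) Set.univ)
    (hbc : bd c ∈ sing _ n (Set.univ \ {p})) (hcp : ¬ NullIn Set.univ {p} c)
    {d : Chain (ZMod 2) (n + 2) M} (hd : d ∈ sing _ (n + 2) Set.univ)
    (hbd : bd d = push Subtype.val c) {r : ℝ} (hr : 0 < r)
    (hrΘ : ({0} ×ˢ Set.Icc (-r) r : Set (V × ℝ)) ⊆ Θ.target) :
    ¬ (NullIn Set.univ {Θ.symm (0, r)} d ↔ NullIn Set.univ {Θ.symm (0, -r)} d) := by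
  intro h
  set θ := sliceChart Θ p hΘ with hθ
  set L : Set (V × ℝ) := {0} ×ˢ Set.Icc (-r) r with hL
  have hLc : IsCompact L := isCompact_singleton.prod isCompact_Icc
  set K := Θ.symm '' L with hK
  have hKc : IsCompact K := hLc.image_of_continuousOn (Θ.continuousOn_symm.mono hrΘ)
  have hKΘ : K ⊆ Θ.source := by
    rintro _ ⟨y, hy, rfl⟩
    exact Θ.map_target (hrΘ hy)
  have hΘK : Θ '' K = L := by
    rw [hK, Set.image_image]
    exact (Set.image_congr fun y hy => Θ.right_inv (hrΘ hy)).trans (Set.image_id' L)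
  have hKS : ∀ x ∈ K, x ∈ S → x = p := by
    rintro _ ⟨⟨v, t⟩, hy, rfl⟩ hxS
    have h1 := (hΘ _ (Θ.map_target (hrΘ hy))).1 hxS
    rw [Θ.right_inv (hrΘ hy)] at h1
    obtain ⟨rfl : v = 0, -⟩ := hy
    obtain rfl : t = 0 := h1
    rw [← Θ.left_inv hp, hp0]
    rfl
  have hpθ : p ∈ θ.source := hp
  have hθp : θ p = 0 := by
    change (Θ p).1 = 0
    rw [hp0]
    rfl
  -- localize `c` near `p`
  have hcov : θ.source ∪ {p}ᶜ = Set.univ := by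
    refine Set.eq_univ_of_forall fun x => ?_
    by_cases hx : x = p
    · exact Or.inl (hx ▸ hpθ)
    · exact Or.inr hx
  obtain ⟨a, ha, b, hb, w, hw, hab⟩ := exists_split (c := c) θ.open_source
    isClosed_singleton.isOpen_compl (by rwa [hcov]) (Submodule.mem_sup_right (by
      rwa [Set.compl_eq_univ_sdiff]))
  rw [hcov] at hw
  have hap : ¬ NullIn Set.univ {p} a := by
    intro ha0
    refine hcp ?_
    rw [hab]
    exact (ha0.add (nullIn_of_mem (by rwa [← Set.compl_eq_univ_sdiff]))).add (nullIn_bd hw)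
  have hba : bd a ∈ sing _ n (Set.univ \ {p}) := by
    have h1 : bd a = bd c - bd b := by
      rw [hab, map_add, map_add, bd_bd]; abel
    rw [h1]
    refine sub_mem hbc ?_
    rw [← Set.compl_eq_univ_sdiff]
    exact bd_mem hb
  have hval : ∀ {k : ℕ} {U : Set S} {x : Chain (ZMod 2) k S}, x ∈ sing _ k U →
      push Subtype.val x ∈ sing _ k (Subtype.val '' U) := fun hx =>
    push_mem continuous_subtype_val.continuousOn (Set.mapsTo_image _ _) hx
  -- localize `d` near the segment
  set d' := d - push Subtype.val w with hd'
  have hd'm : d' ∈ sing _ (n + 2) Set.univ :=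
    sub_mem hd (sing_mono (Set.subset_univ _) (hval hw))
  have hbd' : bd d' = push Subtype.val a + push Subtype.val b := by
    rw [hd', map_sub, hbd, hab, bd_push, ← map_sub, ← map_add]
    congr 1
    abel
  have haM : push Subtype.val a ∈ sing _ (n + 1) Θ.source :=
    push_mem continuous_subtype_val.continuousOn (fun x hx => hx) ha
  have hbM : push Subtype.val b ∈ sing _ (n + 1) (Set.univ \ K) := by
    refine sing_mono ?_ (hval hb)
    rintro _ ⟨x, hx, rfl⟩
    exact ⟨trivial, fun hxK => hx (Subtype.ext (hKS x hxK x.2))⟩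
  obtain ⟨D, hD, hdD, y, hy, hbD⟩ := exists_excision Θ.open_source (Set.subset_univ _)
    (isOpen_univ_sdiff hKc.isClosed) hKΘ hd'm (by
      rw [hbd']
      exact Submodule.add_mem_sup haM hbM)
  have hE : bd D - push Subtype.val a ∈ sing _ (n + 1) (Θ.source ∩ (Set.univ \ K)) := by
    refine mem_sing_inter (sub_mem (bd_mem hD) haM) ?_
    have : bd D - push Subtype.val a = push Subtype.val b - bd y := by
      rw [hbd'] at hbD
      rw [sub_eq_sub_iff_add_eq_add, ← hbD]
      exact add_comm _ _
    rw [this]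
    exact sub_mem hbM (bd_mem hy)
  have hends : ∀ q ∈ L, q.2 ≠ 0 →
      (NullIn Set.univ {q} (push Θ D) ↔ NullIn Set.univ {Θ.symm q} d) := by
    intro q hq hq0
    have hqK : Θ.symm q ∈ K := Set.mem_image_of_mem _ hq
    have h1 := nullIn_push_iff Θ (K := {Θ.symm q}) (Set.singleton_subset_iff.2 (hKΘ hqK))
      isClosed_singleton (by simp) hD
    rw [Set.image_singleton, Θ.right_inv (hrΘ hq)] at h1
    rw [h1, ← (hdD.mono (Set.singleton_subset_iff.2 hqK)).congr]
    refine (NullIn.congr (nullIn_of_mem ?_)).symm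
    rw [hd', sub_sub_cancel]
    refine sing_mono ?_ (hval hw)
    rintro _ ⟨x, -, rfl⟩
    refine ⟨trivial, fun hx => hq0 ?_⟩
    rw [Set.mem_singleton_iff] at hx
    have h2 := (hΘ x (hx ▸ hKΘ hqK)).1 x.2
    rwa [hx, Θ.right_inv (hrΘ hq)] at h2
  refine hap ?_
  rw [← nullIn_push_iff θ (Set.singleton_subset_iff.2 hpθ) isClosed_singleton (by simp) ha,
    Set.image_singleton, hθp]
  have hθpush : push Θ (push Subtype.val a) = push (fun v => (v, (0 : ℝ))) (push θ a) := by
    rw [push_push, push_push]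
    refine push_congr_of_mem (fun x hx => ?_) ha
    exact Prod.ext rfl ((hΘ x hx).1 x.2)
  refine nullIn_of_nullIn_iff hV hr (D := push Θ D)
    (push_mem Θ.continuousOn (Set.mapsTo_univ _ _) hD)
    (push_mem θ.continuousOn (Set.mapsTo_univ _ _) ha) ?_ ?_ ?_
  · have := bd_push_mem θ (Set.singleton_subset_iff.2 hpθ)
      (z := a) (sing_mono (U := θ.source ∩ (Set.univ \ {p})) (V := θ.source \ {p}) (fun x hx => ⟨hx.1, hx.2.2⟩)
        (mem_sing_inter (bd_mem ha) hba))
    rwa [Set.image_singleton, hθp] at this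
  · rw [← hθpush, bd_push, ← map_sub]
    refine push_mem (V := Set.univ \ L) (Θ.continuousOn.mono Set.inter_subset_left)
      (fun x hx => ⟨trivial, ?_⟩) hE
    rw [← hΘK]
    rintro ⟨x', hx', hxx'⟩
    exact hx.2.2 (Θ.injOn (hKΘ hx') hx.1 hxx' ▸ hx')
  · rw [hends (0, r) ⟨rfl, by simp [hr.le]⟩ hr.ne',
      hends (0, -r) ⟨rfl, by simp [hr.le]⟩ (neg_ne_zero.2 hr.ne')]
    exact h

end Chain

/-! ### Cutting along a two-sided connected hypersurface -/

section Topology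

open Set Topology

variable {M : Type*} [TopologicalSpace M]

/-- The set `T` has locally two sides, which are told apart by `φ`: every point of `T` has arbitrarily
small neighbourhoods `W` such that `W \ T` is the union of two connected sides, both of them
accumulating at all of `W ∩ T`, and `φ` takes different values somewhere on them. -/
def TwoSided (T : Set M) (φ : M → Prop) : Prop :=
  ∀ p ∈ T, ∀ N ∈ 𝓝 p, ∃ W, IsOpen W ∧ p ∈ W ∧ W ⊆ N ∧ ∃ P Q, IsPreconnected P ∧ IsPreconnected Q ∧
    W \ T = P ∪ Q ∧ W ∩ T ⊆ closure P ∧ W ∩ T ⊆ closure Q ∧ ∃ a ∈ P, ∃ b ∈ Q, ¬ (φ a ↔ φ b)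

/-- A component of the complement of `T` that accumulates at `p` contains one of the sides at `p`. -/
lemma subset_or_subset_of_mem_closure {U T W P Q : Set M} {x p : M} (hWo : IsOpen W)
    (hpW : p ∈ W) (hWU : W ⊆ U) (hP : IsPreconnected P) (hQ : IsPreconnected Q)
    (hPQ : W \ T = P ∪ Q) (hp : p ∈ closure (connectedComponentIn (U \ T) x)) :
    P ⊆ connectedComponentIn (U \ T) x ∨ Q ⊆ connectedComponentIn (U \ T) x := by
  obtain ⟨z, hzW, hzD⟩ := mem_closure_iff.1 hp W hWo hpW
  have hz := connectedComponentIn_subset _ _ hzD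
  have hsub : W \ T ⊆ U \ T := sdiff_subset_sdiff_left hWU
  rw [connectedComponentIn_eq hzD]
  rcases (hPQ ▸ (⟨hzW, hz.2⟩ : z ∈ W \ T) : z ∈ P ∪ Q) with h | h
  · exact Or.inl (hP.subset_connectedComponentIn h ((hPQ ▸ subset_union_left).trans hsub))
  · exact Or.inr (hQ.subset_connectedComponentIn h ((hPQ ▸ subset_union_right).trans hsub))

/-- If the component of `x` in `U` is cut by `T`, then what remains of it around `x` accumulates at all
of `T`. -/
lemma TwoSided.subset_closure [LocallyConnectedSpace M] {T U : Set M} {φ : M → Prop}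
    (h : TwoSided T φ) (hT : IsPreconnected T) (hTc : IsClosed T) (hU : IsOpen U) {x : M}
    (hx : x ∈ U \ T) (hTU : T ⊆ U) (hTx : (connectedComponentIn U x ∩ T).Nonempty) :
    T ⊆ closure (connectedComponentIn (U \ T) x) := by
  set D := connectedComponentIn (U \ T) x with hD
  have hUT : IsOpen (U \ T) := hU.sdiff hTc
  have hne : (T ∩ closure D).Nonempty := by
    by_contra hne
    rw [not_nonempty_iff_eq_empty] at hne
    have hsub : connectedComponentIn U x ⊆ D := by
      refine isPreconnected_connectedComponentIn.subset_of_closure_inter_subset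
        hUT.connectedComponentIn ⟨x, mem_connectedComponentIn hx.1, mem_connectedComponentIn hx⟩ ?_
      rintro z ⟨hzD, hzC⟩
      have hzU : z ∈ U \ T := ⟨connectedComponentIn_subset _ _ hzC, fun hzT =>
        (hne ▸ (⟨hzT, hzD⟩ : z ∈ T ∩ closure D) : z ∈ (∅ : Set M))⟩
      obtain ⟨y, hyz, hyD⟩ := mem_closure_iff.1 hzD _ (hUT.connectedComponentIn (x := z))
        (mem_connectedComponentIn hzU)
      rw [hD, connectedComponentIn_eq hyD, ← connectedComponentIn_eq hyz]
      exact mem_connectedComponentIn hzU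
    obtain ⟨z, hzC, hzT⟩ := hTx
    exact (connectedComponentIn_subset _ _ (hsub hzC)).2 hzT
  -- the part of `T` in the closure of `D` is open in `T`, since whole sides belong to `D`
  let u : Set M := ⋃₀ {W | IsOpen W ∧ W ∩ T ⊆ closure D}
  have hu : IsOpen u := isOpen_sUnion fun W hW => hW.1
  have huT : u ∩ T ⊆ closure D := by
    rintro z ⟨⟨W, hW, hzW⟩, hzT⟩
    exact hW.2 ⟨hzW, hzT⟩
  have hDu : T ∩ closure D ⊆ u := by
    rintro z ⟨hzT, hzD⟩
    obtain ⟨W, hWo, hzW, hWU, P, Q, hP, hQ, hPQ, hWP, hWQ, -⟩ := h z hzT U (hU.mem_nhds (hTU hzT))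
    refine ⟨W, ⟨hWo, ?_⟩, hzW⟩
    rcases subset_or_subset_of_mem_closure hWo hzW hWU hP hQ hPQ hzD with h | h
    · exact hWP.trans (closure_mono h)
    · exact hWQ.trans (closure_mono h)
  rcases isPreconnected_iff_subset_of_disjoint.1 hT u (closure D)ᶜ hu isClosed_closure.isOpen_compl
    (fun z hz => by
      by_cases hzD : z ∈ closure D
      · exact Or.inl (hDu ⟨hz, hzD⟩)
      · exact Or.inr hzD) (by
      rw [eq_empty_iff_forall_notMem]
      rintro z ⟨hzT, hzu, hzD⟩
      exact hzD (huT ⟨hzu, hzT⟩)) with hs | hs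
  · exact fun z hz => huT ⟨hs hz, hz⟩
  · obtain ⟨z, hzT, hzD⟩ := hne
    exact absurd hzD (hs hzT)

/-- Cutting along `T` separates only points that are told apart by `φ`. -/
theorem TwoSided.connectedComponentIn_sdiff_eq [LocallyConnectedSpace M] {T U : Set M}
    {φ : M → Prop} (h : TwoSided T φ) (hT : IsPreconnected T) (hTc : IsClosed T) (hU : IsOpen U)
    (hTU : T ⊆ U) (hφ : ∀ x y, connectedComponentIn Tᶜ x = connectedComponentIn Tᶜ y → x ∈ Tᶜ →
      y ∈ Tᶜ → (φ x ↔ φ y)) {x y : M} (hx : x ∈ U \ T) (hy : y ∈ U \ T)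
    (hxy : connectedComponentIn U x = connectedComponentIn U y) (hφxy : φ x ↔ φ y) :
    connectedComponentIn (U \ T) x = connectedComponentIn (U \ T) y := by
  rcases (connectedComponentIn U x ∩ T).eq_empty_or_nonempty with he | hTx
  · have hsub : connectedComponentIn U x ⊆ connectedComponentIn (U \ T) x :=
      isPreconnected_connectedComponentIn.subset_connectedComponentIn
        (mem_connectedComponentIn hx.1) fun z hz => ⟨connectedComponentIn_subset _ _ hz,
          fun hzT => (he ▸ (⟨hz, hzT⟩ : z ∈ _ ∩ T) : z ∈ (∅ : Set M))⟩
    refine connectedComponentIn_eq (hsub ?_)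
    rw [hxy]
    exact mem_connectedComponentIn hy.1
  have hDx := h.subset_closure hT hTc hU hx hTU hTx
  have hDy := h.subset_closure hT hTc hU hy hTU (hxy ▸ hTx)
  obtain ⟨p, -, hpT⟩ := hTx
  obtain ⟨W, hWo, hpW, hWU, P, Q, hP, hQ, hPQ, -, -, a, ha, b, hb, hab⟩ :=
    h p hpT U (hU.mem_nhds (hTU hpT))
  have hconst : ∀ z w, z ∈ U \ T → w ∈ connectedComponentIn (U \ T) z → (φ z ↔ φ w) := by
    intro z w hz hw
    have hsub : U \ T ⊆ Tᶜ := fun v hv => hv.2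
    exact hφ z w (connectedComponentIn_eq (connectedComponentIn_mono z hsub hw)) hz.2
      (hsub (connectedComponentIn_subset _ _ hw))
  have hcommon : ∀ R : Set M, R.Nonempty → R ⊆ connectedComponentIn (U \ T) x →
      R ⊆ connectedComponentIn (U \ T) y →
      connectedComponentIn (U \ T) x = connectedComponentIn (U \ T) y := by
    rintro R ⟨c, hc⟩ h1 h2
    rw [connectedComponentIn_eq (h1 hc), connectedComponentIn_eq (h2 hc)]
  -- at `p` both components contain a side, the same one unless `φ` distinguishes `x` from `y`
  rcases subset_or_subset_of_mem_closure hWo hpW hWU hP hQ hPQ (hDx hpT) with h1 | h1 <;>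
    rcases subset_or_subset_of_mem_closure hWo hpW hWU hP hQ hPQ (hDy hpT) with h2 | h2
  · exact hcommon P ⟨a, ha⟩ h1 h2
  · refine absurd ?_ hab
    rw [← hconst x a hx (h1 ha), ← hconst y b hy (h2 hb)]
    exact hφxy
  · refine absurd ?_ hab
    rw [← hconst x b hx (h1 hb), ← hconst y a hy (h2 ha)]
    exact hφxy.symm
  · exact hcommon Q ⟨b, hb⟩ h1 h2

/-- Cutting along finitely many disjoint sets does not separate two points if the individual cuts
do not. -/
theorem connectedComponentIn_compl_biUnion_eq [LocallyConnectedSpace M] {ι : Type*} (s : Finset ι)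
    {T : ι → Set M} {φ : ι → M → Prop} (h : ∀ i, TwoSided (T i) (φ i))
    (hT : ∀ i, IsPreconnected (T i)) (hTc : ∀ i, IsClosed (T i))
    (hdisj : ∀ i j, T i = T j ∨ Disjoint (T i) (T j))
    (hφ : ∀ i x y, connectedComponentIn (T i)ᶜ x = connectedComponentIn (T i)ᶜ y → x ∈ (T i)ᶜ →
      y ∈ (T i)ᶜ → (φ i x ↔ φ i y)) {x y : M} (hx : ∀ i ∈ s, x ∉ T i) (hy : ∀ i ∈ s, y ∉ T i)
    (hxy : connectedComponent x = connectedComponent y)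
    (hsep : ∀ i ∈ s, connectedComponentIn (T i)ᶜ x = connectedComponentIn (T i)ᶜ y) :
    connectedComponentIn (⋃ i ∈ s, T i)ᶜ x = connectedComponentIn (⋃ i ∈ s, T i)ᶜ y := by
  classical
  induction s using Finset.induction_on with
  | empty => simpa [connectedComponentIn_univ] using hxy
  | insert j s hj ih =>
    have ih := ih (fun i hi => hx i (Finset.mem_insert_of_mem hi))
      (fun i hi => hy i (Finset.mem_insert_of_mem hi))
      (fun i hi => hsep i (Finset.mem_insert_of_mem hi))
    by_cases hjs : ∃ i ∈ s, T j = T i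
    · obtain ⟨i, hi, hij⟩ := hjs
      have : ⋃ k ∈ insert j s, T k = ⋃ k ∈ s, T k := by
        rw [Finset.set_biUnion_insert, union_eq_right, hij]
        exact subset_biUnion_of_mem (u := T) hi
      rwa [this]
    · push Not at hjs
      have hset : (⋃ k ∈ insert j s, T k)ᶜ = (⋃ k ∈ s, T k)ᶜ \ T j := by
        rw [Finset.set_biUnion_insert, union_comm, compl_union, sdiff_eq]
      have hmem : ∀ z, (∀ i ∈ insert j s, z ∉ T i) → z ∈ (⋃ k ∈ s, T k)ᶜ \ T j := fun z hz => by
        refine ⟨fun h => ?_, hz j (Finset.mem_insert_self j s)⟩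
        obtain ⟨i, hi, hzi⟩ := mem_iUnion₂.1 h
        exact hz i (Finset.mem_insert_of_mem hi) hzi
      rw [hset]
      refine (h j).connectedComponentIn_sdiff_eq (hT j) (hTc j)
        (s.finite_toSet.isClosed_biUnion fun i _ => hTc i).isOpen_compl ?_ (hφ j) (hmem x hx)
        (hmem y hy) ih (hφ j x y (hsep j (Finset.mem_insert_self j s))
          (hx j (Finset.mem_insert_self j s)) (hy j (Finset.mem_insert_self j s)))
      intro z hz h
      obtain ⟨i, hi, hzi⟩ := mem_iUnion₂.1 h
      rcases hdisj j i with h | h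
      · exact hjs i hi h
      · exact disjoint_left.1 h hz hzi

end Topology

/-! ### Slice charts -/

/-- Near each of its points, a smoothly embedded hypersurface is flat in a suitable chart. -/
lemma exists_sliceChart {n : ℕ} {M : Type u} [TopologicalSpace M]
    [ChartedSpace (EuclideanSpace ℝ (Fin (n + 1))) M] {S : Set M}
    [ChartedSpace (EuclideanSpace ℝ (Fin n)) S]
    (hS : Manifold.IsSmoothEmbedding (𝓡 n) (𝓡 (n + 1)) ∞ (Subtype.val : S → M)) (p : S) :
    ∃ Θ : OpenPartialHomeomorph M (EuclideanSpace ℝ (Fin n) × ℝ),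
      (p : M) ∈ Θ.source ∧ Θ p = 0 ∧ ∀ x ∈ Θ.source, x ∈ S ↔ (Θ x).2 = 0 := by
  obtain ⟨F, _, _, h⟩ := hS.isImmersion.isImmersionAt p
  set φ := h.domChart
  set ψ := h.codChart
  have hwrite : ∀ v ∈ φ.target, ψ (φ.symm v) = h.equiv (v, 0) := by
    intro v hv
    have hv' : v ∈ (h.domChart.extend (𝓡 n)).target := by simpa using hv
    simpa using h.writtenInCharts hv'
  have hmaps : ∀ x : S, x ∈ φ.source → (x : M) ∈ ψ.source := fun x hx =>
    h.source_subset_preimage_source hx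
  -- the complement is a line
  have hfd : FiniteDimensional ℝ F := FiniteDimensional.of_injective
    (h.equiv.toLinearMap ∘ₗ LinearMap.inr ℝ (EuclideanSpace ℝ (Fin n)) F)
    (h.equiv.injective.comp (LinearMap.inr_injective))
  have hF : Module.finrank ℝ F = Module.finrank ℝ ℝ := by
    have := h.equiv.toLinearEquiv.finrank_eq
    simp only [Module.finrank_prod, finrank_euclideanSpace, Fintype.card_fin] at this
    simp
    omega
  let ℓ : F ≃L[ℝ] ℝ := ContinuousLinearEquiv.ofFinrankEq hF
  let g : EuclideanSpace ℝ (Fin (n + 1)) ≃ₜ EuclideanSpace ℝ (Fin n) × ℝ :=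
    (h.equiv.symm.trans ((ContinuousLinearEquiv.refl ℝ _).prodCongr ℓ)).toHomeomorph.trans
      (Homeomorph.subRight (φ p, 0))
  have hg : ∀ v, g (h.equiv (v, 0)) = (v - φ p, 0) := fun v => by simp [g]
  let Ψ := ψ.transHomeomorph g
  have hΨs : Ψ.source = ψ.source := rfl
  have hΨφ : ∀ x : S, x ∈ φ.source → Ψ x = (φ x - φ p, 0) := by
    intro x hx
    have h1 := hwrite (φ x) (φ.map_source hx)
    rw [φ.left_inv hx] at h1
    change g (ψ x) = _
    rw [h1, hg]
  obtain ⟨W, hW, hWφ⟩ := isOpen_induced_iff.1 φ.open_source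
  have hT : IsOpen {q : EuclideanSpace ℝ (Fin n) × ℝ | q.1 + φ p ∈ φ.target} :=
    φ.open_target.preimage (by fun_prop)
  have hp : p ∈ φ.source := h.mem_domChart_source
  have hpW : (p : M) ∈ W := by
    have : p ∈ Subtype.val ⁻¹' W := by rwa [hWφ]
    exact this
  have hΨp : Ψ p = 0 := by
    rw [hΨφ p hp, sub_self]
    rfl
  let Θ := Ψ.restrOpen _ ((Ψ.isOpen_inter_preimage hT).inter hW)
  refine ⟨Θ, ⟨hmaps p hp, ⟨hmaps p hp, ?_⟩, hpW⟩, hΨp, ?_⟩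
  · change (Ψ p).1 + φ p ∈ φ.target
    rw [hΨp, Prod.fst_zero, zero_add]
    exact φ.map_source hp
  · rintro x ⟨hx, ⟨-, hxT⟩, hxW⟩
    change x ∈ S ↔ (Ψ x).2 = 0
    constructor
    · intro hxS
      have hxφ : (⟨x, hxS⟩ : S) ∈ φ.source := by
        rw [← hWφ]
        exact hxW
      rw [hΨφ _ hxφ]
    · intro hx0
      have hxT : (Ψ x).1 + φ p ∈ φ.target := hxT
      have h1 := hΨφ _ (φ.map_target hxT)
      rw [φ.right_inv hxT, add_sub_cancel_right] at h1
      have h2 : Ψ x = Ψ (φ.symm ((Ψ x).1 + φ p)) := by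
        rw [h1, ← hx0]
      rw [Ψ.injOn hx (hmaps _ (φ.map_target hxT)) h2]
      exact Subtype.coe_prop _

/-! ### The two sides of a hypersurface -/

namespace Chain

open Set Topology

variable {n : ℕ} {M : Type u} [TopologicalSpace M] [T2Space M]

/-- The vanishing of a chain of a manifold in local homology is locally constant off its boundary. -/
lemma eventually_nullIn_iff {V : Type} [NormedAddCommGroup V] [NormedSpace ℝ V]
    [FiniteDimensional ℝ V] {T : Set M} (hT : IsClosed T) {d : Chain (ZMod 2) (n + 1) M}
    (hd : d ∈ sing _ (n + 1) univ) (hbd : bd d ∈ sing _ n T)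
    (e : OpenPartialHomeomorph M V) {x : M} (hx : x ∈ e.source) (hxT : x ∉ T) :
    ∀ᶠ y in 𝓝 x, (NullIn univ {y} d ↔ NullIn univ {x} d) := by
  obtain ⟨r, hr, hre⟩ := Metric.nhds_basis_closedBall.mem_iff.1
    ((e.isOpen_inter_preimage_symm hT.isOpen_compl).mem_nhds
      ⟨e.map_source hx, by simpa [e.left_inv hx] using hxT⟩)
  have : ProperSpace V := FiniteDimensional.proper ℝ V
  set B := Metric.closedBall (e x) r
  have hBe : B ⊆ e.target := fun y hy => (hre hy).1
  set K := e.symm '' B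
  have hKc : IsCompact K :=
    (isCompact_closedBall _ _).image_of_continuousOn (e.continuousOn_symm.mono hBe)
  have hKe : K ⊆ e.source := by
    rintro _ ⟨y, hy, rfl⟩
    exact e.map_target (hBe hy)
  have heK : e '' K = B := by
    rw [image_image]
    exact (image_congr fun y hy => e.right_inv (hBe hy)).trans (image_id' B)
  have hTK : T ⊆ univ \ K := by
    rintro y hy
    refine ⟨trivial, ?_⟩
    rintro ⟨v, hv, rfl⟩
    exact (hre hv).2 hy
  obtain ⟨d', hd', hbd', hn⟩ := exists_mem_sing_nullIn_sub e.open_source hKc.isClosed hKe hd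
    (sing_mono hTK hbd)
  have hb := bd_push_mem e hKe hbd'
  rw [heK] at hb
  have hpd : push e d' ∈ sing _ (n + 1) univ := push_mem e.continuousOn (mapsTo_univ _ _) hd'
  have key : ∀ v ∈ B, ∀ v' ∈ B, NullIn univ {v} (push e d') → NullIn univ {v'} (push e d') :=
    fun v hv v' hv' h => (NullIn.of_convex (convex_closedBall _ _) Metric.isBounded_closedBall hv
      hpd hb h).mono (singleton_subset_iff.2 hv')
  have htr : ∀ y ∈ K, (NullIn univ {y} d ↔ NullIn univ {e y} (push e d')) := fun y hy => by
    rw [← image_singleton, nullIn_push_iff e (singleton_subset_iff.2 (hKe hy)) isClosed_singleton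
      (by simp) hd', (hn.mono (singleton_subset_iff.2 hy)).congr]
  have hxB : e x ∈ B := Metric.mem_closedBall_self hr.le
  have hxK : x ∈ K := ⟨e x, hxB, e.left_inv hx⟩
  filter_upwards [e.open_source.mem_nhds hx,
    (e.continuousAt hx).preimage_mem_nhds (Metric.closedBall_mem_nhds _ hr)] with y hy hyB
  have hyK : y ∈ K := ⟨e y, hyB, e.left_inv hy⟩
  rw [htr y hyK, htr x hxK]
  exact ⟨key _ hyB _ hxB, key _ hxB _ hyB⟩

/-- A locally constant property is constant on the components of an open set. -/
lemma _root_.iff_of_connectedComponentIn_eq {M : Type*} [TopologicalSpace M] {U : Set M}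
    (hU : IsOpen U) {φ : M → Prop} (hφ : ∀ x ∈ U, ∀ᶠ y in 𝓝 x, (φ y ↔ φ x)) {x y : M} (hx : x ∈ U)
    (hy : y ∈ U) (hxy : connectedComponentIn U x = connectedComponentIn U y) : φ x ↔ φ y := by
  have hsub : connectedComponentIn U x ⊆ {z | z ∈ U ∧ (φ z ↔ φ x)} := by
    refine isPreconnected_connectedComponentIn.subset_of_closure_inter_subset ?_
      ⟨x, mem_connectedComponentIn hx, hx, Iff.rfl⟩ ?_
    · refine isOpen_iff_mem_nhds.2 fun z hz => ?_
      filter_upwards [hU.mem_nhds hz.1, hφ z hz.1] with w hw h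
      exact ⟨hw, h.trans hz.2⟩
    · rintro z ⟨hz, hzC⟩
      have hzU := connectedComponentIn_subset _ _ hzC
      obtain ⟨w, hw, hwx⟩ := (mem_closure_iff_nhds.1 hz) _ (hφ z hzU)
      exact ⟨hzU, (Iff.symm hw).trans hwx.2⟩
  exact (hsub (hxy ▸ mem_connectedComponentIn hy)).2.symm

/-- A union of components of the hypersurface that bounds a chain has two sides, and the chain is
null on exactly one of them. -/
theorem twoSided_nullIn {S : Set M} (hS : IsClosed S)
    (hslice : ∀ p : S, ∃ Θ : OpenPartialHomeomorph M (EuclideanSpace ℝ (Fin n) × ℝ),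
      (p : M) ∈ Θ.source ∧ Θ p = 0 ∧ ∀ x ∈ Θ.source, x ∈ S ↔ (Θ x).2 = 0)
    {T : Set S} (hT : IsClopen T) {c : Chain (ZMod 2) (n + 1) S}
    (hc : c ∈ sing _ (n + 1) univ) (hbc : bd c ∈ sing _ n (∅ : Set S))
    (hcT : ∀ p ∈ T, ¬ NullIn univ {p} c) {d : Chain (ZMod 2) (n + 2) M}
    (hd : d ∈ sing _ (n + 2) univ) (hbd : bd d = push Subtype.val c) :
    TwoSided (Subtype.val '' T) fun x => NullIn univ {x} d := by
  rintro _ ⟨p, hpT, rfl⟩ N hN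
  obtain ⟨Θ, hp, hp0, hΘ⟩ := hslice p
  have hcl : IsClosed ((Subtype.val : S → M) '' Tᶜ) :=
    hS.isClosedEmbedding_subtypeVal.isClosedMap _ hT.compl.isClosed
  have hN' : interior N ∩ (Subtype.val '' Tᶜ)ᶜ ∈ 𝓝 (p : M) := by
    refine Filter.inter_mem (interior_mem_nhds.2 hN) (hcl.isOpen_compl.mem_nhds ?_)
    rintro ⟨q, hq, hqp⟩
    exact hq (Subtype.ext hqp ▸ hpT)
  have hsymm : Θ.symm 0 = p := by rw [← hp0, Θ.left_inv hp]
  have h0 : (0 : EuclideanSpace ℝ (Fin n) × ℝ) ∈ Θ.target := hp0 ▸ Θ.map_source hp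
  obtain ⟨ρ, hρ, hρΘ⟩ := Metric.nhds_basis_ball.mem_iff.1 (Filter.inter_mem
    (Θ.open_target.mem_nhds h0) ((Θ.continuousAt_symm h0).preimage_mem_nhds (hsymm.symm ▸ hN')))
  set B := Metric.ball (0 : EuclideanSpace ℝ (Fin n) × ℝ) ρ
  have hBt : B ⊆ Θ.target := fun q hq => (hρΘ hq).1
  have hBS : ∀ q ∈ B, Θ.symm q ∈ Subtype.val '' T ↔ q.2 = 0 := by
    intro q hq
    have h1 := hΘ _ (Θ.map_target (hBt hq))
    rw [Θ.right_inv (hBt hq)] at h1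
    rw [← h1]
    refine ⟨?_, fun h => ⟨⟨_, h⟩, ?_, rfl⟩⟩
    · rintro ⟨y, -, hy⟩
      exact hy ▸ y.2
    · by_contra hnT
      exact (hρΘ hq).2.2 ⟨_, hnT, rfl⟩
  have hpre : ∀ C : Set (EuclideanSpace ℝ (Fin n) × ℝ), Convex ℝ C →
      IsPreconnected (Θ.symm '' (B ∩ C)) := fun C hC =>
    ((convex_ball _ _).inter hC).isPreconnected.image _
      (Θ.continuousOn_symm.mono (inter_subset_left.trans hBt))
  have hcl : ∀ I : Set ℝ, (0 : ℝ) ∈ closure I → Θ.symm '' B ∩ Subtype.val '' T ⊆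
      closure (Θ.symm '' (B ∩ (univ ×ˢ I))) := by
    rintro I hI _ ⟨⟨q, hq, rfl⟩, hqT⟩
    have hq0 := (hBS q hq).1 hqT
    refine mem_closure_image (Θ.continuousAt_symm (hBt hq)) (Metric.isOpen_ball.inter_closure
      ⟨hq, ?_⟩)
    rw [closure_prod_eq, closure_univ]
    exact ⟨trivial, by rwa [hq0]⟩
  have hr : 0 < ρ / 2 := half_pos hρ
  have hseg : ({0} ×ˢ Icc (-(ρ / 2)) (ρ / 2) : Set (EuclideanSpace ℝ (Fin n) × ℝ)) ⊆ B := by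
    rintro ⟨v, t⟩ ⟨hv : v = 0, ht⟩
    rw [mem_ball_zero_iff, Prod.norm_def, hv, norm_zero, max_lt_iff, Real.norm_eq_abs]
    exact ⟨hρ, (abs_le.2 ht).trans_lt (half_lt_self hρ)⟩
  refine ⟨Θ.symm '' B, Θ.isOpen_image_symm_of_subset_target Metric.isOpen_ball hBt,
    ⟨0, Metric.mem_ball_self hρ, hsymm⟩, ?_, Θ.symm '' (B ∩ (univ ×ˢ Ioi 0)),
    Θ.symm '' (B ∩ (univ ×ˢ Iio 0)), hpre _ (convex_univ.prod (convex_Ioi 0)),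
    hpre _ (convex_univ.prod (convex_Iio 0)), ?_, hcl _ (by simp), hcl _ (by simp),
    Θ.symm (0, ρ / 2), mem_image_of_mem _ ⟨hseg ⟨rfl, by constructor <;> linarith⟩, trivial, hr⟩,
    Θ.symm (0, -(ρ / 2)), mem_image_of_mem _ ⟨hseg ⟨rfl, by constructor <;> linarith⟩, trivial,
      neg_lt_zero.2 hr⟩, ?_⟩
  · rintro _ ⟨q, hq, rfl⟩
    exact interior_subset (hρΘ hq).2.1
  · ext x
    constructor
    · rintro ⟨⟨q, hq, rfl⟩, hqT⟩
      rw [hBS q hq] at hqT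
      rcases lt_or_gt_of_ne hqT with h | h
      · exact Or.inr ⟨q, ⟨hq, trivial, h⟩, rfl⟩
      · exact Or.inl ⟨q, ⟨hq, trivial, h⟩, rfl⟩
    · rintro (⟨q, ⟨hq, -, h⟩, rfl⟩ | ⟨q, ⟨hq, -, h⟩, rfl⟩)
      · exact ⟨⟨q, hq, rfl⟩, fun hqT => (ne_of_gt h) ((hBS q hq).1 hqT)⟩
      · exact ⟨⟨q, hq, rfl⟩, fun hqT => (ne_of_lt h) ((hBS q hq).1 hqT)⟩
  · exact not_nullIn_iff_of_bd_eq_push (by simp) Θ hp hp0 hΘ hc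
      (sing_mono (empty_subset _) hbc) (hcT p hpT) hd hbd hr (hseg.trans hBt)

end Chain

theorem proposition3 (n : ℕ)
    -- `M` is a closed orientable smooth manifold of dimension `n + 1`
    (M : Type u) [TopologicalSpace M] [T2Space M] [CompactSpace M]
    [ChartedSpace (EuclideanSpace ℝ (Fin (n + 1))) M] [IsManifold (𝓡 (n + 1)) ∞ M]
    (hM : IsOrientableManifold (n + 1) M)
    (hH : CategoryTheory.Limits.IsZero (integralHomology n M))
    -- `S` is a nonempty closed orientable smoothly embedded hypersurface of `M`
    (S : Set M) [ChartedSpace (EuclideanSpace ℝ (Fin n)) S] [IsManifold (𝓡 n) ∞ S]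
    (hS : Manifold.IsSmoothEmbedding (𝓡 n) (𝓡 (n + 1)) ∞ (Subtype.val : S → M))
    (hS_compact : IsCompact S) (hS_nonempty : S.Nonempty)
    (hS_orientable : IsOrientableManifold n S)
    (K₁ K₂ : Set M) (hK₁ : IsClosed K₁) (hK₂ : IsClosed K₂)
    (hsep : Separates S K₁ K₂) :
    ∃ p ∈ S, Separates (connectedComponentIn S p) K₁ K₂ := by
  classical
  obtain ⟨x, hx, y, hy, hK₁x, hK₂y, hne⟩ := hsep
  have : CompactSpace S := isCompact_iff_compactSpace.1 hS_compact
  have : LocallyConnectedSpace S := ChartedSpace.locallyConnectedSpace (EuclideanSpace ℝ (Fin n)) S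
  have : LocallyConnectedSpace M :=
    ChartedSpace.locallyConnectedSpace (EuclideanSpace ℝ (Fin (n + 1))) M
  obtain ⟨A, -, hcov, hA⟩ := hS_orientable
  -- a cycle on each component of `S`, and a chain of `M` that it bounds
  let T : S → Set M := fun p => Subtype.val '' connectedComponent p
  have hclopen : ∀ p : S, IsClopen (connectedComponent p) := fun p =>
    ⟨isClosed_connectedComponent, isOpen_connectedComponent⟩
  choose a ha hba hap using fun p : S => Chain.exists_cycle_of_isClopen hcov hA (hclopen p)
  have hval : ∀ p, Chain.push Subtype.val (a p) ∈ Chain.sing ℤ (n + 1) (T p) := fun p =>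
    Chain.push_mem continuous_subtype_val.continuousOn (Set.mapsTo_image _ _) (ha p)
  choose w hw hbw using fun p => Chain.exists_bd_eq_of_isZero hH
    (Chain.sing_mono (Set.subset_univ _) (hval p)) (fun hn => by
      obtain ⟨k, rfl⟩ := Nat.exists_eq_succ_of_ne_zero hn
      rw [Chain.bd_push, Chain.eq_zero_of_mem_sing_empty (hba p), map_zero])
  have hbd : ∀ p, Chain.bd (red (w p)) = Chain.push Subtype.val (red (a p)) := fun p => by
    rw [← Chain.red_bd, hbw, Chain.red_push]
  let φ : S → M → Prop := fun p z => Chain.NullIn Set.univ {z} (red (w p))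
  have hTc : ∀ p, IsClosed (T p) := fun p =>
    hS_compact.isClosed.isClosedEmbedding_subtypeVal.isClosedMap _ isClosed_connectedComponent
  have hTS : ∀ p, T p ⊆ S := fun p => Subtype.coe_image_subset _ _
  have htwo : ∀ p, TwoSided (T p) (φ p) := fun p =>
    Chain.twoSided_nullIn hS_compact.isClosed (exists_sliceChart hS) (hclopen p)
      (Chain.sing_mono (Set.subset_univ _) (Chain.red_mem (ha p)))
      (by rw [← Chain.red_bd]; exact Chain.red_mem (hba p)) (hap p) (Chain.red_mem (hw p)) (hbd p)
  have hφ : ∀ p z z', connectedComponentIn (T p)ᶜ z = connectedComponentIn (T p)ᶜ z' →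
      z ∈ (T p)ᶜ → z' ∈ (T p)ᶜ → (φ p z ↔ φ p z') := fun p z z' h hz hz' =>
    iff_of_connectedComponentIn_eq (hTc p).isOpen_compl (fun v hv =>
      Chain.eventually_nullIn_iff (hTc p) (Chain.red_mem (hw p))
        (by rw [← Chain.red_bd, hbw]; exact Chain.red_mem (hval p))
        (chartAt (EuclideanSpace ℝ (Fin (n + 1))) v) (mem_chart_source _ v) hv) hz hz' h
  have hdisj : ∀ p q, T p = T q ∨ Disjoint (T p) (T q) := by
    intro p q
    by_cases h : connectedComponent p = connectedComponent q
    · exact Or.inl (congrArg (Subtype.val '' ·) h)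
    · exact Or.inr ((Set.disjoint_image_iff Subtype.val_injective).2
        (connectedComponent_disjoint h))
  -- if no component separates, cutting along them one by one never separates `x` from `y`
  by_contra! hno
  have hsame : ∀ p, connectedComponentIn (T p)ᶜ x = connectedComponentIn (T p)ᶜ y := by
    intro p
    by_contra hp
    have hTp : T p = connectedComponentIn S p := (connectedComponentIn_eq_image p.2).symm
    have hsub : Sᶜ ⊆ (T p)ᶜ := Set.compl_subset_compl.2 (hTS p)
    refine hno p p.2 ?_
    rw [← hTp]
    exact ⟨x, hsub hx, y, hsub hy, hK₁x.trans (connectedComponentIn_mono x hsub),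
      hK₂y.trans (connectedComponentIn_mono y hsub), hp⟩
  have hxy : connectedComponent x = connectedComponent y := by
    obtain ⟨p, hp⟩ := hS_nonempty
    have h1 : y ∈ connectedComponentIn (T ⟨p, hp⟩)ᶜ x := by
      rw [hsame]
      exact mem_connectedComponentIn fun h => hy (hTS _ h)
    rw [← connectedComponentIn_univ, ← connectedComponentIn_univ]
    exact connectedComponentIn_eq (connectedComponentIn_mono x (Set.subset_univ _) h1)
  obtain ⟨t, -, ht⟩ := isCompact_univ.elim_nhds_subcover (fun p : S => connectedComponent p)
    fun p _ => (hclopen p).isOpen.mem_nhds mem_connectedComponent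
  have hSt : ⋃ p ∈ t, T p = S := by
    refine Set.Subset.antisymm (Set.iUnion₂_subset fun p _ => hTS p) fun z hz => ?_
    obtain ⟨p, hp, hzp⟩ := Set.mem_iUnion₂.1 (ht (Set.mem_univ (⟨z, hz⟩ : S)))
    exact Set.mem_iUnion₂.2 ⟨p, hp, _, hzp, rfl⟩
  have := connectedComponentIn_compl_biUnion_eq t htwo
    (fun p => isPreconnected_connectedComponent.image _ continuous_subtype_val.continuousOn) hTc
    hdisj hφ (fun p _ h => hx (hTS p h)) (fun p _ h => hy (hTS p h)) hxy fun p _ => hsame p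
  rw [hSt] at this
  exact hne this
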